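/- **Lemma (Uniform equivalence between component and operator norms).** Let $\ell\ge 2$ be an integer and $\rho\in(0,1)$. There is a constant $C>0$ depending only on $\ell$ and $\rho$ such that the following holds for every polygonal domain $\Omega\subset\mathbb R^2$, every polygonal mesh $(\mathcal T_h,\mathcal E_h)$ of $\Omega$ that is regular with parameter $\rho$, and every choice of points $x_T\in T$ ($T\in\mathcal T_h$): for $\bullet=h$ and for $\bullet=T\in\mathcal T_h$, $$C^{-1}\,\|\underline\tau_\bullet\|_{\Sigma,\bullet}\le |||\underline\tau_\bullet|||_{\Sigma,\bullet}\le C\,\|\underline\tau_\bullet\|_{\Sigma,\bullet}\qquad\forall\,\underline\tau_\bullet\in\underline\Sigma_\bullet^\ell .$$ *Mesh.* A polygonal domain is a bounded connected nonempty open set without cracks (equal to the interior of its closure) whose boundary lies in a finite union of segments. A polygonal mesh consists of finitely many disjoint polygonal domains $T\in\mathcal T_h$ with $\overline\Omega=\bigcup_T\overline T$, and finitely many disjoint open segments $E\in\mathcal E_h$ with $\bigcup_T\partial T=\bigcup_E\overline E$, each $E$ being contained either in $\partial T\cap\partial T'$ for two distinct elements or in $\partial T\cap\partial\Omega$ for some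 element. It is regular with parameter $\rho$ if it has a matching simplicial submesh (every triangle is contained in one element, every open triangle side is disjoint from, or contained in, any given $E$) such that each triangle $t$ has inradius at least $\rho h_t$, and $\rho h_T\le h_t$ whenever $t\subset T$; here $h_X$ is the diameter of $X$. $\mathcal E_T$ is the set of the edges contained in $\partial T$, and $\mathcal V_T$ (resp. $\mathcal V_h$) the set of the endpoints of the edges in $\mathcal E_T$ (resp. $\mathcal E_h$); $\mathcal V_E$ is the set of the endpoints of $E$. Each $E$ has a fixed unit tangent $t_E$ and the unit normal $n_E$ such that $(t_E,n_E)$ is right-handed; $\omega_{EV}=+1$ if $t_E$ points towards $V\in\mathcal V_E$ and $-1$ otherwise; $\omega_{TE}\in\{\pm1\}$ is such that $\omega_{TE}n_E$ points out of $T$. *Spaces.* $\mathcal P^m(Y)$ is the space of restrictions to $Y$ of bivariate polynomials of total degree $\le m$, $\mathbb S$ the space of symmetric $2\times2$ matrices, $\mathcal H^m(T)=\nabla^2\mathcal P^{m+2}(T)$, $\mathcal H^{c,m}(T)=\operatorname{sym}\big((x-x_T)^\perp\otimes\mathcal P^{m-1}(T;\mathbb R^2)\big)$, and $\pi^m_{\mathcal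 P,E}$ the $L^2(E)$-orthogonal projector on $\mathcal P^m(E)$. The elements of $\underline\Sigma_T^\ell$ are the families $$\underline\tau_T=\big(\tau_{\mathcal H,T},\tau^c_{\mathcal H,T},(\tau_E,D_{\tau,E})_{E\in\mathcal E_T},(\tau_V)_{V\in\mathcal V_T}\big),$$ $$\tau_{\mathcal H,T}\in\mathcal H^{\ell-3}(T),\quad \tau^c_{\mathcal H,T}\in\mathcal H^{c,\ell}(T),\quad \tau_E\in\mathcal P^{\ell-2}(E),\quad D_{\tau,E}\in\mathcal P^{\ell-1}(E),\quad \tau_V\in\mathbb S,$$ and $\underline\Sigma_h^\ell$ is the analogous global space, with one pair $(\tau_{\mathcal H,T},\tau^c_{\mathcal H,T})$ per element and single-valued components on the edges $\mathcal E_h$ and the vertices $\mathcal V_h$; $\underline\tau_T$ denotes the restriction of $\underline\tau_h$ to $T$. *Reconstructions.* $\mathsf{DD}\,\underline\tau_T\in\mathcal P^{\ell-1}(T)$ is the unique polynomial such that, for all $q\in\mathcal P^{\ell-1}(T)$, $$\int_T \mathsf{DD}\,\underline\tau_T\,q=\int_T\tau_{\mathcal H,T}:\nabla^2q-\sum_{E\in\mathcal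 E_T}\omega_{TE}\sum_{V\in\mathcal V_E}\omega_{EV}(\tau_Vn_E\cdot t_E)\,q(x_V)-\sum_{E\in\mathcal E_T}\omega_{TE}\Big(\int_E\tau_E\,\partial_{n_E}q-\int_ED_{\tau,E}\,q\Big).$$ $P_E\underline\tau_T\in\mathcal P^\ell(E)$ is the unique polynomial with $P_E\underline\tau_T(x_V)=\tau_Vn_E\cdot n_E$ for $V\in\mathcal V_E$ and $\pi^{\ell-2}_{\mathcal P,E}(P_E\underline\tau_T)=\tau_E$. Finally $P_T\underline\tau_T\in\mathcal P^\ell(T;\mathbb S)$ is the unique tensor field such that, for all $q\in\mathcal P^{\ell+2}(T)$ and $\upsilon\in\mathcal H^{c,\ell}(T)$, $$\int_TP_T\underline\tau_T:(\nabla^2q+\upsilon)=\int_T\mathsf{DD}\,\underline\tau_T\,q+\sum_{E\in\mathcal E_T}\omega_{TE}\sum_{V\in\mathcal V_E}\omega_{EV}(\tau_Vn_E\cdot t_E)\,q(x_V)+\sum_{E\in\mathcal E_T}\omega_{TE}\Big(\int_EP_E\underline\tau_T\,\partial_{n_E}q-\int_ED_{\tau,E}\,q\Big)+\int_T\tau^c_{\mathcal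 H,T}:\upsilon.$$ *Norms.* The operator norm is $\|\underline\tau_h\|_{\Sigma,h}^2=\sum_{T}\|\underline\tau_T\|_{\Sigma,T}^2$ with $$\begin{aligned}\|\underline\tau_T\|_{\Sigma,T}^2={}&\|P_T\underline\tau_T\|_{L^2(T)}^2+\sum_{E\in\mathcal E_T}h_T\|P_T\underline\tau_T\,n_E\cdot n_E-P_E\underline\tau_T\|_{L^2(E)}^2\\&+\sum_{E\in\mathcal E_T}h_T^3\|\partial_{t_E}(P_T\underline\tau_T\,n_E\cdot t_E)+(\operatorname{div}P_T\underline\tau_T)\cdot n_E-D_{\tau,E}\|_{L^2(E)}^2+\sum_{V\in\mathcal V_T}h_T^2|P_T\underline\tau_T(x_V)-\tau_V|^2,\end{aligned}$$ with row-wise divergence, and the component norm is $|||\underline\tau_h|||_{\Sigma,h}^2=\sum_T|||\underline\tau_T|||_{\Sigma,T}^2$ with $$|||\underline\tau_T|||_{\Sigma,T}^2=\|\tau_{\mathcal H,T}\|_{L^2(T)}^2+\|\tau^c_{\mathcal H,T}\|_{L^2(T)}^2+\sum_{E\in\mathcal E_T}\big(h_T\|\tau_E\|_{L^2(E)}^2+h_T^3\|D_{\tau,E}\|_{L^2(E)}^2\big)+\sum_{V\in\mathcal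 V_T}h_T^2|\tau_V|^2 .$$ -/

import Mathlib

open scoped Matrix

open Classical in
/-- The unique element satisfying `p` (and `0` if there is no such element, or more than one). -/
noncomputable def PlatesComplex.theUnique {α : Type*} [Zero α] (p : α → Prop) : α :=
  if h : ∃! a, p a then h.exists.choose else 0

theorem PlatesComplex.theUnique_spec {α : Type*} [Zero α] {p : α → Prop} (h : ∃! a, p a) :
    p (PlatesComplex.theUnique p) := by
  unfold PlatesComplex.theUnique
  rw [dif_pos h]
  exact h.exists.choose_spec

namespace PlatesComplex

noncomputable section

/-! ### The plane, bivariate polynomials, tensors -/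

/-- The Euclidean plane. -/
abbrev Plane := EuclideanSpace ℝ (Fin 2)

/-- Real polynomials in two variables. A polynomial on a nonempty open set is identified with the
polynomial function it is the restriction of. -/
abbrev Poly2 := MvPolynomial (Fin 2) ℝ

/-- `2 × 2` tensors with entries in `R`. -/
abbrev Tens (R : Type*) := Matrix (Fin 2) (Fin 2) R

/-- Value of a bivariate polynomial at a point of the plane. -/
def pval (p : Poly2) (x : Plane) : ℝ := MvPolynomial.eval (fun i => x i) p

/-- Value of a polynomial tensor field at a point of the plane. -/
def tval (A : Tens Poly2) (x : Plane) : Tens ℝ := Matrix.of fun i j => pval (A i j) x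

/-- The Frobenius product `A : B`. -/
def ddot {R : Type*} [CommRing R] (A B : Tens R) : R := ∑ i, ∑ j, A i j * B i j

/-- A constant vector, seen as a constant polynomial vector field. -/
def constVec (v : Plane) : Fin 2 → Poly2 := fun i => MvPolynomial.C (v i)

/-- The scalar field `(A u) · v` for a polynomial tensor field `A` and constant vectors `u`, `v`. -/
def tcomp (A : Tens Poly2) (u v : Plane) : Poly2 := (A *ᵥ constVec u) ⬝ᵥ constVec v

/-- The number `(A u) · v` for a constant tensor `A` and vectors `u`, `v`. -/
def vcomp (A : Tens ℝ) (u v : Plane) : ℝ := (A *ᵥ fun i => u i) ⬝ᵥ fun i => v i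

/-- Derivative of a polynomial in the direction of `v`. -/
def dirDeriv (v : Plane) (q : Poly2) : Poly2 :=
  ∑ i, MvPolynomial.C (v i) * MvPolynomial.pderiv i q

/-- The Hessian of a polynomial. -/
def hess (q : Poly2) : Tens Poly2 :=
  Matrix.of fun i j => MvPolynomial.pderiv i (MvPolynomial.pderiv j q)

/-- The row-wise divergence of a polynomial tensor field. -/
def vdiv (A : Tens Poly2) : Fin 2 → Poly2 := fun i => ∑ j, MvPolynomial.pderiv j (A i j)

/-- `P^m(T)`: bivariate polynomials of total degree `≤ m`. -/
def PolyT (m : ℕ) : Set Poly2 := {p | p.totalDegree ≤ m}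

/-- `P^m(T; 𝕊)`: symmetric tensor fields with components in `P^m(T)`. -/
def SymPolyT (m : ℕ) : Set (Tens Poly2) := {A | A.IsSymm ∧ ∀ i j, A i j ∈ PolyT m}

/-- `HESS P^m(T)`, that is the space `H^{m-2}(T)` (which is `{0}` if `m ≤ 1`). -/
def HessPoly (m : ℕ) : Set (Tens Poly2) := {A | ∃ q ∈ PolyT m, A = hess q}

/-- The vector field `(x - x₀)^⊥`, with `(y₁, y₂)^⊥ = (y₂, -y₁)`. -/
def perpField (x₀ : Plane) : Fin 2 → Poly2 :=
  ![MvPolynomial.X 1 - MvPolynomial.C (x₀ 1), -(MvPolynomial.X 0 - MvPolynomial.C (x₀ 0))]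

/-- The symmetric part of a polynomial tensor field. -/
def symPart (A : Tens Poly2) : Tens Poly2 :=
  Matrix.of fun i j => MvPolynomial.C (1 / 2 : ℝ) * (A i j + A j i)

/-- `H^{c,m+1}(T) = SYM ((x - x₀)^⊥ ⊗ P^m(T; ℝ²))`, the complement of `HESS P^{m+3}(T)` in
`P^{m+1}(T; 𝕊)`; the argument `m` is the degree of the vector polynomials. -/
def CHess (x₀ : Plane) (m : ℕ) : Set (Tens Poly2) :=
  {A | ∃ v : Fin 2 → Poly2, (∀ i, v i ∈ PolyT m) ∧
    A = symPart (Matrix.vecMulVec (perpField x₀) v)}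

/-! ### Edges -/

/-- An oriented nondegenerate segment; the orientation goes from `a` to `b`. -/
structure MeshEdge where
  a : Plane
  b : Plane
  ne : a ≠ b

namespace MeshEdge

/-- The edge as an open segment. -/
def carrier (E : MeshEdge) : Set Plane := openSegment ℝ E.a E.b

def length (E : MeshEdge) : ℝ := dist E.a E.b

/-- The unit tangent `t_E`. -/
def tangent (E : MeshEdge) : Plane := (E.length)⁻¹ • (E.b - E.a)

/-- The unit normal `n_E`, such that `(t_E, n_E)` is right-handed. -/
def normal (E : MeshEdge) : Plane := !₂[-(E.tangent 1), E.tangent 0]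

/-- Arclength parametrization, for `s` in `[0, length]`. -/
def point (E : MeshEdge) (s : ℝ) : Plane := E.a + s • E.tangent

/-- The integral over `E` of a function of the arclength. A polynomial on `E` is given by the
univariate polynomial in the arclength (measured from `a`) that it is. -/
def integral (E : MeshEdge) (f : ℝ → ℝ) : ℝ := ∫ s in (0 : ℝ)..E.length, f s

open Classical in
/-- The number `ω_{EV}` for an endpoint `V` of `E`: it is `1` if `t_E` points towards `V`, and `-1`
otherwise. -/
def vertexSign (E : MeshEdge) (V : Plane) : ℝ := if V = E.b then 1 else -1

end MeshEdge

/-- `P^m(E)`. -/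
def PolyE (m : ℕ) : Set (Polynomial ℝ) := {p | p.natDegree ≤ m}

/-- `p` is the `L²(E)`-orthogonal projection of the polynomial `f` on `P^m(E)`. -/
def IsEdgeProj (E : MeshEdge) (m : ℕ) (f p : Polynomial ℝ) : Prop :=
  p ∈ PolyE m ∧ ∀ r ∈ PolyE m,
    E.integral (fun s => p.eval s * r.eval s) = E.integral (fun s => f.eval s * r.eval s)

/-! ### Polygonal elements and the local construction -/

/-- A polygonal domain: a bounded, nonempty, connected open set whose boundary is contained in a
finite union of segments, and that has no cracks. -/
def IsPolygonalDomain (T : Set Plane) : Prop :=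
  IsOpen T ∧ IsConnected T ∧ Bornology.IsBounded T ∧ interior (closure T) = T ∧
    ∃ S : Finset (Plane × Plane), frontier T ⊆ ⋃ p ∈ S, segment ℝ p.1 p.2

/-- The data of an element: the open set, the selected point `x_T`, and the set of edges. -/
structure Element where
  carrier : Set Plane
  center : Plane
  edges : Finset MeshEdge

namespace Element

variable (T : Element)

/-- The diameter `h_T`. -/
def diam : ℝ := Metric.diam T.carrier

open Classical in
/-- The vertices of `T`: the endpoints of its edges. -/
def vertices : Finset Plane := T.edges.image MeshEdge.a ∪ T.edges.image MeshEdge.b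

/-- `n_E` points out of `T`: near some point of `E`, the set `T` is the half-disc on the
side of `E` opposite to `n_E`. -/
def NormalPointsOut (E : MeshEdge) : Prop :=
  ∃ x ∈ E.carrier, ∃ r > 0,
    T.carrier ∩ Metric.ball x r = {y ∈ Metric.ball x r | inner ℝ (y - x) E.normal < 0}

open Classical in
/-- The relative orientation `ω_{TE}`, such that `ω_{TE} n_E` points out of `T`. -/
def orient (E : MeshEdge) : ℝ := if T.NormalPointsOut E then 1 else -1

/-- The integral over `T` of a polynomial. -/
def integral (p : Poly2) : ℝ := ∫ x in T.carrier, pval p x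

variable {T} in
theorem a_mem (E : {E // E ∈ T.edges}) : E.1.a ∈ T.vertices := by
  classical
  exact Finset.mem_union_left _ (Finset.mem_image_of_mem _ E.2)

variable {T} in
theorem b_mem (E : {E // E ∈ T.edges}) : E.1.b ∈ T.vertices := by
  classical
  exact Finset.mem_union_right _ (Finset.mem_image_of_mem _ E.2)

end Element

/-- The local discrete space `Σ_T^ℓ` (for `ℓ ≥ 2`):
`cell ∈ H^{ℓ-3}(T)`, `cellC ∈ H^{c,ℓ}(T)`, `edge E ∈ P^{ℓ-2}(E)` is `τ_E`,
`edgeD E ∈ P^{ℓ-1}(E)` is `D_{τ,E}`, and `vert V ∈ 𝕊` is `τ_V`. -/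
structure LocalSigma (ℓ : ℕ) (T : Element) where
  cell : Tens Poly2
  cell_mem : cell ∈ HessPoly (ℓ - 1)
  cellC : Tens Poly2
  cellC_mem : cellC ∈ CHess T.center (ℓ - 1)
  edge : {E // E ∈ T.edges} → Polynomial ℝ
  edge_mem : ∀ E, edge E ∈ PolyE (ℓ - 2)
  edgeD : {E // E ∈ T.edges} → Polynomial ℝ
  edgeD_mem : ∀ E, edgeD E ∈ PolyE (ℓ - 1)
  vert : {V // V ∈ T.vertices} → Tens ℝ
  vert_symm : ∀ V, (vert V).IsSymm

namespace LocalSigma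

variable {ℓ : ℕ} {T : Element} (τ : LocalSigma ℓ T)

/-- The value `τ_V` at the origin of the edge `E`. -/
def vertA (E : {E // E ∈ T.edges}) : Tens ℝ := τ.vert ⟨E.1.a, Element.a_mem E⟩

/-- The value `τ_V` at the end of the edge `E`. -/
def vertB (E : {E // E ∈ T.edges}) : Tens ℝ := τ.vert ⟨E.1.b, Element.b_mem E⟩

/-- The vertex contribution
`∑_E ω_{TE} ∑_{V ∈ V_E} ω_{EV} (τ_V n_E · t_E) q(x_V)`. -/
def vertexTerm (q : Poly2) : ℝ :=
  ∑ E : {E // E ∈ T.edges}, T.orient E.1 *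
    (E.1.vertexSign E.1.a * (vcomp (τ.vertA E) E.1.normal E.1.tangent * pval q E.1.a)
      + E.1.vertexSign E.1.b * (vcomp (τ.vertB E) E.1.normal E.1.tangent * pval q E.1.b))

/-- The defining property of the discrete div-div operator. -/
def IsDD (d : Poly2) : Prop :=
  d ∈ PolyT (ℓ - 1) ∧ ∀ q ∈ PolyT (ℓ - 1),
    T.integral (d * q) =
      T.integral (ddot τ.cell (hess q)) - τ.vertexTerm q
      - ∑ E : {E // E ∈ T.edges}, T.orient E.1 *
          (E.1.integral (fun s =>
              (τ.edge E).eval s * pval (dirDeriv E.1.normal q) (E.1.point s))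
            - E.1.integral (fun s => (τ.edgeD E).eval s * pval q (E.1.point s)))

/-- The discrete div-div operator with values in `P^{ℓ-1}(T)`. -/
def DD : Poly2 := theUnique τ.IsDD

/-- The defining property of the edge potential. -/
def IsEdgePotential (E : {E // E ∈ T.edges}) (p : Polynomial ℝ) : Prop :=
  p ∈ PolyE ℓ ∧
  p.eval 0 = vcomp (τ.vertA E) E.1.normal E.1.normal ∧
  p.eval E.1.length = vcomp (τ.vertB E) E.1.normal E.1.normal ∧
  IsEdgeProj E.1 (ℓ - 2) p (τ.edge E)

/-- The edge potential `P_{Σ,E}^ℓ τ_E ∈ P^ℓ(E)`. -/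
def edgePotential (E : {E // E ∈ T.edges}) : Polynomial ℝ := theUnique (τ.IsEdgePotential E)

/-- The defining property of the tensor potential. -/
def IsPotential (P : Tens Poly2) : Prop :=
  P ∈ SymPolyT ℓ ∧ ∀ q ∈ PolyT (ℓ + 2), ∀ υ ∈ CHess T.center (ℓ - 1),
    T.integral (ddot P (hess q + υ)) =
      T.integral (τ.DD * q) + τ.vertexTerm q
      + ∑ E : {E // E ∈ T.edges}, T.orient E.1 *
          (E.1.integral (fun s =>
              (τ.edgePotential E).eval s * pval (dirDeriv E.1.normal q) (E.1.point s))
            - E.1.integral (fun s => (τ.edgeD E).eval s * pval q (E.1.point s)))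
      + T.integral (ddot τ.cellC υ)

/-- The tensor potential `P_{Σ,T}^ℓ τ_T ∈ P^ℓ(T; 𝕊)`. -/
def potential : Tens Poly2 := theUnique τ.IsPotential

/-- `P_{Σ,T} τ_T n_E · n_E - P_{Σ,E} τ_E`, as a function of the arclength on `E`. -/
def normalDefect (E : {E // E ∈ T.edges}) (s : ℝ) : ℝ :=
  pval (tcomp τ.potential E.1.normal E.1.normal) (E.1.point s) - (τ.edgePotential E).eval s

/-- `∂_{t_E} (P_{Σ,T} τ_T n_E · t_E) + VDIV P_{Σ,T} τ_T · n_E - D_{τ,E}`, as a function of the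
arclength on `E`. -/
def shearDefect (E : {E // E ∈ T.edges}) (s : ℝ) : ℝ :=
  pval (dirDeriv E.1.tangent (tcomp τ.potential E.1.normal E.1.tangent)
    + vdiv τ.potential ⬝ᵥ constVec E.1.normal) (E.1.point s) - (τ.edgeD E).eval s

/-- `P_{Σ,T} τ_T (x_V) - τ_V`. -/
def vertexDefect (V : {V // V ∈ T.vertices}) : Tens ℝ := tval τ.potential V.1 - τ.vert V

/-- The stabilization bilinear form `s_{Σ,T}`. -/
def stab (υ τ : LocalSigma ℓ T) : ℝ :=
  ∑ E : {E // E ∈ T.edges},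
      T.diam * E.1.integral (fun s => υ.normalDefect E s * τ.normalDefect E s)
  + ∑ E : {E // E ∈ T.edges},
      T.diam ^ 3 * E.1.integral (fun s => υ.shearDefect E s * τ.shearDefect E s)
  + ∑ V : {V // V ∈ T.vertices}, T.diam ^ 2 * ddot (υ.vertexDefect V) (τ.vertexDefect V)

/-- The local discrete `L²`-product. -/
def prod (υ τ : LocalSigma ℓ T) : ℝ :=
  T.integral (ddot υ.potential τ.potential) + stab υ τ

/-- The local operator norm `‖τ_T‖_{Σ,T}`. -/
def opNorm : ℝ := Real.sqrt (prod τ τ)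

/-- The square of the local component norm. -/
def compNormSq : ℝ :=
  T.integral (ddot τ.cell τ.cell) + T.integral (ddot τ.cellC τ.cellC)
  + ∑ E : {E // E ∈ T.edges},
      (T.diam * E.1.integral (fun s => (τ.edge E).eval s ^ 2)
        + T.diam ^ 3 * E.1.integral (fun s => (τ.edgeD E).eval s ^ 2))
  + ∑ V : {V // V ∈ T.vertices}, T.diam ^ 2 * ddot (τ.vert V) (τ.vert V)

/-- The local component norm `|||τ_T|||_{Σ,T}`. -/
def compNorm : ℝ := Real.sqrt τ.compNormSq

end LocalSigma

/-! ### Polygonal meshes and the global construction -/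

/-- A polygonal mesh of `Ω`: disjoint polygonal elements covering `Ω`, and disjoint edges (open
segments) that partition the skeleton, each being either an interface between two distinct elements
or a boundary edge. Elements may have hanging nodes and flat angles. -/
structure PolygonalMesh (Ω : Set Plane) where
  elems : Finset (Set Plane)
  edges : Finset MeshEdge
  elem_polygonal : ∀ T ∈ elems, IsPolygonalDomain T
  elem_disjoint : ∀ T ∈ elems, ∀ T' ∈ elems, T ≠ T' → Disjoint T T'
  closure_eq : closure Ω = ⋃ T ∈ elems, closure T
  edge_disjoint : ∀ E ∈ edges, ∀ E' ∈ edges, E ≠ E' → Disjoint E.carrier E'.carrier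
  edge_interface_or_boundary : ∀ E ∈ edges,
    (∃ T ∈ elems, ∃ T' ∈ elems, T ≠ T' ∧ E.carrier ⊆ frontier T ∩ frontier T') ∨
    (∃ T ∈ elems, E.carrier ⊆ frontier T ∩ frontier Ω)
  skeleton_eq : (⋃ T ∈ elems, frontier T) = ⋃ E ∈ edges, closure E.carrier

/-- The inradius of a set: the supremum of the radii of the discs it contains. -/
def inradius (S : Set Plane) : ℝ := sSup {r : ℝ | ∃ c, Metric.closedBall c r ⊆ S}

namespace PolygonalMesh

variable {Ω : Set Plane} (M : PolygonalMesh Ω)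

open Classical in
/-- The set `V_h` of edge endpoints. -/
def vertices : Finset Plane := M.edges.image MeshEdge.a ∪ M.edges.image MeshEdge.b

open Classical in
/-- The element `T`, with the selected point `x_T` and the edges contained in its boundary. -/
def element (x : {T // T ∈ M.elems} → Plane) (T : {T // T ∈ M.elems}) : Element where
  carrier := T.1
  center := x T
  edges := M.edges.filter (fun E => E.carrier ⊆ frontier T.1)

variable {M} in
theorem mem_edges {x : {T // T ∈ M.elems} → Plane} {T : {T // T ∈ M.elems}} {E : MeshEdge}
    (h : E ∈ (M.element x T).edges) : E ∈ M.edges := by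
  classical
  exact (Finset.mem_filter.1 h).1

variable {M} in
theorem mem_vertices {x : {T // T ∈ M.elems} → Plane} {T : {T // T ∈ M.elems}} {V : Plane}
    (h : V ∈ (M.element x T).vertices) : V ∈ M.vertices := by
  classical
  exact Finset.union_subset_union (Finset.image_subset_image fun _ => mem_edges)
    (Finset.image_subset_image fun _ => mem_edges) h

/-- `K` is a matching simplicial submesh of `M`: a finite pure two-dimensional simplicial complex
triangulating `closure Ω`, each triangle being contained in one element, and each open triangle
side being either disjoint from or contained in any given mesh edge. -/
structure IsMatchingSubmesh (K : Geometry.SimplicialComplex ℝ Plane) : Prop where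
  finite : K.faces.Finite
  pure : ∀ s ∈ K.faces, ∃ t ∈ K.faces, t.card = 3 ∧ s ⊆ t
  space_eq : K.space = closure Ω
  triangle_sub : ∀ t ∈ K.faces, t.card = 3 →
    ∃ T ∈ M.elems, interior (convexHull ℝ (t : Set Plane)) ⊆ T
  side_sub : ∀ y z : Plane, y ≠ z →
    (∃ s ∈ K.faces, (s : Set Plane) = {y, z}) → ∀ E ∈ M.edges,
      Disjoint (openSegment ℝ y z) E.carrier ∨ openSegment ℝ y z ⊆ E.carrier

/-- `M` is regular with mesh regularity parameter `ρ`: it has a matching simplicial submesh such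
that `ρ h_t ≤ r_t` for every triangle `t` (with `h_t` its diameter and `r_t` its inradius), and
`ρ h_T ≤ h_t` for every triangle `t` contained in the element `T`. -/
def IsRegular (ρ : ℝ) : Prop :=
  ∃ K : Geometry.SimplicialComplex ℝ Plane, M.IsMatchingSubmesh K ∧
    (∀ t ∈ K.faces, t.card = 3 →
      ρ * Metric.diam (convexHull ℝ (t : Set Plane)) ≤ inradius (convexHull ℝ (t : Set Plane))) ∧
    (∀ T ∈ M.elems, ∀ t ∈ K.faces, t.card = 3 → interior (convexHull ℝ (t : Set Plane)) ⊆ T →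
      ρ * Metric.diam T ≤ Metric.diam (convexHull ℝ (t : Set Plane)))

end PolygonalMesh

/-- The global discrete space `Σ_h^ℓ` (for `ℓ ≥ 2`), with single-valued edge and vertex
components. -/
structure GlobalSigma (ℓ : ℕ) {Ω : Set Plane} (M : PolygonalMesh Ω)
    (x : {T // T ∈ M.elems} → Plane) where
  cell : {T // T ∈ M.elems} → Tens Poly2
  cell_mem : ∀ T, cell T ∈ HessPoly (ℓ - 1)
  cellC : {T // T ∈ M.elems} → Tens Poly2
  cellC_mem : ∀ T, cellC T ∈ CHess (x T) (ℓ - 1)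
  edge : {E // E ∈ M.edges} → Polynomial ℝ
  edge_mem : ∀ E, edge E ∈ PolyE (ℓ - 2)
  edgeD : {E // E ∈ M.edges} → Polynomial ℝ
  edgeD_mem : ∀ E, edgeD E ∈ PolyE (ℓ - 1)
  vert : {V // V ∈ M.vertices} → Tens ℝ
  vert_symm : ∀ V, (vert V).IsSymm

namespace GlobalSigma

variable {ℓ : ℕ} {Ω : Set Plane} {M : PolygonalMesh Ω} {x : {T // T ∈ M.elems} → Plane}

/-- The restriction `τ_T` of `τ_h` to the element `T`. -/
def restrict (τ : GlobalSigma ℓ M x) (T : {T // T ∈ M.elems}) :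
    LocalSigma ℓ (M.element x T) where
  cell := τ.cell T
  cell_mem := τ.cell_mem T
  cellC := τ.cellC T
  cellC_mem := τ.cellC_mem T
  edge E := τ.edge ⟨E.1, PolygonalMesh.mem_edges E.2⟩
  edge_mem _ := τ.edge_mem _
  edgeD E := τ.edgeD ⟨E.1, PolygonalMesh.mem_edges E.2⟩
  edgeD_mem _ := τ.edgeD_mem _
  vert V := τ.vert ⟨V.1, PolygonalMesh.mem_vertices V.2⟩
  vert_symm _ := τ.vert_symm _

/-- The global discrete `L²`-product. -/
def prod (υ τ : GlobalSigma ℓ M x) : ℝ :=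
  ∑ T : {T // T ∈ M.elems}, LocalSigma.prod (υ.restrict T) (τ.restrict T)

/-- The global operator norm `‖τ_h‖_{Σ,h}`. -/
def opNorm (τ : GlobalSigma ℓ M x) : ℝ := Real.sqrt (prod τ τ)

/-- The global component norm `|||τ_h|||_{Σ,h}`. -/
def compNorm (τ : GlobalSigma ℓ M x) : ℝ :=
  Real.sqrt (∑ T : {T // T ∈ M.elems}, (τ.restrict T).compNorm ^ 2)

end GlobalSigma

end

end PlatesComplex

/-! Everything is measured in a norm that does not see the shape of the element: the ℓ¹ norm of the
coefficients of a polynomial once the disc of centre `x_T` and radius `h_T` has been rescaled to the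
unit disc (`discNorm`, `tensNorm`). It is submultiplicative, dominates point values on the disc, and
a derivative costs a factor of order `1 / h_T`, all with explicit constants. Compactness enters only
on fixed domains, the unit disc and the unit interval, and is transported by scaling. If the element
contains a disc of radius comparable to `h_T`, its L² norm controls `h_T` times this norm
(`exists_discNorm_sq_le`).

The operator norm is bounded by testing the reconstructions with themselves. This works directly for
`DD` (`exists_DD_le`). The edge potential is an explicit affine-plus-bubble interpolant
(`exists_edge_interpolant`). The tensor potential must first be split as `∇²q + υ` with bounds on
both `q` and `υ` (`exists_stable_decomposition`). The splitting is algebraic: with the centre at the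
origin, `x · (∇²q) x = E(E - 1)q` for the Euler operator `E`, which is diagonal on monomials, so `q`
can be chosen to match `x · A x`; a symmetric field with `x · A x = 0` is of the form `sym (x^⊥ ⊗
v)` by divisibility.

Conversely, the two cell components are L² projections of the tensor potential and `τ_E` is one of
the edge potential, so none of them is larger than the potential it comes from. The remaining
components, and the edge potential, are traces of the tensor potential minus the defects that the
operator norm contains.

The geometry enters through `isShapeRegular_element`: a triangle of the submesh supplies the inner
disc, and comparing areas bounds the number of triangles, hence of edges, of an element. The global
estimate is the sum of the local ones. -/

namespace PlatesComplex

/-! ### The ℓ¹ norm of the coefficients of a bivariate polynomial. -/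

open MvPolynomial

/-- The sum of the absolute values of the coefficients of a bivariate polynomial. -/
noncomputable def coeffNorm (p : Poly2) : ℝ := ∑ α ∈ p.support, |p.coeff α|

theorem coeffNorm_nonneg (p : Poly2) : 0 ≤ coeffNorm p := Finset.sum_nonneg fun _ _ => abs_nonneg _

theorem coeffNorm_eq_sum {p : Poly2} {S : Finset (Fin 2 →₀ ℕ)} (h : p.support ⊆ S) :
    coeffNorm p = ∑ α ∈ S, |p.coeff α| :=
  Finset.sum_subset h fun α _ hα => by simpa using hα

theorem coeffNorm_zero : coeffNorm 0 = 0 := by simp [coeffNorm]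

theorem coeffNorm_eq_zero {p : Poly2} (h : coeffNorm p = 0) : p = 0 := by
  ext α
  by_cases hα : α ∈ p.support
  · have := (Finset.sum_eq_zero_iff_of_nonneg (fun _ _ => abs_nonneg _)).1 h α hα
    simpa using this
  · simpa using hα

theorem coeffNorm_add_le (p q : Poly2) : coeffNorm (p + q) ≤ coeffNorm p + coeffNorm q := by
  classical
  rw [coeffNorm_eq_sum (support_add (p := p) (q := q)),
    coeffNorm_eq_sum (Finset.subset_union_left (s₁ := p.support) (s₂ := q.support)),
    coeffNorm_eq_sum (Finset.subset_union_right (s₁ := p.support) (s₂ := q.support)),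
    ← Finset.sum_add_distrib]
  exact Finset.sum_le_sum fun α _ => by rw [coeff_add]; exact abs_add_le _ _

theorem coeffNorm_sum_le {ι : Type*} (S : Finset ι) (f : ι → Poly2) :
    coeffNorm (∑ i ∈ S, f i) ≤ ∑ i ∈ S, coeffNorm (f i) := by
  classical
  induction S using Finset.induction_on with
  | empty => simp [coeffNorm_zero]
  | insert a S ha ih =>
    rw [Finset.sum_insert ha, Finset.sum_insert ha]
    exact (coeffNorm_add_le _ _).trans (by gcongr)

theorem coeffNorm_monomial (α : Fin 2 →₀ ℕ) (a : ℝ) : coeffNorm (monomial α a) = |a| := by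
  classical
  rw [coeffNorm_eq_sum (support_monomial_subset)]
  simp

theorem coeffNorm_C (a : ℝ) : coeffNorm (C a) = |a| := coeffNorm_monomial 0 a

theorem coeffNorm_X (i : Fin 2) : coeffNorm (X i) = 1 :=
  (coeffNorm_monomial (Finsupp.single i 1) 1).trans abs_one

/-- Coefficients multiply by convolution, and ℓ¹ is a convolution algebra. This is why the ℓ¹ norm
is preferred to the other norms on coefficients. -/
theorem coeffNorm_mul_le (p q : Poly2) : coeffNorm (p * q) ≤ coeffNorm p * coeffNorm q := by
  conv_lhs => rw [p.as_sum, q.as_sum, Finset.sum_mul_sum]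
  refine (coeffNorm_sum_le _ _).trans ?_
  rw [coeffNorm, coeffNorm, Finset.sum_mul_sum]
  refine Finset.sum_le_sum fun α _ => (coeffNorm_sum_le _ _).trans (Finset.sum_le_sum fun β _ => ?_)
  rw [monomial_mul, coeffNorm_monomial, abs_mul]

theorem coeffNorm_C_mul_le (a : ℝ) (p : Poly2) : coeffNorm (C a * p) ≤ |a| * coeffNorm p :=
  (coeffNorm_mul_le _ _).trans_eq (by rw [coeffNorm_C])

theorem coeffNorm_neg (p : Poly2) : coeffNorm (-p) = coeffNorm p := by
  simp [coeffNorm, support_neg]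

theorem coeffNorm_pow_le (p : Poly2) (n : ℕ) : coeffNorm (p ^ n) ≤ coeffNorm p ^ n := by
  induction n with
  | zero => simpa using (coeffNorm_C 1).le
  | succ n ih =>
    rw [pow_succ, pow_succ]
    exact (coeffNorm_mul_le _ _).trans (mul_le_mul_of_nonneg_right ih (coeffNorm_nonneg _))

theorem abs_eval_le_coeffNorm (p : Poly2) {y : Fin 2 → ℝ} (hy : ∀ i, |y i| ≤ 1) :
    |eval y p| ≤ coeffNorm p := by
  rw [eval_eq']
  refine (Finset.abs_sum_le_sum_abs _ _).trans (Finset.sum_le_sum fun α _ => ?_)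
  rw [abs_mul, Finset.abs_prod]
  refine mul_le_of_le_one_right (abs_nonneg _) (Finset.prod_le_one (fun _ _ => abs_nonneg _) ?_)
  intro i _
  rw [abs_pow]
  exact pow_le_one₀ (abs_nonneg _) (hy i)

theorem sum_le_of_mem_support {p : Poly2} {m : ℕ} (hp : p ∈ PolyT m) {α : Fin 2 →₀ ℕ}
    (hα : α ∈ p.support) : α 0 + α 1 ≤ m := by
  have := (le_totalDegree hα).trans hp
  rwa [Finsupp.sum_fintype _ _ (fun _ => rfl), Fin.sum_univ_two] at this

/-- Differentiation shifts the monomials and multiplies each coefficient by an exponent, which is at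
most `m`. After rescaling this is the inverse inequality for derivatives. -/
theorem coeffNorm_pderiv_le {p : Poly2} {m : ℕ} (hp : p ∈ PolyT m) (i : Fin 2) :
    coeffNorm (pderiv i p) ≤ m * coeffNorm p := by
  conv_lhs => rw [p.as_sum, map_sum]
  refine (coeffNorm_sum_le _ _).trans ?_
  rw [coeffNorm, Finset.mul_sum]
  refine Finset.sum_le_sum fun α hα => ?_
  rw [pderiv_monomial, coeffNorm_monomial, abs_mul, mul_comm, Nat.abs_cast]
  have := sum_le_of_mem_support hp hα
  have h2 : α i ≤ m := by fin_cases i <;> simp <;> omega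
  gcongr

/-- A monomial becomes a product of at most `m` factors of norm at most `R`; `1 ≤ R` allows the
exponent to be raised to `m`. Used to compare two discs. -/
theorem coeffNorm_aeval_le {p : Poly2} {m : ℕ} (hp : p ∈ PolyT m) {f : Fin 2 → Poly2} {R : ℝ}
    (hR : 1 ≤ R) (hf : ∀ i, coeffNorm (f i) ≤ R) :
    coeffNorm (aeval f p) ≤ R ^ m * coeffNorm p := by
  rw [aeval_def, eval₂_eq', coeffNorm.eq_def p, Finset.mul_sum]
  refine (coeffNorm_sum_le _ _).trans (Finset.sum_le_sum fun α hα => ?_)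
  rw [mul_comm, Fin.prod_univ_two]
  have hR0 : 0 ≤ R := zero_le_one.trans hR
  have h1 : ∀ i, coeffNorm (f i ^ α i) ≤ R ^ α i := fun i =>
    (coeffNorm_pow_le _ _).trans (pow_le_pow_left₀ (coeffNorm_nonneg _) (hf i) _)
  calc coeffNorm (f 0 ^ α 0 * f 1 ^ α 1 * algebraMap ℝ Poly2 (p.coeff α))
      ≤ coeffNorm (f 0 ^ α 0) * coeffNorm (f 1 ^ α 1) * |p.coeff α| := by
        refine (coeffNorm_mul_le _ _).trans ?_
        rw [algebraMap_eq, coeffNorm_C]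
        exact mul_le_mul_of_nonneg_right (coeffNorm_mul_le _ _) (abs_nonneg _)
    _ ≤ R ^ α 0 * R ^ α 1 * |p.coeff α| := by
        refine mul_le_mul_of_nonneg_right ?_ (abs_nonneg _)
        exact mul_le_mul (h1 0) (h1 1) (coeffNorm_nonneg _) (by positivity)
    _ ≤ R ^ m * |p.coeff α| := by
        rw [← pow_add]
        exact mul_le_mul_of_nonneg_right (pow_le_pow_right₀ hR (sum_le_of_mem_support hp hα))
          (abs_nonneg _)

/-! ### Degrees of sums, products, derivatives and affine substitutions. -/

theorem mem_PolyT_iff {p : Poly2} {m : ℕ} :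
    p ∈ PolyT m ↔ ∀ α, p.coeff α ≠ 0 → α 0 + α 1 ≤ m := by
  constructor
  · exact fun hp α hα => sum_le_of_mem_support hp (mem_support_iff.2 hα)
  · intro h
    change p.support.sup (fun s => s.sum fun _ e => e) ≤ m
    refine Finset.sup_le fun α hα => ?_
    rw [Finsupp.sum_fintype _ _ (fun _ => rfl), Fin.sum_univ_two]
    exact h α (mem_support_iff.1 hα)

theorem pderiv_mem_PolyT {p : Poly2} {m : ℕ} (hp : p ∈ PolyT m) (i : Fin 2) :
    pderiv i p ∈ PolyT (m - 1) := by
  rw [mem_PolyT_iff] at hp ⊢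
  intro α hα
  rw [coeff_pderiv] at hα
  have := hp _ (left_ne_zero_of_mul hα)
  fin_cases i <;> simp at this <;> omega

theorem PolyT_mono {m n : ℕ} (h : m ≤ n) : PolyT m ⊆ PolyT n := fun _ hp => le_trans hp h

theorem add_mem_PolyT {p q : Poly2} {m : ℕ} (hp : p ∈ PolyT m) (hq : q ∈ PolyT m) :
    p + q ∈ PolyT m := (totalDegree_add p q).trans (max_le hp hq)

theorem sub_mem_PolyT {p q : Poly2} {m : ℕ} (hp : p ∈ PolyT m) (hq : q ∈ PolyT m) :
    p - q ∈ PolyT m := (totalDegree_sub p q).trans (max_le hp hq)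

theorem neg_mem_PolyT {p : Poly2} {m : ℕ} (hp : p ∈ PolyT m) : -p ∈ PolyT m :=
  (totalDegree_neg p).trans_le hp

theorem sum_mem_PolyT {ι : Type*} {S : Finset ι} {f : ι → Poly2} {m : ℕ}
    (h : ∀ i ∈ S, f i ∈ PolyT m) : ∑ i ∈ S, f i ∈ PolyT m := totalDegree_finsetSum_le h

theorem mul_mem_PolyT {p q : Poly2} {m n : ℕ} (hp : p ∈ PolyT m) (hq : q ∈ PolyT n) :
    p * q ∈ PolyT (m + n) := (totalDegree_mul p q).trans (add_le_add hp hq)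

theorem C_mem_PolyT (a : ℝ) (m : ℕ) : (C a : Poly2) ∈ PolyT m :=
  (totalDegree_C a).trans_le (Nat.zero_le _)

theorem zero_mem_PolyT (m : ℕ) : (0 : Poly2) ∈ PolyT m :=
  totalDegree_zero.trans_le (Nat.zero_le _)

theorem C_mul_mem_PolyT {p : Poly2} {m : ℕ} (a : ℝ) (hp : p ∈ PolyT m) :
    C a * p ∈ PolyT m := by simpa using mul_mem_PolyT (C_mem_PolyT a 0) hp

theorem X_mem_PolyT (i : Fin 2) : (X i : Poly2) ∈ PolyT 1 := (totalDegree_X i).le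

theorem aeval_mem_PolyT {p : Poly2} {m : ℕ} (hp : p ∈ PolyT m) {f : Fin 2 → Poly2}
    (hf : ∀ i, f i ∈ PolyT 1) : aeval f p ∈ PolyT m := by
  rw [aeval_def, eval₂_eq']
  refine sum_mem_PolyT fun α hα => ?_
  refine C_mul_mem_PolyT _ (PolyT_mono (sum_le_of_mem_support hp hα) ?_)
  rw [Fin.prod_univ_two]
  have h1 : ∀ i, f i ^ α i ∈ PolyT (α i) := fun i =>
    (totalDegree_pow _ _).trans (by simpa using Nat.mul_le_mul_left (α i) (hf i))
  exact mul_mem_PolyT (h1 0) (h1 1)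

/-! ### Hessians, their complement, and the radial part of a tensor field. -/

theorem pderiv_comm (i j : Fin 2) (p : Poly2) :
    pderiv i (pderiv j p) = pderiv j (pderiv i p) := by
  ext α
  simp only [coeff_pderiv]
  rw [add_right_comm]
  rcases eq_or_ne i j with rfl | h
  · rfl
  · simp [h, h.symm]
    ring

theorem hess_isSymm (q : Poly2) : (hess q).IsSymm :=
  Matrix.IsSymm.ext fun i j => pderiv_comm j i q

/-- The Euler operator. -/
noncomputable def euler (q : Poly2) : Poly2 := X 0 * pderiv 0 q + X 1 * pderiv 1 q

/-- Each `X i * ∂ᵢ` multiplies a monomial by its exponent in the variable `i`. -/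
theorem coeff_euler (q : Poly2) (α : Fin 2 →₀ ℕ) :
    coeff α (euler q) = ((α 0 + α 1 : ℕ) : ℝ) * coeff α q := by
  classical
  induction q using MvPolynomial.induction_on' with
  | monomial β b =>
    rw [euler, X_mul_pderiv_monomial, X_mul_pderiv_monomial, coeff_add, coeff_smul, coeff_smul]
    by_cases h : β = α
    · subst h; simp [add_mul]
    · simp [h]
  | add p q hp hq =>
    have : euler (p + q) = euler p + euler q := by simp [euler]; ring
    rw [this, coeff_add, coeff_add, hp, hq]
    ring

/-- The quadratic form of a tensor field in the position vector. -/
noncomputable def radial (A : Tens Poly2) : Poly2 := ∑ i, ∑ j, X i * X j * A i j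

/-- By the product rule, applying the Euler operator twice gives the quadratic form of the Hessian
plus one first-order term. On monomials of degree `n` the result is `n(n - 1)`, which vanishes only
for affine functions. -/
theorem radial_hess (q : Poly2) : radial (hess q) = euler (euler q) - euler q := by
  have h01 := pderiv_comm 0 1 q
  simp only [radial, hess, Fin.sum_univ_two, Matrix.of_apply, euler, map_add, pderiv_mul,
    pderiv_X_self, pderiv_X_of_ne (show (1 : Fin 2) ≠ 0 by decide),
    pderiv_X_of_ne (show (0 : Fin 2) ≠ 1 by decide), h01]
  ring

theorem coeff_radial_hess (q : Poly2) (α : Fin 2 →₀ ℕ) :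
    coeff α (radial (hess q)) =
      ((α 0 + α 1 : ℕ) : ℝ) * (((α 0 + α 1 : ℕ) : ℝ) - 1) * coeff α q := by
  rw [radial_hess, coeff_sub, coeff_euler, coeff_euler]
  ring

/-- A polynomial whose Hessian has vanishing radial part is affine. -/
theorem mem_PolyT_one_of_radial_hess {q : Poly2} (h : radial (hess q) = 0) : q ∈ PolyT 1 := by
  rw [mem_PolyT_iff]
  intro α hα
  have := coeff_radial_hess q α
  rw [h, coeff_zero] at this
  by_contra hlt
  have h2 : (2 : ℝ) ≤ ((α 0 + α 1 : ℕ) : ℝ) := by exact_mod_cast (by omega : 2 ≤ α 0 + α 1)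
  have h3 := (mul_eq_zero.1 this.symm).resolve_right hα
  rcases mul_eq_zero.1 h3 with h4 | h4 <;> linarith

theorem hess_eq_zero_of_mem_PolyT_one {q : Poly2} (h : q ∈ PolyT 1) : hess q = 0 := by
  ext i j : 2
  have h1 : pderiv j q ∈ PolyT 0 := pderiv_mem_PolyT h j
  have h2 := totalDegree_eq_zero_iff_eq_C.1 (Nat.le_zero.1 h1)
  rw [hess, Matrix.of_apply, h2, pderiv_C, Matrix.zero_apply]

/-- Every quadratic multiple of a polynomial is the radial part of a Hessian. -/
theorem exists_euler_eq (f : Poly2) : ∃ g : Poly2, g.support ⊆ f.support ∧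
    coeffNorm g ≤ coeffNorm f ∧ ∀ i j, radial (hess (X i * X j * g)) = X i * X j * f := by
  -- The eigenvalue `n(n - 1)` at `n = |α| + 2`, because multiplication by `X i * X j` raises the
  -- degree by two. It is at least 1, so dividing by it does not increase coefficients.
  set c : (Fin 2 →₀ ℕ) → ℝ := fun α => ((α 0 + α 1 + 2 : ℕ) : ℝ) * ((α 0 + α 1 + 1 : ℕ) : ℝ)
    with hc
  have hc1 : ∀ α, 1 ≤ c α := fun α => by
    simp only [hc]
    exact_mod_cast Nat.mul_pos (by omega) (by omega)
  have hcoeff : ∀ α, coeff α (∑ β ∈ f.support, monomial β (f.coeff β / c β)) = f.coeff α / c α := by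
    classical
    intro α
    simp only [coeff_sum, coeff_monomial]
    by_cases h : α ∈ f.support
    · rw [Finset.sum_ite_eq' f.support α, if_pos h]
    · rw [Finset.sum_ite_eq' f.support α, if_neg h]
      simp [notMem_support_iff.1 h]
  have hsupp : (∑ β ∈ f.support, monomial β (f.coeff β / c β)).support ⊆ f.support := by
    intro α hα
    rw [mem_support_iff, hcoeff] at hα
    rw [mem_support_iff]
    rintro h
    simp [h] at hα
  refine ⟨∑ β ∈ f.support, monomial β (f.coeff β / c β), hsupp, ?_, fun i j => ?_⟩
  · rw [coeffNorm_eq_sum hsupp, coeffNorm]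
    refine Finset.sum_le_sum fun α _ => ?_
    rw [hcoeff, abs_div]
    exact div_le_self (abs_nonneg _) ((hc1 α).trans (le_abs_self _))
  · ext α
    rw [coeff_radial_hess]
    have hX : ∀ g : Poly2, X i * X j * g =
        monomial (Finsupp.single i 1 + Finsupp.single j 1) 1 * g := fun g => by
      rw [X, X, monomial_mul, one_mul]
    rw [hX, hX, coeff_monomial_mul', coeff_monomial_mul']
    split_ifs with h
    · obtain ⟨β, rfl⟩ := exists_add_of_le h
      rw [add_tsub_cancel_left, hcoeff]
      have : (Finsupp.single i 1 + Finsupp.single j 1 + β : Fin 2 →₀ ℕ) 0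
          + (Finsupp.single i 1 + Finsupp.single j 1 + β : Fin 2 →₀ ℕ) 1 = β 0 + β 1 + 2 := by
        fin_cases i <;> fin_cases j <;> simp <;> omega
      rw [this]
      have h0 : c β ≠ 0 := (zero_lt_one.trans_le (hc1 β)).ne'
      field_simp
      simp only [hc]
      push_cast
      ring
    · simp

theorem radial_sub (A B : Tens Poly2) : radial (A - B) = radial A - radial B := by
  simp [radial, mul_sub]

theorem hess_sum {ι : Type*} (S : Finset ι) (f : ι → Poly2) :
    hess (∑ i ∈ S, f i) = ∑ i ∈ S, hess (f i) := by
  ext i j : 2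
  simp [hess, Matrix.sum_apply]

theorem radial_sum {ι : Type*} (S : Finset ι) (f : ι → Tens Poly2) :
    radial (∑ i ∈ S, f i) = ∑ i ∈ S, radial (f i) := by
  simp only [radial, Matrix.sum_apply, Finset.mul_sum, Fin.sum_univ_two, Finset.sum_add_distrib]

/-- A symmetric tensor field with vanishing radial part is the symmetric part of a product with
the rotated position vector. -/
theorem exists_symPart_eq {A : Tens Poly2} (hA : A.IsSymm) (h0 : radial A = 0) {m : ℕ}
    (hm : ∀ i j, A i j ∈ PolyT (m + 1)) :
    ∃ v : Fin 2 → Poly2, (∀ i, v i ∈ PolyT m) ∧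
      A = symPart (Matrix.vecMulVec ![X 1, -X 0] v) := by
  have h10 : A 1 0 = A 0 1 := hA.apply 0 1
  simp only [radial, Fin.sum_univ_two, h10] at h0
  have key : X 0 * X 0 * A 0 0 + 2 * (X 0 * X 1 * A 0 1) + X 1 * X 1 * A 1 1 = 0 := by
    rw [← h0]; ring
  -- In `key`, two of the three terms contain a given variable, so this variable divides the third.
  -- As the two variables are non-associated primes, `X 0` divides `A 1 1` and `X 1` divides `A 0
  -- 0`.
  have n01 : ¬ (X 0 : Poly2) ∣ X 1 := by rw [X_dvd_X]; decide
  have n10 : ¬ (X 1 : Poly2) ∣ X 0 := by rw [X_dvd_X]; decide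
  have p0 : Prime (X 0 : Poly2) := X_prime
  have p1 : Prime (X 1 : Poly2) := X_prime
  have d0 : (X 0 : Poly2) ∣ A 1 1 := by
    have : (X 0 : Poly2) ∣ X 1 * X 1 * A 1 1 :=
      ⟨-(X 0 * A 0 0 + 2 * (X 1 * A 0 1)), by linear_combination key⟩
    rcases p0.dvd_or_dvd this with h | h
    · rcases p0.dvd_or_dvd h with h | h <;> exact absurd h n01
    · exact h
  have d1 : (X 1 : Poly2) ∣ A 0 0 := by
    have : (X 1 : Poly2) ∣ X 0 * X 0 * A 0 0 :=
      ⟨-(X 1 * A 1 1 + 2 * (X 0 * A 0 1)), by linear_combination key⟩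
    rcases p1.dvd_or_dvd this with h | h
    · rcases p1.dvd_or_dvd h with h | h <;> exact absurd h n10
    · exact h
  obtain ⟨b, hb⟩ := d0
  obtain ⟨a, ha⟩ := d1
  have hdeg : ∀ (i : Fin 2) (f g : Poly2), f = X i * g → f ∈ PolyT (m + 1) → g ∈ PolyT m := by
    intro i f g hfg hf
    by_cases hg : g = 0
    · rw [hg]; exact zero_mem_PolyT m
    · have : f.totalDegree ≤ m + 1 := hf
      rw [hfg, totalDegree_mul_of_isDomain (X_ne_zero i) hg, totalDegree_X] at this
      change g.totalDegree ≤ m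
      omega
  -- The diagonal of the symmetric part is `X 1 * v 0` and `-(X 0 * v 1)`, which forces `v`; the
  -- off-diagonal entry then follows from `key` after cancelling `X 0 * X 1`.
  refine ⟨![a, -b], fun i => ?_, ?_⟩
  · fin_cases i
    · exact hdeg 1 _ _ ha (hm 0 0)
    · exact neg_mem_PolyT (hdeg 0 _ _ hb (hm 1 1))
  · have h2 : (C (1 / 2 : ℝ) : Poly2) * 2 = 1 := by
      rw [show (2 : Poly2) = C 2 from (map_ofNat C 2).symm, ← C_mul]; norm_num
    have e01 : A 0 1 = C (1 / 2 : ℝ) * (-(X 1 * b) - X 0 * a) := by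
      have : X 0 * X 1 * (X 0 * a + 2 * A 0 1 + X 1 * b) = 0 := by
        rw [ha, hb] at key; linear_combination key
      have h3 := (mul_eq_zero.1 this).resolve_left (mul_ne_zero (X_ne_zero _) (X_ne_zero _))
      linear_combination C (1 / 2 : ℝ) * h3 - A 0 1 * h2
    ext i j : 2
    fin_cases i <;> fin_cases j <;>
      simp [symPart, Matrix.vecMulVec_apply, h10, ha, hb, e01] <;> ring_nf

/-- The rotated position vector is orthogonal to the position vector. -/
theorem radial_symPart (v : Fin 2 → Poly2) :
    radial (symPart (Matrix.vecMulVec ![X 1, -X 0] v)) = 0 := by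
  simp [radial, symPart, Matrix.vecMulVec_apply, Fin.sum_univ_two]
  ring

/-- The decomposition of symmetric polynomial tensor fields into a Hessian and an element of the
complement, with the origin as center. -/
theorem exists_hess_add_symPart {A : Tens Poly2} {m : ℕ} (hA : A ∈ SymPolyT (m + 1)) :
    ∃ q ∈ PolyT (m + 3), ∃ v : Fin 2 → Poly2, (∀ i, v i ∈ PolyT m) ∧
      A = hess q + symPart (Matrix.vecMulVec ![X 1, -X 0] v) ∧
      coeffNorm q ≤ ∑ i, ∑ j, coeffNorm (A i j) := by
  choose g hg1 hg2 hg3 using fun i j => exists_euler_eq (A i j)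
  -- The Hessian of `q` has the same radial part as `A`, so the difference falls in the complement.
  set q : Poly2 := ∑ i, ∑ j, X i * X j * g i j with hq
  have hqm : q ∈ PolyT (m + 3) := by
    refine sum_mem_PolyT fun i _ => sum_mem_PolyT fun j _ => ?_
    have : g i j ∈ PolyT (m + 1) :=
      (totalDegree_le_of_support_subset (hg1 i j)).trans (hA.2 i j)
    exact PolyT_mono (by omega) (mul_mem_PolyT (mul_mem_PolyT (X_mem_PolyT i) (X_mem_PolyT j)) this)
  have hrad : radial (hess q) = radial A := by
    rw [hq, hess_sum, radial_sum]
    simp only [hess_sum, radial_sum, hg3]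
    rfl
  obtain ⟨v, hv, hAv⟩ := exists_symPart_eq (A := A - hess q) (m := m)
    (by rw [Matrix.IsSymm, Matrix.transpose_sub, hA.1, hess_isSymm q])
    (by rw [radial_sub, hrad, sub_self])
    (fun i j => sub_mem_PolyT (hA.2 i j)
      (PolyT_mono (by omega) (pderiv_mem_PolyT (pderiv_mem_PolyT hqm j) i)))
  refine ⟨q, hqm, v, hv, by rw [← hAv]; abel, ?_⟩
  refine (coeffNorm_sum_le _ _).trans (Finset.sum_le_sum fun i _ => (coeffNorm_sum_le _ _).trans
    (Finset.sum_le_sum fun j _ => ?_))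
  refine (coeffNorm_mul_le _ _).trans ?_
  have : coeffNorm (X i * X j : Poly2) ≤ 1 := by
    simpa [coeffNorm_X] using coeffNorm_mul_le (X i) (X j)
  calc _ ≤ 1 * coeffNorm (g i j) := mul_le_mul_of_nonneg_right this (coeffNorm_nonneg _)
    _ ≤ _ := by rw [one_mul]; exact hg2 i j

end PlatesComplex

namespace PlatesComplex

/-! ### Affine rescaling of polynomials and of the Hessian decomposition. -/

open MvPolynomial

/-- Substitution of `x + h y` for the variable `y`. -/
noncomputable def scale (x : Plane) (h : ℝ) : Poly2 →ₐ[ℝ] Poly2 :=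
  aeval fun i => C (x i) + C h * X i

theorem scale_X (x : Plane) (h : ℝ) (i : Fin 2) : scale x h (X i) = C (x i) + C h * X i := by
  simp [scale]

theorem scale_C (x : Plane) (h a : ℝ) : scale x h (C a) = C a := by
  simp [scale, algebraMap_eq]

theorem scale_scale (x y : Plane) (h k : ℝ) (p : Poly2) :
    scale y k (scale x h p) = scale (x + h • y) (h * k) p := by
  have : (scale y k).comp (scale x h) = scale (x + h • y) (h * k) := by
    ext i : 1
    simp only [AlgHom.comp_apply, scale_X, map_add, map_mul, scale_C]
    simp
    ring_nf
  rw [← this]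
  rfl

theorem scale_zero_one (p : Poly2) : scale 0 1 p = p := by
  have : scale 0 1 = AlgHom.id ℝ Poly2 := by
    ext i : 1
    simp [scale_X]
  rw [this]
  rfl

theorem scale_inv_scale (x : Plane) {h : ℝ} (hh : h ≠ 0) (p : Poly2) :
    scale (-(h⁻¹ • x)) h⁻¹ (scale x h p) = p := by
  rw [scale_scale]
  conv_rhs => rw [← scale_zero_one p]
  congr 2
  · simp [smul_smul, hh]
  · exact mul_inv_cancel₀ hh

theorem scale_scale_inv (x : Plane) {h : ℝ} (hh : h ≠ 0) (p : Poly2) :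
    scale x h (scale (-(h⁻¹ • x)) h⁻¹ p) = p := by
  rw [scale_scale]
  conv_rhs => rw [← scale_zero_one p]
  congr 2
  · simp
  · exact inv_mul_cancel₀ hh

theorem scale_injective (x : Plane) {h : ℝ} (hh : h ≠ 0) : Function.Injective (scale x h) :=
  Function.LeftInverse.injective (scale_inv_scale x hh)

theorem pval_scale (x : Plane) (h : ℝ) (p : Poly2) (y : Plane) :
    pval (scale x h p) y = pval p (x + h • y) := by
  induction p using MvPolynomial.induction_on with
  | C a => simp [pval]
  | add p q hp hq =>
    simp only [pval, map_add] at hp hq ⊢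
    rw [hp, hq]
  | mul_X p i hp =>
    simp only [pval, map_mul, scale_X] at hp ⊢
    rw [hp]
    simp

theorem pderiv_scale (x : Plane) (h : ℝ) (i : Fin 2) (p : Poly2) :
    pderiv i (scale x h p) = C h * scale x h (pderiv i p) := by
  induction p using MvPolynomial.induction_on with
  | C a => simp
  | add p q hp hq =>
    simp only [map_add] at hp hq ⊢
    rw [hp, hq]
    ring
  | mul_X p j hp =>
    simp only [map_mul, scale_X, pderiv_mul, map_add, hp, pderiv_C, pderiv_X, zero_mul, zero_add]
    rcases eq_or_ne i j with rfl | hij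
    · simp
      ring
    · simp [hij.symm]
      ring

theorem scale_mem_PolyT (x : Plane) (h : ℝ) {p : Poly2} {m : ℕ} (hp : p ∈ PolyT m) :
    scale x h p ∈ PolyT m :=
  aeval_mem_PolyT hp fun i => add_mem_PolyT (C_mem_PolyT _ _) (C_mul_mem_PolyT _ (X_mem_PolyT i))

theorem hess_scale (x : Plane) (h : ℝ) (q : Poly2) :
    hess (scale x h q) = (C (h ^ 2) : Poly2) • (hess q).map (scale x h) := by
  ext i j : 2
  simp only [hess, Matrix.of_apply, pderiv_scale, pderiv_C_mul, Matrix.smul_apply, Matrix.map_apply,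
    smul_eq_mul, C_pow]
  ring_nf

theorem map_scale_symPart (x y : Plane) (h : ℝ) (v : Fin 2 → Poly2) :
    (symPart (Matrix.vecMulVec (perpField y) v)).map (scale x h) =
      symPart (Matrix.vecMulVec (fun i => scale x h (perpField y i)) fun i => scale x h (v i)) := by
  ext i j : 2
  simp [symPart, Matrix.vecMulVec_apply]

theorem scale_perpField (x : Plane) (h : ℝ) :
    (fun i => scale x h (perpField x i)) = (C h : Poly2) • ![X 1, -X 0] := by
  ext i : 1
  fin_cases i <;> simp [perpField, scale_X]

theorem symPart_smul_vecMulVec (a : Poly2) (u v : Fin 2 → Poly2) :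
    symPart (Matrix.vecMulVec (a • u) v) = symPart (Matrix.vecMulVec u (a • v)) := by
  ext i j : 2
  simp [symPart, Matrix.vecMulVec_apply]
  ring_nf

/-- The intersection of Hessians and of the complement is trivial. -/
theorem mem_PolyT_one_of_hess_add_eq_zero {x : Plane} {m : ℕ} {q : Poly2} {υ : Tens Poly2}
    (hυ : υ ∈ CHess x m) (h0 : hess q + υ = 0) : q ∈ PolyT 1 := by
  obtain ⟨v, -, rfl⟩ := hυ
  -- The translation taking the centre `x` to the origin gives fields of the complement a zero
  -- radial part, and therefore also the Hessian, which is opposite to such a field.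
  have h1 : radial (hess (scale x 1 q)) = 0 := by
    have h2 : hess q = -symPart (Matrix.vecMulVec (perpField x) v) := eq_neg_of_add_eq_zero_left h0
    have h3 : hess (scale x 1 q) = 0 - symPart (Matrix.vecMulVec ![X 1, -X 0]
        fun i => scale x 1 (v i)) := by
      rw [hess_scale, h2, zero_sub]
      have : (-symPart (Matrix.vecMulVec (perpField x) v)).map (scale x 1) =
          -((symPart (Matrix.vecMulVec (perpField x) v)).map (scale x 1)) := by
        ext i j : 2; simp
      rw [this, map_scale_symPart, scale_perpField]
      simp
    rw [h3, radial_sub, radial_symPart]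
    simp [radial]
  have := scale_mem_PolyT (-((1:ℝ)⁻¹ • x)) (1:ℝ)⁻¹ (mem_PolyT_one_of_radial_hess h1)
  rwa [scale_inv_scale x one_ne_zero] at this

/-- The scale-invariant coefficient norm of a polynomial on the disc of center `x` and
radius `h`. -/
noncomputable def discNorm (x : Plane) (h : ℝ) (p : Poly2) : ℝ := coeffNorm (scale x h p)

/-! ### Calculus of the disc norm: products, derivatives, point values, change of disc. -/

section discNorm

variable {x : Plane} {h : ℝ}

theorem discNorm_nonneg (p : Poly2) : 0 ≤ discNorm x h p := coeffNorm_nonneg _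

theorem discNorm_add_le (p q : Poly2) :
    discNorm x h (p + q) ≤ discNorm x h p + discNorm x h q := by
  rw [discNorm, map_add]; exact coeffNorm_add_le _ _

theorem discNorm_neg (p : Poly2) : discNorm x h (-p) = discNorm x h p := by
  rw [discNorm, map_neg, coeffNorm_neg]; rfl

theorem discNorm_sum_le {ι : Type*} (S : Finset ι) (f : ι → Poly2) :
    discNorm x h (∑ i ∈ S, f i) ≤ ∑ i ∈ S, discNorm x h (f i) := by
  rw [discNorm, map_sum]; exact coeffNorm_sum_le _ _

theorem discNorm_mul_le (p q : Poly2) :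
    discNorm x h (p * q) ≤ discNorm x h p * discNorm x h q := by
  rw [discNorm, map_mul]; exact coeffNorm_mul_le _ _

theorem discNorm_C (a : ℝ) : discNorm x h (C a) = |a| := by
  rw [discNorm, scale_C, coeffNorm_C]

theorem discNorm_C_mul_le (a : ℝ) (p : Poly2) :
    discNorm x h (C a * p) ≤ |a| * discNorm x h p := by
  simpa [discNorm_C] using discNorm_mul_le (x := x) (h := h) (C a) p

/-- The factor `h` is that of the chain rule for the substitution `x + h y`. -/
theorem discNorm_pderiv_le (hh : 0 < h) {p : Poly2} {m : ℕ} (hp : p ∈ PolyT m) (i : Fin 2) :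
    h * discNorm x h (pderiv i p) ≤ m * discNorm x h p := by
  have h1 := coeffNorm_pderiv_le (scale_mem_PolyT x h hp) i
  have h2 : scale x h (pderiv i p) = C h⁻¹ * pderiv i (scale x h p) := by
    rw [pderiv_scale, ← mul_assoc, ← C_mul, inv_mul_cancel₀ hh.ne', C_1, one_mul]
  rw [discNorm, h2]
  have h3 := coeffNorm_C_mul_le h⁻¹ (pderiv i (scale x h p))
  rw [abs_of_pos (inv_pos.2 hh)] at h3
  calc _ ≤ h * (h⁻¹ * coeffNorm (pderiv i (scale x h p))) := by gcongr
    _ = coeffNorm (pderiv i (scale x h p)) := by field_simp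
    _ ≤ _ := h1

/-- Rescaling sends the disc into the square `[-1, 1]²`, where all monomials are at most 1 in
absolute value. -/
theorem abs_pval_le_discNorm (hh : 0 < h) (p : Poly2) {y : Plane}
    (hy : y ∈ Metric.closedBall x h) : |pval p y| ≤ discNorm x h p := by
  have h1 : y = x + h • (h⁻¹ • (y - x)) := by rw [smul_smul, mul_inv_cancel₀ hh.ne']; simp
  rw [h1, ← pval_scale]
  refine abs_eval_le_coeffNorm _ fun i => ?_
  have h2 : |(y - x) i| ≤ h := (PiLp.norm_apply_le (y - x) i).trans (by
    rwa [Metric.mem_closedBall, dist_eq_norm] at hy)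
  rw [PiLp.smul_apply, smul_eq_mul, abs_mul, abs_inv, abs_of_pos hh, inv_mul_le_iff₀ hh, mul_one]
  exact h2

/-- The passage from one rescaled variable to the other is an affine substitution, each component of
which has coefficient norm at most `(dist x c + h) / r ≤ R`. -/
theorem discNorm_le_discNorm {c : Plane} {r R : ℝ} (hr : 0 < r) (hh : 0 < h) (hR : 1 ≤ R)
    (hcR : dist x c + h ≤ R * r) {p : Poly2} {m : ℕ} (hp : p ∈ PolyT m) :
    discNorm x h p ≤ R ^ m * discNorm c r p := by
  have h1 : scale x h p = scale (r⁻¹ • (x - c)) (r⁻¹ * h) (scale c r p) := by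
    rw [scale_scale, smul_smul, mul_inv_cancel₀ hr.ne', ← mul_assoc, mul_inv_cancel₀ hr.ne']
    simp
  rw [discNorm, h1]
  refine coeffNorm_aeval_le (scale_mem_PolyT c r hp) hR fun i => ?_
  refine (coeffNorm_add_le _ _).trans ?_
  have h2 : |(x - c) i| ≤ dist x c := by
    rw [dist_eq_norm]; exact PiLp.norm_apply_le (x - c) i
  have h3 := coeffNorm_C_mul_le (r⁻¹ * h) (X i)
  rw [coeffNorm_X, mul_one, abs_of_pos (by positivity)] at h3
  rw [coeffNorm_C, PiLp.smul_apply, smul_eq_mul, abs_mul, abs_inv, abs_of_pos hr]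
  calc _ ≤ r⁻¹ * dist x c + r⁻¹ * h := by gcongr
    _ = r⁻¹ * (dist x c + h) := by ring
    _ ≤ r⁻¹ * (R * r) := by gcongr
    _ = R := by field_simp

end discNorm

/-- The sum of the scale-invariant norms of the components of a tensor field. -/
noncomputable def tensNorm (x : Plane) (h : ℝ) (A : Tens Poly2) : ℝ :=
  ∑ i, ∑ j, discNorm x h (A i j)

/-! ### Disc norms of tensor fields and the stable splitting into a Hessian and a complement. -/

section tensNorm

variable {x : Plane} {h : ℝ}

theorem tensNorm_nonneg (A : Tens Poly2) : 0 ≤ tensNorm x h A :=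
  Finset.sum_nonneg fun _ _ => Finset.sum_nonneg fun _ _ => discNorm_nonneg _

theorem discNorm_le_tensNorm (A : Tens Poly2) (i j : Fin 2) :
    discNorm x h (A i j) ≤ tensNorm x h A :=
  (Finset.single_le_sum (f := fun j => discNorm x h (A i j)) (fun _ _ => discNorm_nonneg _)
    (Finset.mem_univ j)).trans
  (Finset.single_le_sum (f := fun i => ∑ j, discNorm x h (A i j))
    (fun _ _ => Finset.sum_nonneg fun _ _ => discNorm_nonneg _) (Finset.mem_univ i))

theorem tensNorm_hess_le (hh : 0 < h) {q : Poly2} {m : ℕ} (hq : q ∈ PolyT m) :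
    h ^ 2 * tensNorm x h (hess q) ≤ 4 * m ^ 2 * discNorm x h q := by
  have h1 : ∀ i j, h ^ 2 * discNorm x h (hess q i j) ≤ m ^ 2 * discNorm x h q := by
    intro i j
    have h2 := discNorm_pderiv_le (x := x) hh hq j
    have h3 := discNorm_pderiv_le (x := x) hh (PolyT_mono (Nat.sub_le _ _) (pderiv_mem_PolyT hq j)) i
    calc _ = h * (h * discNorm x h (pderiv i (pderiv j q))) := by
            rw [hess, Matrix.of_apply]; ring
      _ ≤ h * (m * discNorm x h (pderiv j q)) := by gcongr
      _ = m * (h * discNorm x h (pderiv j q)) := by ring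
      _ ≤ m * (m * discNorm x h q) := by gcongr
      _ = _ := by ring
  simp only [tensNorm, Fin.sum_univ_two]
  linarith [h1 0 0, h1 0 1, h1 1 0, h1 1 1]

/-- The stable decomposition of symmetric polynomial tensor fields. -/
theorem exists_stable_decomposition (hh : 0 < h) {A : Tens Poly2} {m : ℕ}
    (hA : A ∈ SymPolyT (m + 1)) :
    ∃ q ∈ PolyT (m + 3), ∃ υ ∈ CHess x m, A = hess q + υ ∧
      discNorm x h q ≤ h ^ 2 * tensNorm x h A ∧
      tensNorm x h υ ≤ (1 + 4 * (m + 3) ^ 2) * tensNorm x h A := by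
  have hA' : A.map (scale x h) ∈ SymPolyT (m + 1) :=
    ⟨Matrix.IsSymm.ext fun i j => by rw [Matrix.map_apply, Matrix.map_apply, hA.1.apply],
      fun i j => scale_mem_PolyT _ _ (hA.2 i j)⟩
  obtain ⟨q, hq, v, hv, hAe, hqn⟩ := exists_hess_add_symPart hA'
  -- The factor `h ^ 2` compensates the two derivatives: the Hessian of `q'`, once rescaled, is
  -- exactly `hess q`.
  set q' : Poly2 := C (h ^ 2) * scale (-(h⁻¹ • x)) h⁻¹ q with hq'
  have hsq : scale x h q' = C (h ^ 2) * q := by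
    rw [hq', map_mul, scale_C, scale_scale_inv x hh.ne']
  have hq'm : q' ∈ PolyT (m + 3) := C_mul_mem_PolyT _ (scale_mem_PolyT _ _ hq)
  have hdn : discNorm x h q' ≤ h ^ 2 * tensNorm x h A := by
    rw [discNorm, hsq]
    refine (coeffNorm_C_mul_le _ _).trans ?_
    rw [abs_of_pos (by positivity)]
    exact mul_le_mul_of_nonneg_left hqn (by positivity)
  have hh2 : (C (h ^ 2) : Poly2) ≠ 0 := by
    rw [Ne, C_eq_zero]; positivity
  have hhess : (hess q').map (scale x h) = hess q := by
    have h1 := hess_scale x h q'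
    rw [hsq] at h1
    have h2 : hess (C (h ^ 2) * q) = (C (h ^ 2) : Poly2) • hess q := by
      ext i j : 2; simp [hess]
    rw [h2] at h1
    refine Matrix.ext fun i j => ?_
    have := congrFun (congrFun h1 i) j
    simp only [Matrix.smul_apply, smul_eq_mul] at this
    exact (mul_left_cancel₀ hh2 this).symm
  -- The identity is checked after the injective rescaling. There `perpField x` becomes `h` times
  -- the field centred at the origin, whence the `h⁻¹` in front of the vector.
  have hdec : A - hess q' = symPart (Matrix.vecMulVec (perpField x)
      fun i => C h⁻¹ * scale (-(h⁻¹ • x)) h⁻¹ (v i)) := by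
    have hinj : Function.Injective fun B : Tens Poly2 => B.map (scale x h) :=
      Matrix.map_injective (scale_injective x hh.ne')
    apply hinj
    change (A - hess q').map (scale x h) = (symPart _).map (scale x h)
    rw [map_scale_symPart, scale_perpField, symPart_smul_vecMulVec]
    have h2 : (A - hess q').map (scale x h) = A.map (scale x h) - (hess q').map (scale x h) := by
      ext i j : 2; simp
    rw [h2, hhess, hAe, add_sub_cancel_left]
    congr 2
    ext i : 1
    rw [Pi.smul_apply, smul_eq_mul, map_mul, scale_C, scale_scale_inv x hh.ne', ← mul_assoc,
      ← C_mul, mul_inv_cancel₀ hh.ne', C_1, one_mul]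
  refine ⟨q', hq'm, A - hess q', ⟨_, fun i => C_mul_mem_PolyT _ (scale_mem_PolyT _ _ (hv i)), hdec⟩,
    by abel, hdn, ?_⟩
  -- The complement part is not estimated through `v`: it is the difference of two fields already
  -- under control.
  have h1 : tensNorm x h (A - hess q') ≤ tensNorm x h A + tensNorm x h (hess q') := by
    simp only [tensNorm, ← Finset.sum_add_distrib]
    refine Finset.sum_le_sum fun i _ => Finset.sum_le_sum fun j _ => ?_
    rw [Matrix.sub_apply, sub_eq_add_neg, ← discNorm_neg (hess q' i j)]
    exact discNorm_add_le _ _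
  have h2 := tensNorm_hess_le (x := x) hh hq'm
  have h3 : h ^ 2 * tensNorm x h (hess q') ≤ h ^ 2 * (4 * (m + 3) ^ 2 * tensNorm x h A) := by
    refine h2.trans ?_
    push_cast
    calc _ ≤ 4 * (m + 3 : ℝ) ^ 2 * (h ^ 2 * tensNorm x h A) := by gcongr
      _ = _ := by ring
  have h4 := le_of_mul_le_mul_left h3 (by positivity)
  linarith

end tensNorm

end PlatesComplex

namespace PlatesComplex

open MvPolynomial MeasureTheory

/-! ### Definite forms on finite-dimensional spaces -/

section forms

variable {V : Type*} [AddCommGroup V] [Module ℝ V]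

/-- Definiteness makes `v ↦ B v` injective into the dual, which has the same dimension. All the
reconstructions are obtained from this principle, and symmetry is not needed for it. -/
theorem existsUnique_form_eq [FiniteDimensional ℝ V] (B : LinearMap.BilinForm ℝ V)
    (hB : ∀ v, B v v = 0 → v = 0) (f : V →ₗ[ℝ] ℝ) : ∃! v, ∀ w, B v w = f w := by
  have hinj : Function.Injective B := by
    rw [← LinearMap.ker_eq_bot, LinearMap.ker_eq_bot']
    intro v hv
    exact hB v (by rw [hv]; rfl)
  have hfr : Module.finrank ℝ V = Module.finrank ℝ (V →ₗ[ℝ] ℝ) :=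
    (Subspace.dual_finrank_eq (K := ℝ) (V := V)).symm
  obtain ⟨v, hv⟩ := (LinearMap.injective_iff_surjective_of_finrank_eq_finrank hfr).1 hinj f
  refine ⟨v, fun w => by rw [hv], fun v' hv' => hinj ?_⟩
  rw [hv]
  exact LinearMap.ext hv'

/-- A sublinear function on a finite-dimensional space is controlled by a definite form. -/
theorem exists_sq_le_form [FiniteDimensional ℝ V] (B : LinearMap.BilinForm ℝ V)
    (hs : ∀ v w, B v w = B w v) (hpos : ∀ v, 0 ≤ B v v) (hB : ∀ v, B v v = 0 → v = 0) (N : V → ℝ)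
    (h0 : ∀ v, 0 ≤ N v) (hadd : ∀ v w, N (v + w) ≤ N v + N w)
    (hsmul : ∀ (a : ℝ) v, N (a • v) ≤ |a| * N v) :
    ∃ C : ℝ, 0 < C ∧ ∀ v, N v ^ 2 ≤ C * B v v := by
  classical
  have hsymm : LinearMap.IsSymm B := ⟨fun v w => hs v w⟩
  have hN0 : N 0 = 0 := le_antisymm (by simpa using hsmul 0 0) (h0 0)
  have hsum : ∀ (S : Finset (Fin (Module.finrank ℝ V))) (f : Fin (Module.finrank ℝ V) → V),
      N (∑ i ∈ S, f i) ≤ ∑ i ∈ S, N (f i) := by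
    intro S f
    induction S using Finset.induction_on with
    | empty => simp [hN0]
    | insert a S ha ih =>
      rw [Finset.sum_insert ha, Finset.sum_insert ha]
      exact (hadd _ _).trans (by gcongr)
  let b := Module.finBasis ℝ V
  -- Representing each coordinate functional by a vector `g i` allows the Cauchy–Schwarz inequality
  -- to bound coordinates by the form, without any topology on `V`.
  choose g hg _ using fun i => existsUnique_form_eq B hB (b.coord i)
  set D : ℝ := ∑ i, Real.sqrt (B (g i) (g i)) * N (b i) with hD
  have hD0 : 0 ≤ D := Finset.sum_nonneg fun i _ => mul_nonneg (Real.sqrt_nonneg _) (h0 _)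
  have key : ∀ v, N v ≤ D * Real.sqrt (B v v) := by
    intro v
    rw [hD, Finset.sum_mul]
    conv_lhs => rw [← b.sum_repr v]
    refine (hsum _ _).trans (Finset.sum_le_sum fun i _ => (hsmul _ _).trans ?_)
    have h1 : (b.repr v i) ^ 2 ≤ B (g i) (g i) * B v v := by
      have := B.apply_sq_le_of_symm hpos hsymm (g i) v
      rwa [hg] at this
    have h2 : |b.repr v i| ≤ Real.sqrt (B (g i) (g i)) * Real.sqrt (B v v) := by
      rw [← Real.sqrt_mul (hpos _)]
      exact Real.abs_le_sqrt h1
    calc _ ≤ Real.sqrt (B (g i) (g i)) * Real.sqrt (B v v) * N (b i) :=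
          mul_le_mul_of_nonneg_right h2 (h0 _)
      _ = _ := by ring
  -- `D` vanishes when `N` does; adding 1 keeps the constant positive.
  refine ⟨D ^ 2 + 1, by positivity, fun v => ?_⟩
  calc N v ^ 2 ≤ (D * Real.sqrt (B v v)) ^ 2 := pow_le_pow_left₀ (h0 v) (key v) 2
    _ = D ^ 2 * B v v := by rw [mul_pow, Real.sq_sqrt (hpos v)]
    _ ≤ _ := mul_le_mul_of_nonneg_right (by linarith) (hpos v)

end forms

/-! ### Integrals of polynomials over plane domains -/

theorem pval_add (p q : Poly2) (x : Plane) : pval (p + q) x = pval p x + pval q x := by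
  simp [pval]

theorem pval_mul (p q : Poly2) (x : Plane) : pval (p * q) x = pval p x * pval q x := by
  simp [pval]

theorem pval_smul (a : ℝ) (p : Poly2) (x : Plane) : pval (a • p) x = a * pval p x := by
  simp [pval]

theorem continuous_pval (p : Poly2) : Continuous (pval p) :=
  (MvPolynomial.continuous_eval p).comp (by fun_prop)

theorem integrableOn_pval {S : Set Plane} (hS : Bornology.IsBounded S) (p : Poly2) :
    IntegrableOn (pval p) S :=
  ((continuous_pval p).continuousOn.integrableOn_compact hS.isCompact_closure).mono_set
    subset_closure

/-- The `L²` form on the polynomials over a bounded set. -/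
noncomputable def domainForm (S : Set Plane) (hS : Bornology.IsBounded S) :
    LinearMap.BilinForm ℝ Poly2 :=
  LinearMap.mk₂ ℝ (fun p q => ∫ x in S, pval (p * q) x)
    (fun p p' q => by
      simp only [add_mul, pval_add]
      exact integral_add (integrableOn_pval hS _) (integrableOn_pval hS _))
    (fun a p q => by
      simp only [smul_mul_assoc, pval_smul, smul_eq_mul]
      exact integral_const_mul _ _)
    (fun p q q' => by
      simp only [mul_add, pval_add]
      exact integral_add (integrableOn_pval hS _) (integrableOn_pval hS _))
    (fun a p q => by
      simp only [mul_smul_comm, pval_smul, smul_eq_mul]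
      exact integral_const_mul _ _)

theorem domainForm_apply {S : Set Plane} (hS : Bornology.IsBounded S) (p q : Poly2) :
    domainForm S hS p q = ∫ x in S, pval (p * q) x := rfl

theorem domainForm_comm {S : Set Plane} (hS : Bornology.IsBounded S) (p q : Poly2) :
    domainForm S hS p q = domainForm S hS q p := by
  rw [domainForm_apply, domainForm_apply, mul_comm]

theorem domainForm_self_nonneg {S : Set Plane} (hS : Bornology.IsBounded S) (p : Poly2) :
    0 ≤ domainForm S hS p p := by
  rw [domainForm_apply]
  exact integral_nonneg fun x => by
    change 0 ≤ pval (p * p) x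
    rw [pval_mul]; exact mul_self_nonneg _

/-- A continuous nonnegative function of zero integral vanishes on the open disc. The disc contains
a product of two infinite sets, and a polynomial that vanishes on such a product is zero. -/
theorem eq_zero_of_domainForm_ball_eq_zero (p : Poly2)
    (h : domainForm (Metric.ball 0 1) Metric.isBounded_ball p p = 0) : p = 0 := by
  rw [domainForm_apply] at h
  have h1 : pval (p * p) =ᵐ[volume.restrict (Metric.ball 0 1)] 0 := by
    refine (integral_eq_zero_iff_of_nonneg (fun x => ?_)
      (integrableOn_pval Metric.isBounded_ball _)).1 h
    rw [pval_mul]; exact mul_self_nonneg _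
  have h2 : Set.EqOn (pval (p * p)) 0 (Metric.ball 0 1) :=
    Measure.eqOn_open_of_ae_eq h1 Metric.isOpen_ball (continuous_pval _).continuousOn
      continuousOn_const
  refine MvPolynomial.funext_set (fun _ => Set.Ioo (-(1 / 2) : ℝ) (1 / 2))
    (fun _ => Set.Ioo_infinite (by norm_num)) fun y hy => ?_
  have h3 : !₂[y 0, y 1] ∈ Metric.ball (0 : Plane) 1 := by
    have h0 := hy 0 (Set.mem_univ _)
    have h1 := hy 1 (Set.mem_univ _)
    rw [mem_ball_zero_iff, EuclideanSpace.norm_eq, Real.sqrt_lt' one_pos, Fin.sum_univ_two]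
    simp only [Set.mem_Ioo] at h0 h1
    simp
    nlinarith
  have h4 := h2 h3
  rw [pval_mul] at h4
  have h5 := mul_self_eq_zero.1 h4
  have h6 : (fun i => (!₂[y 0, y 1] : Plane) i) = y := by
    ext i; fin_cases i <;> rfl
  rw [pval, h6] at h5
  rw [h5, map_zero]

/-- Norm equivalence on a finite-dimensional space. The domain is the fixed unit disc, so the
constant depends on the degree alone. -/
theorem exists_coeffNorm_sq_le (m : ℕ) : ∃ C : ℝ, 0 < C ∧ ∀ p ∈ PolyT m,
    coeffNorm p ^ 2 ≤ C * ∫ x in Metric.ball (0 : Plane) 1, pval (p * p) x := by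
  let V := restrictTotalDegree (Fin 2) ℝ m
  obtain ⟨C, hC, h⟩ := exists_sq_le_form
    ((domainForm (Metric.ball 0 1) Metric.isBounded_ball).compl₁₂ V.subtype V.subtype)
    (fun v w => domainForm_comm Metric.isBounded_ball _ _)
    (fun v => domainForm_self_nonneg Metric.isBounded_ball _)
    (fun v hv => Subtype.ext (eq_zero_of_domainForm_ball_eq_zero _ hv))
    (fun v => coeffNorm v.1) (fun v => coeffNorm_nonneg _) (fun v w => coeffNorm_add_le _ _)
    (fun a v => by
      have := coeffNorm_C_mul_le a v.1
      rwa [← smul_eq_C_mul] at this)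
  exact ⟨C, hC, fun p hp => h ⟨p, (mem_restrictTotalDegree _ _ _).2 hp⟩⟩

theorem setIntegral_ball_eq (f : Plane → ℝ) (c : Plane) {r : ℝ} (hr : 0 < r) :
    ∫ x in Metric.ball c r, f x = r ^ 2 * ∫ x in Metric.ball (0 : Plane) 1, f (c + r • x) := by
  have h1 := Measure.setIntegral_comp_smul_of_pos (volume : Measure Plane)
    (fun z => f (c + z)) (Metric.ball 0 1) hr
  rw [h1, smul_unitBall_of_pos hr, finrank_euclideanSpace_fin, smul_eq_mul, ← mul_assoc,
    mul_inv_cancel₀ (by positivity), one_mul]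
  have h2 := (measurePreserving_add_left (volume : Measure Plane) c).setIntegral_preimage_emb
    (measurableEmbedding_addLeft c) f (Metric.ball c r)
  rw [← h2]
  congr 2
  ext z
  simp

/-- The scale-invariant norm is controlled by the `L²` norm. -/
theorem exists_discNorm_sq_le (m : ℕ) {R : ℝ} (hR : 1 ≤ R) : ∃ C : ℝ, 0 < C ∧
    ∀ (S : Set Plane) (x c : Plane) (h r : ℝ), 0 < h → 0 < r → dist x c + h ≤ R * r →
      Bornology.IsBounded S → Metric.ball c r ⊆ S → ∀ p ∈ PolyT m,
      h ^ 2 * discNorm x h p ^ 2 ≤ C * ∫ y in S, pval (p * p) y := by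
  obtain ⟨C, hC, hCm⟩ := exists_coeffNorm_sq_le m
  refine ⟨R ^ 2 * (R ^ m) ^ 2 * C, by positivity, ?_⟩
  intro S x c h r hh hr hcR hS hball p hp
  -- Pass to the inner disc at the price `R ^ m`, where the integral rescales to the unit disc;
  -- enlarging the domain to `S` only increases the integral of a square.
  have h1 := discNorm_le_discNorm hr hh hR hcR hp
  have h2 := hCm _ (scale_mem_PolyT c r hp)
  have h3 : h ≤ R * r := by linarith [dist_nonneg (x := x) (y := c)]
  have h4 : ∫ y in Metric.ball c r, pval (p * p) y =
      r ^ 2 * ∫ y in Metric.ball (0 : Plane) 1, pval (scale c r p * scale c r p) y := by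
    rw [setIntegral_ball_eq _ c hr]
    simp only [← map_mul, pval_scale]
  have h5 : ∫ y in Metric.ball c r, pval (p * p) y ≤ ∫ y in S, pval (p * p) y := by
    refine setIntegral_mono_set (integrableOn_pval hS _) ?_ hball.eventuallyLE
    exact Filter.Eventually.of_forall fun y => by
      change 0 ≤ pval (p * p) y
      rw [pval_mul]; exact mul_self_nonneg _
  calc h ^ 2 * discNorm x h p ^ 2 ≤ (R * r) ^ 2 * (R ^ m * discNorm c r p) ^ 2 := by
        have := discNorm_nonneg (x := x) (h := h) p
        gcongr
    _ = R ^ 2 * (R ^ m) ^ 2 * r ^ 2 * discNorm c r p ^ 2 := by ring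
    _ ≤ R ^ 2 * (R ^ m) ^ 2 * r ^ 2 *
        (C * ∫ y in Metric.ball (0 : Plane) 1, pval (scale c r p * scale c r p) y) := by
        gcongr
        exact h2
    _ = R ^ 2 * (R ^ m) ^ 2 * C * ∫ y in Metric.ball c r, pval (p * p) y := by rw [h4]; ring
    _ ≤ _ := by gcongr

/-- Supremum times area, with `π ≤ 4`. -/
theorem abs_setIntegral_pval_le {S : Set Plane} {x : Plane} {h : ℝ} (hh : 0 < h)
    (hS : S ⊆ Metric.closedBall x h) (p : Poly2) :
    |∫ y in S, pval p y| ≤ 4 * h ^ 2 * discNorm x h p := by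
  have hfin : volume (Metric.closedBall x h) < ⊤ := measure_closedBall_lt_top
  have h1 := norm_setIntegral_le_of_norm_le_const (μ := volume) (f := pval p)
    ((measure_mono hS).trans_lt hfin) (fun y hy => abs_pval_le_discNorm hh p (hS hy))
  rw [Real.norm_eq_abs] at h1
  have h2 : volume.real S ≤ 4 * h ^ 2 := by
    refine (measureReal_mono hS hfin.ne).trans ?_
    rw [measureReal_def, EuclideanSpace.volume_closedBall_fin_two, ENNReal.toReal_mul,
      ENNReal.toReal_pow, ENNReal.toReal_ofReal hh.le, ENNReal.toReal_ofReal Real.pi_pos.le]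
    nlinarith [Real.pi_le_four, sq_nonneg h]
  calc _ ≤ discNorm x h p * volume.real S := h1
    _ ≤ discNorm x h p * (4 * h ^ 2) := mul_le_mul_of_nonneg_left h2 (discNorm_nonneg _)
    _ = _ := by ring

end PlatesComplex

namespace PlatesComplex

/-! ### Polynomials on an edge -/

/-- By the parallelogram identity, the gap between the two sides is `B (v - w) (v - w)`. -/
theorem form_add_self_le {V : Type*} [AddCommGroup V] [Module ℝ V] (B : LinearMap.BilinForm ℝ V)
    (hpos : ∀ v, 0 ≤ B v v) (v w : V) :
    B (v + w) (v + w) ≤ 2 * B v v + 2 * B w w := by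
  have h := hpos (v - w)
  simp only [map_add, map_sub, LinearMap.add_apply, LinearMap.sub_apply] at h ⊢
  linarith

theorem form_sub_self_le {V : Type*} [AddCommGroup V] [Module ℝ V] (B : LinearMap.BilinForm ℝ V)
    (hpos : ∀ v, 0 ≤ B v v) (v w : V) :
    B (v - w) (v - w) ≤ 2 * B v v + 2 * B w w := by
  have h := hpos (v + w)
  simp only [map_add, map_sub, LinearMap.add_apply, LinearMap.sub_apply] at h ⊢
  linarith

open Polynomial

theorem intervalIntegrable_eval_mul (p q : ℝ[X]) (a b : ℝ) :
    IntervalIntegrable (fun s => p.eval s * q.eval s) MeasureTheory.volume a b :=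
  Continuous.intervalIntegrable (by fun_prop) _ _

/-- The `L²(0, L)` form on univariate polynomials. -/
noncomputable def intervalForm (L : ℝ) : LinearMap.BilinForm ℝ ℝ[X] :=
  LinearMap.mk₂ ℝ (fun p q => ∫ s in (0 : ℝ)..L, p.eval s * q.eval s)
    (fun p p' q => by
      simp only [eval_add, add_mul]
      exact intervalIntegral.integral_add (intervalIntegrable_eval_mul _ _ _ _)
        (intervalIntegrable_eval_mul _ _ _ _))
    (fun a p q => by
      simp only [eval_smul, smul_eq_mul, mul_assoc]
      exact intervalIntegral.integral_const_mul _ _)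
    (fun p q q' => by
      simp only [eval_add, mul_add]
      exact intervalIntegral.integral_add (intervalIntegrable_eval_mul _ _ _ _)
        (intervalIntegrable_eval_mul _ _ _ _))
    (fun a p q => by
      simp only [eval_smul, smul_eq_mul, mul_left_comm _ a]
      exact intervalIntegral.integral_const_mul _ _)

theorem intervalForm_apply (L : ℝ) (p q : ℝ[X]) :
    intervalForm L p q = ∫ s in (0 : ℝ)..L, p.eval s * q.eval s := rfl

theorem intervalForm_comm (L : ℝ) (p q : ℝ[X]) : intervalForm L p q = intervalForm L q p := by
  simp only [intervalForm_apply, mul_comm]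

theorem intervalForm_mul_left (L : ℝ) (w p q : ℝ[X]) :
    intervalForm L (w * p) q = intervalForm L p (w * q) := by
  simp only [intervalForm_apply, eval_mul]
  congr 1; ext s; ring

theorem intervalForm_le_intervalForm {L : ℝ} (hL : 0 ≤ L) {p q p' q' : ℝ[X]}
    (h : ∀ s ∈ Set.Icc 0 L, p.eval s * q.eval s ≤ p'.eval s * q'.eval s) :
    intervalForm L p q ≤ intervalForm L p' q' :=
  intervalIntegral.integral_mono_on hL (intervalIntegrable_eval_mul _ _ _ _)
    (intervalIntegrable_eval_mul _ _ _ _) h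

theorem intervalForm_nonneg {L : ℝ} (hL : 0 ≤ L) {p q : ℝ[X]}
    (h : ∀ s ∈ Set.Icc 0 L, 0 ≤ p.eval s * q.eval s) : 0 ≤ intervalForm L p q := by
  simpa using intervalForm_le_intervalForm hL (p := 0) (q := 0) (by simpa using h)

theorem intervalForm_self_nonneg {L : ℝ} (hL : 0 ≤ L) (p : ℝ[X]) : 0 ≤ intervalForm L p p :=
  intervalForm_nonneg hL fun _ _ => mul_self_nonneg _

theorem intervalForm_self_le {L : ℝ} (hL : 0 ≤ L) {p : ℝ[X]} {M : ℝ}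
    (h : ∀ s ∈ Set.Icc 0 L, |p.eval s| ≤ M) : intervalForm L p p ≤ L * M ^ 2 := by
  have h1 : intervalForm L p p ≤ intervalForm L (C M) (C M) :=
    intervalForm_le_intervalForm hL fun s hs => by
      rw [eval_C, ← sq, ← sq, sq_le_sq]
      exact (h s hs).trans (le_abs_self _)
  refine h1.trans_eq ?_
  simp [intervalForm_apply, sq]
  ring

theorem intervalForm_sq_le {L : ℝ} (hL : 0 ≤ L) (p q : ℝ[X]) :
    intervalForm L p q ^ 2 ≤ intervalForm L p p * intervalForm L q q :=
  (intervalForm L).apply_sq_le_of_symm (intervalForm_self_nonneg hL)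
    ⟨fun p q => intervalForm_comm L p q⟩ p q

/-- The edge bubble. -/
noncomputable def bubble (L : ℝ) : ℝ[X] := X * (C L - X)

theorem bubble_nonneg {L s : ℝ} (hs : s ∈ Set.Icc 0 L) : 0 ≤ (bubble L).eval s := by
  simp only [bubble, eval_mul, eval_X, eval_sub, eval_C]
  exact mul_nonneg hs.1 (sub_nonneg.2 hs.2)

theorem bubble_le {L s : ℝ} (hs : s ∈ Set.Icc 0 L) : (bubble L).eval s ≤ L ^ 2 := by
  simp only [bubble, eval_mul, eval_X, eval_sub, eval_C]
  nlinarith [hs.1, hs.2]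

/-- A nonzero polynomial has a non-root inside the interval, and there the integrand, bubble times
square, is positive. -/
theorem eq_zero_of_bubble_form_eq_zero {L : ℝ} (hL : 0 < L) {r : ℝ[X]}
    (h : intervalForm L (bubble L * r) r = 0) : r = 0 := by
  by_contra hr
  have h1 : ∃ c ∈ Set.Ioo 0 L, ¬ r.IsRoot c := by
    by_contra! hcon
    exact hr (eq_zero_of_infinite_isRoot r ((Set.Ioo_infinite hL).mono hcon))
  obtain ⟨c, hc, hrc⟩ := h1
  refine (ne_of_gt ?_) h
  rw [intervalForm_apply]
  refine intervalIntegral.integral_pos hL (by fun_prop) (fun s hs => ?_)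
    ⟨c, Set.Ioo_subset_Icc_self hc, ?_⟩
  · rw [eval_mul, mul_assoc]
    exact mul_nonneg (bubble_nonneg (Set.Ioc_subset_Icc_self hs)) (mul_self_nonneg _)
  · rw [eval_mul, mul_assoc]
    refine mul_pos ?_ (mul_self_pos.2 hrc)
    simp only [bubble, eval_mul, eval_X, eval_sub, eval_C]
    exact mul_pos hc.1 (sub_pos.2 hc.2)

theorem mem_degreeLT_iff_mem_PolyE {m : ℕ} {p : ℝ[X]} : p ∈ degreeLT ℝ (m + 1) ↔ p ∈ PolyE m := by
  rw [mem_degreeLT, degree_lt_iff_coeff_zero]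
  exact natDegree_le_iff_coeff_eq_zero.symm

/-- The bubble-weighted form on polynomials of bounded degree. -/
noncomputable def bubbleForm (L : ℝ) (m : ℕ) : LinearMap.BilinForm ℝ (degreeLT ℝ (m + 1)) :=
  (intervalForm L).compl₁₂ (LinearMap.mulLeft ℝ (bubble L) ∘ₗ (degreeLT ℝ (m + 1)).subtype)
    (degreeLT ℝ (m + 1)).subtype

theorem bubbleForm_apply (L : ℝ) (m : ℕ) (p q : degreeLT ℝ (m + 1)) :
    bubbleForm L m p q = intervalForm L (bubble L * p) q := rfl

/-- Norm equivalence on the unit interval: the weighted form is still definite, so it controls the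
sum of the absolute values of the coefficients, which dominates the supremum on `[0, 1]`. -/
theorem exists_le_bubble_form_one (m : ℕ) : ∃ K : ℝ, 0 < K ∧ ∀ r ∈ PolyE m,
    intervalForm 1 r r ≤ K * intervalForm 1 (bubble 1 * r) r := by
  have : FiniteDimensional ℝ (degreeLT ℝ (m + 1)) := inferInstance
  obtain ⟨K, hK, h⟩ := exists_sq_le_form (bubbleForm 1 m)
    (fun v w => by
      rw [bubbleForm_apply, bubbleForm_apply, intervalForm_mul_left, intervalForm_comm])
    (fun v => intervalForm_nonneg zero_le_one fun s hs => by
      rw [LinearMap.comp_apply, LinearMap.mulLeft_apply, eval_mul, mul_assoc]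
      exact mul_nonneg (bubble_nonneg hs) (mul_self_nonneg _))
    (fun v hv => Subtype.ext (eq_zero_of_bubble_form_eq_zero one_pos hv))
    (fun v => ∑ i ∈ Finset.range (m + 1), |v.1.coeff i|)
    (fun v => Finset.sum_nonneg fun _ _ => abs_nonneg _)
    (fun v w => by
      rw [← Finset.sum_add_distrib]
      exact Finset.sum_le_sum fun i _ => by
        rw [Submodule.coe_add, coeff_add]; exact abs_add_le _ _)
    (fun a v => by
      rw [Finset.mul_sum]
      exact Finset.sum_le_sum fun i _ => by
        rw [Submodule.coe_smul, coeff_smul, smul_eq_mul, abs_mul])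
  refine ⟨K, hK, fun r hr => ?_⟩
  refine le_trans ?_ (h ⟨r, mem_degreeLT_iff_mem_PolyE.2 hr⟩)
  refine (intervalForm_self_le zero_le_one fun s hs => ?_).trans_eq (one_mul _)
  rw [eval_eq_sum_range' (Nat.lt_succ_of_le hr)]
  refine (Finset.abs_sum_le_sum_abs _ _).trans (Finset.sum_le_sum fun i _ => ?_)
  rw [abs_mul, abs_pow, abs_of_nonneg hs.1]
  exact mul_le_of_le_one_right (abs_nonneg _) (pow_le_one₀ hs.1 hs.2)

theorem intervalForm_eq_one {L : ℝ} (p q : ℝ[X]) :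
    intervalForm L p q = L * intervalForm 1 (p.comp (C L * X)) (q.comp (C L * X)) := by
  have := intervalIntegral.mul_integral_comp_mul_left (a := 0) (b := 1)
    (f := fun s => p.eval s * q.eval s) L
  simp only [mul_zero, mul_one] at this
  simp only [intervalForm_apply, ← this, eval_comp, eval_mul, eval_C, eval_X]

/-- Under `s = L t` the bubble is homogeneous of degree two, which accounts for `L ^ 2`. -/
theorem exists_le_bubble_form (m : ℕ) : ∃ K : ℝ, 0 < K ∧ ∀ L, 0 < L → ∀ r ∈ PolyE m,
    L ^ 2 * intervalForm L r r ≤ K * intervalForm L (bubble L * r) r := by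
  obtain ⟨K, hK, h⟩ := exists_le_bubble_form_one m
  refine ⟨K, hK, fun L hL r hr => ?_⟩
  have h1 : r.comp (C L * X) ∈ PolyE m := by
    refine natDegree_comp_le.trans ?_
    have : (C L * X : ℝ[X]).natDegree ≤ 1 := (natDegree_C_mul_le L X).trans natDegree_X_le
    exact (Nat.mul_le_mul hr this).trans_eq (mul_one m)
  have h2 : (bubble L * r).comp (C L * X) = (L ^ 2) • (bubble 1 * r.comp (C L * X)) := by
    simp only [bubble, mul_comp, sub_comp, X_comp, C_comp, smul_eq_C_mul, C_pow, C_1]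
    ring
  rw [intervalForm_eq_one r r, intervalForm_eq_one (bubble L * r) r, h2, map_smul,
    LinearMap.smul_apply, smul_eq_mul]
  have := h _ h1
  calc _ = L ^ 3 * intervalForm 1 (r.comp (C L * X)) (r.comp (C L * X)) := by ring
    _ ≤ L ^ 3 * (K * intervalForm 1 (bubble 1 * r.comp (C L * X)) (r.comp (C L * X))) := by gcongr
    _ = _ := by ring

/-- A polynomial vanishing at the endpoints and orthogonal to polynomials of degree two less. -/
theorem eq_zero_of_endpoints_of_orthogonal {L : ℝ} (hL : 0 < L) {m : ℕ} {p : ℝ[X]}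
    (hp : p ∈ PolyE (m + 2)) (h0 : p.eval 0 = 0) (hL0 : p.eval L = 0)
    (h : ∀ w ∈ PolyE m, intervalForm L p w = 0) : p = 0 := by
  obtain ⟨p1, rfl⟩ := dvd_iff_isRoot.2 h0
  have h1 : p1.IsRoot L := by
    rw [eval_mul] at hL0
    exact (mul_eq_zero.1 hL0).resolve_left (by simp [hL.ne'])
  obtain ⟨r, rfl⟩ := dvd_iff_isRoot.2 h1
  -- Up to sign the polynomial is the bubble times `r`, and `r` has low enough degree to be used as
  -- test function.
  have h2 : (X - C 0) * ((X - C L) * r) = -(bubble L * r) := by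
    simp only [bubble, C_0]; ring
  by_cases hr : r = 0
  · simp [hr]
  have hrm : r ∈ PolyE m := by
    have : ((X - C 0) * ((X - C L) * r)).natDegree ≤ m + 2 := hp
    rw [natDegree_mul (X_sub_C_ne_zero _) (mul_ne_zero (X_sub_C_ne_zero _) hr),
      natDegree_mul (X_sub_C_ne_zero _) hr, natDegree_X_sub_C, natDegree_X_sub_C] at this
    change r.natDegree ≤ m
    omega
  have h3 := h r hrm
  rw [h2, map_neg, LinearMap.neg_apply, neg_eq_zero] at h3
  exact absurd (eq_zero_of_bubble_form_eq_zero hL h3) hr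

/-- The polynomial with prescribed endpoint values and lower-order moments. -/
theorem exists_edge_interpolant (m : ℕ) : ∃ K : ℝ, 0 < K ∧ ∀ L, 0 < L → ∀ (a b : ℝ), ∀ f ∈ PolyE m,
    ∃ p ∈ PolyE (m + 2), p.eval 0 = a ∧ p.eval L = b ∧
      (∀ w ∈ PolyE m, intervalForm L f w = intervalForm L p w) ∧
      intervalForm L p p ≤ K * (intervalForm L f f + L * (a ^ 2 + b ^ 2)) := by
  obtain ⟨K, hK, hbub⟩ := exists_le_bubble_form m
  refine ⟨2 + 4 * K ^ 2, by positivity, fun L hL a b f hf => ?_⟩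
  have hpos := intervalForm_self_nonneg hL.le
  -- The interpolant is the affine function with the right endpoint values plus a bubble multiple,
  -- which repairs the moments without touching the endpoints.
  set lin : ℝ[X] := C a + C ((b - a) / L) * X with hlin
  have hlin1 : lin.natDegree ≤ 1 := by
    rw [hlin, add_comm]; exact natDegree_linear_le
  have hlinform : intervalForm L lin lin ≤ L * (a ^ 2 + b ^ 2) := by
    have h1 := intervalForm_self_le hL.le (p := lin) (M := Real.sqrt (a ^ 2 + b ^ 2)) fun s hs => by
      refine Real.abs_le_sqrt ?_
      have h2 : lin.eval s = (1 - s / L) * a + (s / L) * b := by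
        simp [hlin]; field_simp; ring
      have h3 : 0 ≤ s / L := div_nonneg hs.1 hL.le
      have h4 : s / L ≤ 1 := (div_le_one hL).2 hs.2
      rw [h2]
      set t := s / L
      nlinarith [sq_nonneg (a - b), mul_nonneg h3 (sub_nonneg.2 h4), mul_nonneg h3 (sq_nonneg a),
        mul_nonneg (sub_nonneg.2 h4) (sq_nonneg b),
        mul_nonneg (mul_nonneg h3 (sub_nonneg.2 h4)) (sq_nonneg (a - b))]
    rwa [Real.sq_sqrt (by positivity)] at h1
  obtain ⟨r, hr, -⟩ := existsUnique_form_eq (bubbleForm L m)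
    (fun v hv => Subtype.ext (eq_zero_of_bubble_form_eq_zero hL hv))
    ((intervalForm L (f - lin)) ∘ₗ (degreeLT ℝ (m + 1)).subtype)
  have hrm : r.1 ∈ PolyE m := mem_degreeLT_iff_mem_PolyE.1 r.2
  have hr' : ∀ w ∈ PolyE m, intervalForm L (bubble L * r.1) w = intervalForm L (f - lin) w :=
    fun w hw => hr ⟨w, mem_degreeLT_iff_mem_PolyE.2 hw⟩
  have hbd : (bubble L).natDegree ≤ 2 := by
    rw [bubble]; compute_degree
  refine ⟨lin + bubble L * r.1, ?_, by simp [hlin, bubble], ?_, fun w hw => ?_, ?_⟩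
  · refine (natDegree_add_le _ _).trans (max_le (by omega) (natDegree_mul_le.trans ?_))
    have : r.1.natDegree ≤ m := hrm
    omega
  · simp [hlin, bubble]; field_simp; ring
  · rw [map_add, LinearMap.add_apply, hr' w hw, map_sub, LinearMap.sub_apply]
    ring
  · have h1 := hbub L hL r.1 hrm
    rw [hr' _ hrm] at h1
    have h2 := intervalForm_sq_le hL.le (f - lin) r.1
    set G := intervalForm L (f - lin) (f - lin) with hG
    set Q := intervalForm L r.1 r.1 with hQ
    have hQ0 : 0 ≤ Q := hpos _
    have hG0 : 0 ≤ G := hpos _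
    -- Cauchy–Schwarz in the weighted estimate `h1`, then division by `Q`. Since the bubble is at
    -- most `L ^ 2`, `L ^ 4 * Q` also dominates the square norm of the bubble correction.
    have h3 : L ^ 4 * Q ≤ K ^ 2 * G := by
      rcases hQ0.eq_or_lt with h | h
      · rw [← h]; simp only [mul_zero]; positivity
      · refine le_of_mul_le_mul_right ?_ h
        calc L ^ 4 * Q * Q = (L ^ 2 * Q) ^ 2 := by ring
          _ ≤ (K * intervalForm L (f - lin) r.1) ^ 2 := pow_le_pow_left₀ (by positivity) h1 2
          _ = K ^ 2 * intervalForm L (f - lin) r.1 ^ 2 := by ring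
          _ ≤ K ^ 2 * (G * Q) := by gcongr
          _ = _ := by ring
    have h4 : intervalForm L (bubble L * r.1) (bubble L * r.1) ≤ L ^ 4 * Q := by
      have : intervalForm L (bubble L * r.1) (bubble L * r.1) ≤
          intervalForm L ((L ^ 2) • r.1) ((L ^ 2) • r.1) :=
        intervalForm_le_intervalForm hL.le fun s hs => by
          simp only [eval_mul, eval_smul, smul_eq_mul]
          nlinarith [mul_le_mul (bubble_le hs) (bubble_le hs) (bubble_nonneg hs) (by positivity),
            mul_le_mul_of_nonneg_right (mul_le_mul (bubble_le hs) (bubble_le hs) (bubble_nonneg hs)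
              (by positivity)) (mul_self_nonneg (r.1.eval s))]
      refine this.trans_eq ?_
      simp only [map_smul, LinearMap.smul_apply, smul_eq_mul]
      rw [← hQ]; ring
    have h5 := form_add_self_le (intervalForm L) hpos lin (bubble L * r.1)
    have h6 := form_sub_self_le (intervalForm L) hpos f lin
    have h7 := hpos f
    have h8 : K ^ 2 * G ≤ K ^ 2 * (2 * intervalForm L f f + 2 * (L * (a ^ 2 + b ^ 2))) := by
      gcongr
      linarith
    nlinarith

end PlatesComplex

namespace PlatesComplex

open MvPolynomial

/-! ### Shape-regular elements -/

/-- The scale-invariant geometric properties of an element on which the estimates depend: it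
contains a disc of comparable radius, and has at most `N` edges. -/
structure Element.IsShapeRegular (T : Element) (R : ℝ) (N : ℕ) : Prop where
  diam_pos : 0 < T.diam
  subset_closedBall : T.carrier ⊆ Metric.closedBall T.center T.diam
  exists_ball : ∃ (c : Plane) (r : ℝ), 0 < r ∧ dist T.center c + T.diam ≤ R * r ∧
    Metric.ball c r ⊆ T.carrier
  a_mem : ∀ E ∈ T.edges, E.a ∈ Metric.closedBall T.center T.diam
  b_mem : ∀ E ∈ T.edges, E.b ∈ Metric.closedBall T.center T.diam
  length_le : ∀ E ∈ T.edges, E.length ≤ T.diam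
  card_le : T.edges.card ≤ N

namespace MeshEdge

variable (E : MeshEdge)

theorem length_pos : 0 < E.length := dist_pos.2 E.ne

theorem norm_tangent : ‖E.tangent‖ = 1 := by
  have h : ‖E.b - E.a‖ = E.length := by rw [← dist_eq_norm, dist_comm]; rfl
  rw [tangent, norm_smul, h, norm_inv, Real.norm_of_nonneg E.length_pos.le,
    inv_mul_cancel₀ E.length_pos.ne']

theorem abs_tangent_le (i : Fin 2) : |E.tangent i| ≤ 1 :=
  (PiLp.norm_apply_le E.tangent i).trans E.norm_tangent.le

theorem abs_normal_le (i : Fin 2) : |E.normal i| ≤ 1 := by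
  fin_cases i
  · simpa [normal] using E.abs_tangent_le 1
  · simpa [normal] using E.abs_tangent_le 0

theorem point_mem_segment {s : ℝ} (hs : s ∈ Set.Icc 0 E.length) :
    E.point s ∈ segment ℝ E.a E.b := by
  refine ⟨1 - s / E.length, s / E.length, ?_, div_nonneg hs.1 E.length_pos.le, by ring, ?_⟩
  · exact sub_nonneg.2 ((div_le_one E.length_pos).2 hs.2)
  · rw [point, tangent, smul_smul, ← div_eq_mul_inv]
    module

/-- The restriction of a bivariate polynomial to an edge, in the arclength. -/
noncomputable def trace : Poly2 →ₐ[ℝ] Polynomial ℝ :=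
  aeval fun i => Polynomial.C (E.a i) + Polynomial.C (E.tangent i) * Polynomial.X

theorem eval_trace (p : Poly2) (s : ℝ) : (E.trace p).eval s = pval p (E.point s) := by
  induction p using MvPolynomial.induction_on with
  | C a => simp [trace, pval]
  | add p q hp hq =>
    simp only [pval, map_add, Polynomial.eval_add] at hp hq ⊢
    rw [hp, hq]
  | mul_X p i hp =>
    simp only [pval, map_mul, Polynomial.eval_mul] at hp ⊢
    rw [hp]
    simp [trace, point]
    ring_nf
    simp

theorem trace_mem_PolyE {p : Poly2} {m : ℕ} (hp : p ∈ PolyT m) : E.trace p ∈ PolyE m := by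
  have : (E.trace p).natDegree ≤ m * 1 := MvPolynomial.aeval_natDegree_le p hp _ fun i => by
    rw [add_comm]; exact Polynomial.natDegree_linear_le
  rwa [mul_one] at this

theorem integral_eq (f : Polynomial ℝ) (p : Poly2) :
    E.integral (fun s => f.eval s * pval p (E.point s)) = intervalForm E.length f (E.trace p) := by
  simp only [integral, intervalForm_apply, eval_trace]

theorem abs_trace_le {x : Plane} {h : ℝ} (hh : 0 < h) (ha : E.a ∈ Metric.closedBall x h)
    (hb : E.b ∈ Metric.closedBall x h) (p : Poly2) {s : ℝ} (hs : s ∈ Set.Icc 0 E.length) :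
    |(E.trace p).eval s| ≤ discNorm x h p := by
  rw [eval_trace]
  exact abs_pval_le_discNorm hh p
    ((convex_closedBall x h).segment_subset ha hb (E.point_mem_segment hs))

/-- The `L²` norm of a trace. -/
theorem intervalForm_trace_le {x : Plane} {h : ℝ} (hh : 0 < h) (ha : E.a ∈ Metric.closedBall x h)
    (hb : E.b ∈ Metric.closedBall x h) (hl : E.length ≤ h) (p : Poly2) :
    intervalForm E.length (E.trace p) (E.trace p) ≤ h * discNorm x h p ^ 2 :=
  (intervalForm_self_le E.length_pos.le fun _ hs => E.abs_trace_le hh ha hb p hs).trans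
    (by gcongr)

/-- Cauchy–Schwarz on the edge: the square norm of the trace brings a factor `h`, since the edge is
no longer than `h`, and this is the weight that `f` carries in the norms. -/
theorem abs_intervalForm_trace_le {x : Plane} {h : ℝ} (hh : 0 < h)
    (ha : E.a ∈ Metric.closedBall x h) (hb : E.b ∈ Metric.closedBall x h) (hl : E.length ≤ h)
    {f : Polynomial ℝ} {k : ℝ} (hk : 0 ≤ k) (hf : h * intervalForm E.length f f ≤ k ^ 2)
    (p : Poly2) : |intervalForm E.length f (E.trace p)| ≤ k * discNorm x h p := by
  refine abs_le_of_sq_le_sq ?_ (mul_nonneg hk (discNorm_nonneg p))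
  calc _ ≤ intervalForm E.length f f * intervalForm E.length (E.trace p) (E.trace p) :=
        intervalForm_sq_le E.length_pos.le _ _
    _ ≤ intervalForm E.length f f * (h * discNorm x h p ^ 2) :=
        mul_le_mul_of_nonneg_left (E.intervalForm_trace_le hh ha hb hl p)
          (intervalForm_self_nonneg E.length_pos.le f)
    _ = h * intervalForm E.length f f * discNorm x h p ^ 2 := by ring
    _ ≤ k ^ 2 * discNorm x h p ^ 2 := by gcongr
    _ = _ := by ring

end MeshEdge

/-! ### Tensor fields -/

theorem vcomp_sq_le (A : Tens ℝ) {u v : Plane} (hu : ∀ i, |u i| ≤ 1) (hv : ∀ i, |v i| ≤ 1) :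
    vcomp A u v ^ 2 ≤ 4 * ddot A A := by
  have h1 : ∀ i j, (A i j * u j * v i) ^ 2 ≤ A i j ^ 2 := fun i j => by
    rw [mul_pow, mul_pow]
    have h1 : u j ^ 2 ≤ 1 := (sq_le_one_iff_abs_le_one _).2 (hu j)
    have h2 : v i ^ 2 ≤ 1 := (sq_le_one_iff_abs_le_one _).2 (hv i)
    calc A i j ^ 2 * u j ^ 2 * v i ^ 2 ≤ A i j ^ 2 * 1 * 1 := by gcongr
      _ = _ := by ring
  have h2 : vcomp A u v = A 0 0 * u 0 * v 0 + A 0 1 * u 1 * v 0 + (A 1 0 * u 0 * v 1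
      + A 1 1 * u 1 * v 1) := by
    simp [vcomp, Matrix.mulVec, dotProduct, Fin.sum_univ_two]
    ring
  rw [h2]
  simp only [ddot, Fin.sum_univ_two]
  have a := h1 0 0
  have b := h1 0 1
  have c := h1 1 0
  have d := h1 1 1
  generalize A 0 0 * u 0 * v 0 = p at *
  generalize A 0 1 * u 1 * v 0 = q at *
  generalize A 1 0 * u 0 * v 1 = r at *
  generalize A 1 1 * u 1 * v 1 = s at *
  nlinarith [sq_nonneg (p - q), sq_nonneg (p - r), sq_nonneg (p - s), sq_nonneg (q - r),
    sq_nonneg (q - s), sq_nonneg (r - s)]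

theorem ddot_self_nonneg (A : Tens ℝ) : 0 ≤ ddot A A :=
  Finset.sum_nonneg fun _ _ => Finset.sum_nonneg fun _ _ => mul_self_nonneg _

theorem ddot_sub_self_le (A B : Tens ℝ) :
    ddot (A - B) (A - B) ≤ 2 * ddot A A + 2 * ddot B B := by
  simp only [ddot, Fin.sum_univ_two, Matrix.sub_apply]
  nlinarith [sq_nonneg (A 0 0 + B 0 0), sq_nonneg (A 0 1 + B 0 1), sq_nonneg (A 1 0 + B 1 0),
    sq_nonneg (A 1 1 + B 1 1)]

/-! ### Normal, shear and vertex values of tensor fields in the disc norm. -/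

section discNorm

variable {x : Plane} {h : ℝ}

theorem discNorm_ddot_le (A B : Tens Poly2) :
    discNorm x h (ddot A B) ≤ tensNorm x h A * tensNorm x h B := by
  have h1 : discNorm x h (ddot A B) ≤ ∑ i, ∑ j, discNorm x h (A i j) * tensNorm x h B := by
    refine (discNorm_sum_le _ _).trans (Finset.sum_le_sum fun i _ => (discNorm_sum_le _ _).trans
      (Finset.sum_le_sum fun j _ => (discNorm_mul_le _ _).trans ?_))
    exact mul_le_mul_of_nonneg_left (discNorm_le_tensNorm B i j) (discNorm_nonneg _)
  refine h1.trans_eq ?_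
  simp only [tensNorm, Finset.sum_mul]

theorem discNorm_dirDeriv_le (hh : 0 < h) {v : Plane} (hv : ∀ i, |v i| ≤ 1) {q : Poly2} {m : ℕ}
    (hq : q ∈ PolyT m) : h * discNorm x h (dirDeriv v q) ≤ 2 * m * discNorm x h q := by
  have h1 : ∀ i, discNorm x h (C (v i) * pderiv i q) ≤ discNorm x h (pderiv i q) := fun i =>
    (discNorm_C_mul_le _ _).trans (mul_le_of_le_one_left (discNorm_nonneg _) (hv i))
  have h2 : discNorm x h (dirDeriv v q) ≤
      discNorm x h (pderiv 0 q) + discNorm x h (pderiv 1 q) := by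
    refine (discNorm_sum_le _ _).trans ?_
    rw [Fin.sum_univ_two]
    exact add_le_add (h1 0) (h1 1)
  have h3 := mul_le_mul_of_nonneg_left h2 hh.le
  linarith [discNorm_pderiv_le (x := x) hh hq 0, discNorm_pderiv_le (x := x) hh hq 1]

theorem dirDeriv_mem_PolyT (v : Plane) {q : Poly2} {m : ℕ} (hq : q ∈ PolyT m) :
    dirDeriv v q ∈ PolyT (m - 1) :=
  sum_mem_PolyT fun i _ => C_mul_mem_PolyT _ (pderiv_mem_PolyT hq i)

theorem tcomp_eq (A : Tens Poly2) (u v : Plane) :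
    tcomp A u v = ∑ i, ∑ j, C (v i) * (C (u j) * A i j) := by
  simp only [tcomp, Matrix.mulVec, dotProduct, constVec, Fin.sum_univ_two]
  ring

theorem discNorm_tcomp_le (A : Tens Poly2) {u v : Plane} (hu : ∀ i, |u i| ≤ 1)
    (hv : ∀ i, |v i| ≤ 1) : discNorm x h (tcomp A u v) ≤ tensNorm x h A := by
  rw [tcomp_eq]
  refine (discNorm_sum_le _ _).trans (Finset.sum_le_sum fun i _ => (discNorm_sum_le _ _).trans
      (Finset.sum_le_sum fun j _ => (discNorm_C_mul_le _ _).trans ?_))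
  refine (mul_le_of_le_one_left (discNorm_nonneg _) (hv i)).trans ?_
  exact (discNorm_C_mul_le _ _).trans (mul_le_of_le_one_left (discNorm_nonneg _) (hu j))

theorem tcomp_mem_PolyT {A : Tens Poly2} {m : ℕ} (hA : ∀ i j, A i j ∈ PolyT m) (u v : Plane) :
    tcomp A u v ∈ PolyT m := by
  rw [tcomp_eq]
  exact sum_mem_PolyT fun i _ => sum_mem_PolyT fun j _ =>
    C_mul_mem_PolyT _ (C_mul_mem_PolyT _ (hA i j))

theorem discNorm_vdiv_le (hh : 0 < h) {A : Tens Poly2} {m : ℕ} (hA : ∀ i j, A i j ∈ PolyT m)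
    {v : Plane} (hv : ∀ i, |v i| ≤ 1) :
    h * discNorm x h (vdiv A ⬝ᵥ constVec v) ≤ m * tensNorm x h A := by
  have h1 : vdiv A ⬝ᵥ constVec v = ∑ i, C (v i) * ∑ j, pderiv j (A i j) := by
    simp only [dotProduct, vdiv, constVec, mul_comm]
  have h2 : discNorm x h (vdiv A ⬝ᵥ constVec v) ≤ ∑ i, ∑ j, discNorm x h (pderiv j (A i j)) := by
    rw [h1]
    refine (discNorm_sum_le _ _).trans (Finset.sum_le_sum fun i _ =>
      (discNorm_C_mul_le _ _).trans ?_)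
    exact (mul_le_of_le_one_left (discNorm_nonneg _) (hv i)).trans (discNorm_sum_le _ _)
  refine (mul_le_mul_of_nonneg_left h2 hh.le).trans ?_
  simp only [tensNorm, Finset.mul_sum]
  exact Finset.sum_le_sum fun i _ => Finset.sum_le_sum fun j _ => discNorm_pderiv_le hh (hA i j) j

/-- The shear trace of a tensor field on an edge. -/
theorem discNorm_shear_le (hh : 0 < h) {A : Tens Poly2} {m : ℕ} (hA : ∀ i j, A i j ∈ PolyT m)
    {u v : Plane} (hu : ∀ i, |u i| ≤ 1) (hv : ∀ i, |v i| ≤ 1) :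
    h * discNorm x h (dirDeriv u (tcomp A v u) + vdiv A ⬝ᵥ constVec v) ≤
      3 * m * tensNorm x h A := by
  have h1 := discNorm_dirDeriv_le (x := x) hh hu (tcomp_mem_PolyT hA v u)
  have h2 := discNorm_vdiv_le (x := x) hh hA hv
  have h3 : (2 * m : ℝ) * discNorm x h (tcomp A v u) ≤ 2 * m * tensNorm x h A :=
    mul_le_mul_of_nonneg_left (discNorm_tcomp_le A hv hu) (by positivity)
  have h4 := mul_le_mul_of_nonneg_left (discNorm_add_le (x := x) (h := h)
    (dirDeriv u (tcomp A v u)) (vdiv A ⬝ᵥ constVec v)) hh.le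
  linarith

theorem ddot_tval_le (hh : 0 < h) (A : Tens Poly2) {y : Plane} (hy : y ∈ Metric.closedBall x h) :
    ddot (tval A y) (tval A y) ≤ 4 * tensNorm x h A ^ 2 := by
  have h1 : ∀ i j, pval (A i j) y * pval (A i j) y ≤ tensNorm x h A ^ 2 := fun i j => by
    rw [← sq, ← sq_abs]
    exact pow_le_pow_left₀ (abs_nonneg _)
      ((abs_pval_le_discNorm hh _ hy).trans (discNorm_le_tensNorm A i j)) 2
  simp only [ddot, tval, Matrix.of_apply, Fin.sum_univ_two]
  linarith [h1 0 0, h1 0 1, h1 1 0, h1 1 1]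

end discNorm

/-- The `L²` form on tensor fields over a bounded set. -/
noncomputable def tensForm (S : Set Plane) (hS : Bornology.IsBounded S) :
    LinearMap.BilinForm ℝ (Tens Poly2) :=
  LinearMap.mk₂ ℝ (fun A B => ∑ i, ∑ j, domainForm S hS (A i j) (B i j))
    (fun A A' B => by simp [Finset.sum_add_distrib])
    (fun a A B => by simp [mul_add])
    (fun A B B' => by simp [Finset.sum_add_distrib])
    (fun a A B => by simp [mul_add])

section tensForm

variable {S : Set Plane} (hS : Bornology.IsBounded S)

theorem tensForm_apply (A B : Tens Poly2) :
    tensForm S hS A B = ∑ i, ∑ j, domainForm S hS (A i j) (B i j) := rfl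

theorem tensForm_eq_integral (A B : Tens Poly2) :
    tensForm S hS A B = ∫ x in S, pval (ddot A B) x := by
  have h1 : tensForm S hS A B = domainForm S hS (ddot A B) 1 := by
    rw [tensForm_apply, ddot]
    simp [domainForm_apply]
  rw [h1, domainForm_apply, mul_one]

theorem tensForm_comm (A B : Tens Poly2) : tensForm S hS A B = tensForm S hS B A := by
  simp only [tensForm_apply, domainForm_comm hS (A _ _)]

theorem tensForm_self_nonneg (A : Tens Poly2) : 0 ≤ tensForm S hS A A := by
  rw [tensForm_apply]
  exact Finset.sum_nonneg fun _ _ => Finset.sum_nonneg fun _ _ => domainForm_self_nonneg hS _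

theorem domainForm_le_tensForm (A : Tens Poly2) (i j : Fin 2) :
    domainForm S hS (A i j) (A i j) ≤ tensForm S hS A A :=
  (Finset.single_le_sum (f := fun j => domainForm S hS (A i j) (A i j))
    (fun _ _ => domainForm_self_nonneg hS _) (Finset.mem_univ j)).trans
  (Finset.single_le_sum (f := fun i => ∑ j, domainForm S hS (A i j) (A i j))
    (fun _ _ => Finset.sum_nonneg fun _ _ => domainForm_self_nonneg hS _) (Finset.mem_univ i))

theorem tensForm_sq_le (A B : Tens Poly2) :
    tensForm S hS A B ^ 2 ≤ tensForm S hS A A * tensForm S hS B B :=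
  (tensForm S hS).apply_sq_le_of_symm (tensForm_self_nonneg hS)
    ⟨fun A B => tensForm_comm hS A B⟩ A B

/-- A field whose product with `B` is the square norm of `B` is at least as large as `B`. -/
theorem tensForm_self_le_of_eq {A B : Tens Poly2} (h : tensForm S hS A B = tensForm S hS B B) :
    tensForm S hS B B ≤ tensForm S hS A A := by
  have h1 := tensForm_sq_le hS A B
  rw [h, sq] at h1
  rcases (tensForm_self_nonneg hS B).eq_or_lt with h2 | h2
  · rw [← h2]; exact tensForm_self_nonneg hS A
  · exact le_of_mul_le_mul_right h1 h2

end tensForm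

/-! ### Comparison of L² norms with disc norms on shape-regular elements. -/

namespace Element.IsShapeRegular

variable {T : Element} {R : ℝ} {N : ℕ}

theorem isBounded (hT : T.IsShapeRegular R N) : Bornology.IsBounded T.carrier :=
  Metric.isBounded_closedBall.subset hT.subset_closedBall

/-- The inverse estimate with squares removed: `k` stands for any bound of the L² norm, so that
estimates can be chained linearly. -/
theorem exists_discNorm_le (m : ℕ) {R : ℝ} (hR : 1 ≤ R) : ∃ K : ℝ, 0 < K ∧
    ∀ (T : Element) (N : ℕ) (hT : T.IsShapeRegular R N), ∀ p ∈ PolyT m, ∀ k, 0 ≤ k →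
      domainForm T.carrier hT.isBounded p p ≤ k ^ 2 →
      T.diam * discNorm T.center T.diam p ≤ K * k := by
  obtain ⟨C, hC, h⟩ := exists_discNorm_sq_le m hR
  refine ⟨Real.sqrt C, Real.sqrt_pos.2 hC, fun T N hT p hp k hk hpk => ?_⟩
  obtain ⟨c, r, hr, hcr, hball⟩ := hT.exists_ball
  have h1 := h T.carrier T.center c T.diam r hT.diam_pos hr hcr hT.isBounded hball p hp
  refine le_of_sq_le_sq ?_ (by positivity)
  rw [mul_pow, mul_pow, Real.sq_sqrt hC.le]
  exact h1.trans (mul_le_mul_of_nonneg_left hpk hC.le)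

theorem exists_tensNorm_le (m : ℕ) {R : ℝ} (hR : 1 ≤ R) : ∃ K : ℝ, 0 < K ∧
    ∀ (T : Element) (N : ℕ) (hT : T.IsShapeRegular R N) (A : Tens Poly2),
      (∀ i j, A i j ∈ PolyT m) → ∀ k, 0 ≤ k → tensForm T.carrier hT.isBounded A A ≤ k ^ 2 →
      T.diam * tensNorm T.center T.diam A ≤ K * k := by
  obtain ⟨K, hK, h⟩ := exists_discNorm_le m hR
  refine ⟨4 * K, by positivity, fun T N hT A hA k hk hAk => ?_⟩
  have h1 := fun i j => h T N hT (A i j) (hA i j) k hk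
    ((domainForm_le_tensForm hT.isBounded A i j).trans hAk)
  simp only [tensNorm, Fin.sum_univ_two]
  linarith [h1 0 0, h1 0 1, h1 1 0, h1 1 1]

/-- The converse direction: with `exists_tensNorm_le`, the L² norm is comparable to `T.diam` times
the tensor norm. -/
theorem abs_tensForm_le (hT : T.IsShapeRegular R N) (A B : Tens Poly2) :
    |tensForm T.carrier hT.isBounded A B| ≤
      4 * T.diam ^ 2 * (tensNorm T.center T.diam A * tensNorm T.center T.diam B) := by
  rw [tensForm_eq_integral]
  refine (abs_setIntegral_pval_le hT.diam_pos hT.subset_closedBall _).trans ?_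
  have := discNorm_ddot_le (x := T.center) (h := T.diam) A B
  have := hT.diam_pos
  gcongr

theorem abs_domainForm_le (hT : T.IsShapeRegular R N) (p q : Poly2) :
    |domainForm T.carrier hT.isBounded p q| ≤
      4 * T.diam ^ 2 * (discNorm T.center T.diam p * discNorm T.center T.diam q) := by
  rw [domainForm_apply]
  refine (abs_setIntegral_pval_le hT.diam_pos hT.subset_closedBall _).trans ?_
  have := discNorm_mul_le (x := T.center) (h := T.diam) p q
  have := hT.diam_pos
  gcongr

/-- The inverse estimate with `k = 0`, in the degree of `p` itself; only definiteness is wanted, so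
the constant is irrelevant. -/
theorem eq_zero_of_domainForm (hR : 1 ≤ R) (hT : T.IsShapeRegular R N) {p : Poly2}
    (h : domainForm T.carrier hT.isBounded p p = 0) : p = 0 := by
  obtain ⟨K, -, hK⟩ := exists_discNorm_le p.totalDegree hR
  have h1 := hK T N hT p (le_refl p.totalDegree) 0 le_rfl (by rw [h]; norm_num)
  rw [mul_zero] at h1
  have h2 := le_antisymm (nonpos_of_mul_nonpos_right h1 hT.diam_pos) (discNorm_nonneg p)
  refine scale_injective T.center hT.diam_pos.ne' ?_
  rw [map_zero]
  exact coeffNorm_eq_zero h2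

theorem eq_zero_of_tensForm (hR : 1 ≤ R) (hT : T.IsShapeRegular R N) {A : Tens Poly2}
    (h : tensForm T.carrier hT.isBounded A A = 0) : A = 0 := by
  refine Matrix.ext fun i j => hT.eq_zero_of_domainForm hR (le_antisymm ?_ ?_)
  · exact (domainForm_le_tensForm _ A i j).trans h.le
  · exact domainForm_self_nonneg _ _

end Element.IsShapeRegular

end PlatesComplex

namespace PlatesComplex

open MvPolynomial

/-! ### Existence of the reconstructions -/

/-- For test vectors parametrised with redundancy by `D`: since `f` vanishes on the kernel, it
descends to `V`, and a linear right inverse of `D` realises the descent. The tensor potential needs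
this, its test fields being parametrised by pairs `(q, υ)`. -/
theorem existsUnique_form_eq_of_surjective {V W : Type*} [AddCommGroup V] [Module ℝ V]
    [AddCommGroup W] [Module ℝ W] [FiniteDimensional ℝ V] (B : LinearMap.BilinForm ℝ V)
    (hB : ∀ v, B v v = 0 → v = 0) (D : W →ₗ[ℝ] V) (hD : Function.Surjective D) (f : W →ₗ[ℝ] ℝ)
    (hf : ∀ w, D w = 0 → f w = 0) : ∃! v, ∀ w, B v (D w) = f w := by
  obtain ⟨S, hS⟩ := D.exists_rightInverse_of_surjective (LinearMap.range_eq_top.2 hD)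
  have hDS : ∀ v, D (S v) = v := fun v => LinearMap.congr_fun hS v
  obtain ⟨v, hv, huniq⟩ := existsUnique_form_eq B hB (f ∘ₗ S)
  refine ⟨v, fun w => ?_, fun v' hv' => huniq v' fun u => ?_⟩
  · rw [hv (D w), LinearMap.comp_apply]
    have := hf (S (D w) - w) (by rw [map_sub, hDS, sub_self])
    rwa [map_sub, sub_eq_zero] at this
  · rw [LinearMap.comp_apply, ← hv', hDS]

theorem hess_add (p q : Poly2) : hess (p + q) = hess p + hess q := by
  ext i j : 2; simp [hess]

theorem hess_smul (a : ℝ) (p : Poly2) : hess (a • p) = a • hess p := by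
  ext i j : 2; simp [hess]

theorem dirDeriv_add (v : Plane) (p q : Poly2) :
    dirDeriv v (p + q) = dirDeriv v p + dirDeriv v q := by
  simp [dirDeriv, mul_add, Finset.sum_add_distrib]

theorem dirDeriv_smul (v : Plane) (a : ℝ) (p : Poly2) :
    dirDeriv v (a • p) = a • dirDeriv v p := by
  simp [dirDeriv]

theorem add_mem_CHess {x : Plane} {m : ℕ} {A B : Tens Poly2} (hA : A ∈ CHess x m)
    (hB : B ∈ CHess x m) : A + B ∈ CHess x m := by
  obtain ⟨v, hv, rfl⟩ := hA
  obtain ⟨w, hw, rfl⟩ := hB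
  refine ⟨v + w, fun i => add_mem_PolyT (hv i) (hw i), ?_⟩
  refine Matrix.ext fun i j => ?_
  simp only [symPart, Matrix.vecMulVec_apply, Matrix.of_apply, Matrix.add_apply, Pi.add_apply]
  ring

theorem smul_mem_CHess {x : Plane} {m : ℕ} (a : ℝ) {A : Tens Poly2} (hA : A ∈ CHess x m) :
    a • A ∈ CHess x m := by
  obtain ⟨v, hv, rfl⟩ := hA
  refine ⟨a • v, fun i => ?_, ?_⟩
  · rw [Pi.smul_apply, smul_eq_C_mul]
    exact C_mul_mem_PolyT _ (hv i)
  · refine Matrix.ext fun i j => ?_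
    simp only [symPart, Matrix.vecMulVec_apply, Matrix.of_apply, Matrix.smul_apply, Pi.smul_apply,
      smul_eq_C_mul]
    ring

/-- The complement of Hessians, as a subspace. -/
noncomputable def CHess.submodule (x : Plane) (m : ℕ) : Submodule ℝ (Tens Poly2) where
  carrier := CHess x m
  add_mem' := add_mem_CHess
  zero_mem' := ⟨0, fun _ => zero_mem_PolyT m, by ext i j : 2; simp [symPart]⟩
  smul_mem' a _ := smul_mem_CHess a

theorem symPart_isSymm (A : Tens Poly2) : (symPart A).IsSymm :=
  Matrix.IsSymm.ext fun i j => by simp [symPart, add_comm]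

theorem perpField_mem_PolyT (x : Plane) (i : Fin 2) : perpField x i ∈ PolyT 1 := by
  fin_cases i
  · exact sub_mem_PolyT (X_mem_PolyT 1) (C_mem_PolyT _ _)
  · exact neg_mem_PolyT (sub_mem_PolyT (X_mem_PolyT 0) (C_mem_PolyT _ _))

theorem CHess_subset_SymPolyT (x : Plane) (m : ℕ) : CHess x m ⊆ SymPolyT (m + 1) := by
  rintro _ ⟨v, hv, rfl⟩
  refine ⟨symPart_isSymm _, fun i j => C_mul_mem_PolyT _ ?_⟩
  rw [add_comm m 1]
  exact add_mem_PolyT (mul_mem_PolyT (perpField_mem_PolyT x i) (hv j))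
    (mul_mem_PolyT (perpField_mem_PolyT x j) (hv i))

theorem hess_mem_SymPolyT {q : Poly2} {m : ℕ} (hq : q ∈ PolyT (m + 2)) : hess q ∈ SymPolyT m :=
  ⟨hess_isSymm q, fun i j => pderiv_mem_PolyT (pderiv_mem_PolyT hq j) i⟩

/-- Symmetric polynomial tensor fields, as a subspace. -/
noncomputable def SymPolyT.submodule (m : ℕ) : Submodule ℝ (Tens Poly2) where
  carrier := SymPolyT m
  add_mem' hA hB := ⟨hA.1.add hB.1, fun i j => add_mem_PolyT (hA.2 i j) (hB.2 i j)⟩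
  zero_mem' := ⟨Matrix.isSymm_zero, fun _ _ => zero_mem_PolyT m⟩
  smul_mem' a A hA := ⟨hA.1.smul a, fun i j => by
    rw [Matrix.smul_apply, smul_eq_C_mul]; exact C_mul_mem_PolyT _ (hA.2 i j)⟩

instance (m : ℕ) : FiniteDimensional ℝ (SymPolyT.submodule m) := by
  let f : SymPolyT.submodule m →ₗ[ℝ] (Fin 2 → Fin 2 → restrictTotalDegree (Fin 2) ℝ m) :=
    { toFun := fun A i j => ⟨A.1 i j, (mem_restrictTotalDegree _ _ _).2 (A.2.2 i j)⟩
      map_add' := fun _ _ => rfl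
      map_smul' := fun _ _ => rfl }
  refine Module.Finite.of_injective f fun A B h => Subtype.ext (Matrix.ext fun i j => ?_)
  exact congrArg Subtype.val (congrFun (congrFun h i) j)

/-! ### Well-posedness of the edge potential, of `DD` and of the tensor potential. -/

namespace LocalSigma

variable {T : Element} {m : ℕ} (τ : LocalSigma (m + 2) T)

/-- The boundary contributions in the definition of the reconstructions, as a linear function of
the test function; `g` stands for the normal-normal components on the edges. -/
noncomputable def boundaryTerm (g : {E // E ∈ T.edges} → Polynomial ℝ) : Poly2 →ₗ[ℝ] ℝ where
  toFun q := τ.vertexTerm q + ∑ E : {E // E ∈ T.edges}, T.orient E.1 *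
    (intervalForm E.1.length (g E) (E.1.trace (dirDeriv E.1.normal q))
      - intervalForm E.1.length (τ.edgeD E) (E.1.trace q))
  map_add' p q := by
    simp only [vertexTerm, pval_add, dirDeriv_add, map_add]
    rw [← Finset.sum_add_distrib, ← Finset.sum_add_distrib, ← Finset.sum_add_distrib,
      ← Finset.sum_add_distrib]
    exact Finset.sum_congr rfl fun E _ => by ring
  map_smul' a q := by
    simp only [vertexTerm, pval_smul, dirDeriv_smul, map_smul, smul_eq_mul, RingHom.id_apply]
    rw [← Finset.sum_add_distrib, ← Finset.sum_add_distrib, Finset.mul_sum]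
    exact Finset.sum_congr rfl fun E _ => by ring

theorem boundaryTerm_apply (g : {E // E ∈ T.edges} → Polynomial ℝ) (q : Poly2) :
    τ.boundaryTerm g q = τ.vertexTerm q + ∑ E : {E // E ∈ T.edges}, T.orient E.1 *
      (E.1.integral (fun s => (g E).eval s * pval (dirDeriv E.1.normal q) (E.1.point s))
        - E.1.integral (fun s => (τ.edgeD E).eval s * pval q (E.1.point s))) := by
  simp only [MeshEdge.integral_eq]
  rfl

theorem existsUnique_edgePotential (E : {E // E ∈ T.edges}) :
    ∃! p, τ.IsEdgePotential E p := by
  obtain ⟨K, -, h⟩ := exists_edge_interpolant m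
  obtain ⟨p, hp, h0, hL, horth, -⟩ := h E.1.length E.1.length_pos
    (vcomp (τ.vertA E) E.1.normal E.1.normal) (vcomp (τ.vertB E) E.1.normal E.1.normal)
    (τ.edge E) (τ.edge_mem E)
  refine ⟨p, ⟨hp, h0, hL, τ.edge_mem E, horth⟩, fun p' hp' => ?_⟩
  refine sub_eq_zero.1 (eq_zero_of_endpoints_of_orthogonal E.1.length_pos (m := m) ?_ ?_ ?_ ?_)
  · exact (Polynomial.natDegree_sub_le _ _).trans (max_le hp'.1 hp)
  · rw [Polynomial.eval_sub, h0, hp'.2.1, sub_self]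
  · rw [Polynomial.eval_sub, hL, hp'.2.2.1, sub_self]
  · intro w hw
    rw [map_sub, LinearMap.sub_apply, sub_eq_zero]
    exact (hp'.2.2.2.2 w hw).symm.trans (horth w hw)

theorem edgePotential_spec (E : {E // E ∈ T.edges}) :
    τ.IsEdgePotential E (τ.edgePotential E) := theUnique_spec (τ.existsUnique_edgePotential E)

/-- The moments of the edge potential are those of the edge component. -/
theorem intervalForm_edgePotential (E : {E // E ∈ T.edges}) {w : Polynomial ℝ} (hw : w ∈ PolyE m) :
    intervalForm E.1.length (τ.edgePotential E) w = intervalForm E.1.length (τ.edge E) w :=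
  ((τ.edgePotential_spec E).2.2.2.2 w hw).symm

/-- The normal derivative of such a `q` has degree at most `m = ℓ - 2` on the edge, and up to this
degree `P_E τ` and `τ_E` have equal moments. -/
theorem boundaryTerm_edgePotential {q : Poly2} (hq : q ∈ PolyT (m + 1)) :
    τ.boundaryTerm τ.edgePotential q = τ.boundaryTerm τ.edge q := by
  refine congrArg (τ.vertexTerm q + ·) (Finset.sum_congr rfl fun E _ => ?_)
  rw [τ.intervalForm_edgePotential E (E.1.trace_mem_PolyE (dirDeriv_mem_PolyT E.1.normal hq))]

section

variable {R : ℝ} {N : ℕ}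

theorem isDD_iff (hT : T.IsShapeRegular R N) (d : Poly2) : τ.IsDD d ↔ d ∈ PolyT (m + 1) ∧ ∀ q ∈ PolyT (m + 1),
    domainForm T.carrier hT.isBounded d q =
      tensForm T.carrier hT.isBounded τ.cell (hess q) - τ.boundaryTerm τ.edge q := by
  refine and_congr Iff.rfl (forall₂_congr fun q _ => ?_)
  rw [tensForm_eq_integral, boundaryTerm_apply, ← sub_sub]
  rfl

theorem existsUnique_DD (hR : 1 ≤ R) (hT : T.IsShapeRegular R N) : ∃! d, τ.IsDD d := by
  let V := restrictTotalDegree (Fin 2) ℝ (m + 1)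
  have hV : ∀ {q : Poly2}, q ∈ V ↔ q ∈ PolyT (m + 1) := mem_restrictTotalDegree _ _ _
  let f : Poly2 →ₗ[ℝ] ℝ :=
    (tensForm T.carrier hT.isBounded τ.cell) ∘ₗ
      ({ toFun := hess, map_add' := hess_add, map_smul' := hess_smul } : Poly2 →ₗ[ℝ] Tens Poly2)
    - τ.boundaryTerm τ.edge
  obtain ⟨d, hd, huniq⟩ := existsUnique_form_eq
    ((domainForm T.carrier hT.isBounded).compl₁₂ V.subtype V.subtype)
    (fun v hv => Subtype.ext (hT.eq_zero_of_domainForm hR hv)) (f ∘ₗ V.subtype)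
  refine ⟨d.1, (τ.isDD_iff hT _).2 ⟨hV.1 d.2, fun q hq => hd ⟨q, hV.2 hq⟩⟩, fun d' hd' => ?_⟩
  have h := (τ.isDD_iff hT _).1 hd'
  exact congrArg Subtype.val (huniq ⟨d', hV.2 h.1⟩ fun w => h.2 w.1 (hV.1 w.2))

theorem DD_mem (hR : 1 ≤ R) (hT : T.IsShapeRegular R N) : τ.DD ∈ PolyT (m + 1) := (theUnique_spec (τ.existsUnique_DD hR hT)).1

theorem domainForm_DD (hR : 1 ≤ R) (hT : T.IsShapeRegular R N) {q : Poly2} (hq : q ∈ PolyT (m + 1)) :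
    domainForm T.carrier hT.isBounded τ.DD q =
      tensForm T.carrier hT.isBounded τ.cell (hess q) - τ.boundaryTerm τ.edge q :=
  ((τ.isDD_iff hT _).1 (theUnique_spec (τ.existsUnique_DD hR hT))).2 q hq

theorem isPotential_iff (hT : T.IsShapeRegular R N) (P : Tens Poly2) : τ.IsPotential P ↔ P ∈ SymPolyT (m + 2) ∧
    ∀ q ∈ PolyT (m + 4), ∀ υ ∈ CHess T.center (m + 1),
      tensForm T.carrier hT.isBounded P (hess q + υ) =
        domainForm T.carrier hT.isBounded τ.DD q + τ.boundaryTerm τ.edgePotential q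
        + tensForm T.carrier hT.isBounded τ.cellC υ := by
  refine and_congr Iff.rfl (forall₄_congr fun q _ υ _ => ?_)
  rw [tensForm_eq_integral, tensForm_eq_integral, boundaryTerm_apply, domainForm_apply,
    ← add_assoc]
  rfl

/-- The fields `hess q + υ` exhaust the symmetric fields, and such a sum vanishes only if `q` is
affine and `υ = 0`. The right-hand side vanishes on these pairs, because an affine `q` is admissible
in the definition of `DD` and has zero Hessian. -/
theorem existsUnique_potential (hR : 1 ≤ R) (hT : T.IsShapeRegular R N) : ∃! P, τ.IsPotential P := by
  let W := restrictTotalDegree (Fin 2) ℝ (m + 4)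
  have hW : ∀ {q : Poly2}, q ∈ W ↔ q ∈ PolyT (m + 4) := mem_restrictTotalDegree _ _ _
  let V := SymPolyT.submodule (m + 2)
  let U := CHess.submodule T.center (m + 1)
  let D : (W × U) →ₗ[ℝ] V :=
    { toFun := fun w => ⟨hess w.1.1 + w.2.1,
        V.add_mem (hess_mem_SymPolyT (hW.1 w.1.2)) (CHess_subset_SymPolyT _ _ w.2.2)⟩
      map_add' := fun w w' => Subtype.ext (by
        change hess (w.1.1 + w'.1.1) + (w.2.1 + w'.2.1) = hess w.1.1 + w.2.1 + (hess w'.1.1 + w'.2.1)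
        rw [hess_add]; abel)
      map_smul' := fun a w => Subtype.ext (by
        change hess (a • w.1.1) + a • w.2.1 = a • (hess w.1.1 + w.2.1)
        rw [hess_smul, smul_add]) }
  let f : (W × U) →ₗ[ℝ] ℝ :=
    ((domainForm T.carrier hT.isBounded τ.DD + τ.boundaryTerm τ.edgePotential) ∘ₗ W.subtype) ∘ₗ
      LinearMap.fst ℝ W U
    + ((tensForm T.carrier hT.isBounded τ.cellC) ∘ₗ U.subtype) ∘ₗ LinearMap.snd ℝ W U
  have hD : Function.Surjective D := by
    rintro ⟨A, hA⟩
    obtain ⟨q, hq, υ, hυ, hAe, -⟩ :=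
      exists_stable_decomposition (x := T.center) hT.diam_pos (m := m + 1) hA
    exact ⟨(⟨q, hW.2 hq⟩, ⟨υ, hυ⟩), Subtype.ext hAe.symm⟩
  have hf : ∀ w, D w = 0 → f w = 0 := by
    rintro ⟨⟨q, hq⟩, ⟨υ, hυ⟩⟩ hw
    have h0 : hess q + υ = 0 := congrArg Subtype.val hw
    have hq1 : q ∈ PolyT 1 := mem_PolyT_one_of_hess_add_eq_zero hυ h0
    have hq0 := hess_eq_zero_of_mem_PolyT_one hq1
    have hυ0 : υ = 0 := by rwa [hq0, zero_add] at h0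
    have hqm : q ∈ PolyT (m + 1) := PolyT_mono (by omega) hq1
    change domainForm T.carrier hT.isBounded τ.DD q + τ.boundaryTerm τ.edgePotential q
      + tensForm T.carrier hT.isBounded τ.cellC υ = 0
    rw [τ.domainForm_DD hR hT hqm, τ.boundaryTerm_edgePotential hqm, hq0, hυ0]
    simp only [map_zero]
    ring
  obtain ⟨P, hP, huniq⟩ := existsUnique_form_eq_of_surjective
    ((tensForm T.carrier hT.isBounded).compl₁₂ V.subtype V.subtype)
    (fun v hv => Subtype.ext (hT.eq_zero_of_tensForm hR hv)) D hD f hf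
  refine ⟨P.1, (τ.isPotential_iff hT _).2 ⟨P.2, fun q hq υ hυ =>
    hP (⟨q, hW.2 hq⟩, ⟨υ, hυ⟩)⟩, fun P' hP' => ?_⟩
  have h := (τ.isPotential_iff hT _).1 hP'
  exact congrArg Subtype.val (huniq ⟨P', h.1⟩ fun w => h.2 w.1.1 (hW.1 w.1.2) w.2.1 w.2.2)

theorem potential_mem (hR : 1 ≤ R) (hT : T.IsShapeRegular R N) : τ.potential ∈ SymPolyT (m + 2) :=
  (theUnique_spec (τ.existsUnique_potential hR hT)).1

theorem tensForm_potential (hR : 1 ≤ R) (hT : T.IsShapeRegular R N) {q : Poly2} (hq : q ∈ PolyT (m + 4)) {υ : Tens Poly2}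
    (hυ : υ ∈ CHess T.center (m + 1)) :
    tensForm T.carrier hT.isBounded τ.potential (hess q + υ) =
      domainForm T.carrier hT.isBounded τ.DD q + τ.boundaryTerm τ.edgePotential q
      + tensForm T.carrier hT.isBounded τ.cellC υ :=
  ((τ.isPotential_iff hT _).1 (theUnique_spec (τ.existsUnique_potential hR hT))).2 q hq υ hυ

/-- The component in the complement is the `L²` projection of the potential. -/
theorem tensForm_potential_cellC (hR : 1 ≤ R) (hT : T.IsShapeRegular R N) :
    tensForm T.carrier hT.isBounded τ.potential τ.cellC =
      tensForm T.carrier hT.isBounded τ.cellC τ.cellC := by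
  have h := τ.tensForm_potential hR hT (zero_mem_PolyT _) τ.cellC_mem
  have h0 : hess 0 = 0 := hess_eq_zero_of_mem_PolyT_one (zero_mem_PolyT 1)
  rwa [h0, zero_add, map_zero, map_zero, zero_add, zero_add] at h

/-- The Hessian component is the `L²` projection of the potential. -/
theorem tensForm_potential_cell (hR : 1 ≤ R) (hT : T.IsShapeRegular R N) :
    tensForm T.carrier hT.isBounded τ.potential τ.cell =
      tensForm T.carrier hT.isBounded τ.cell τ.cell := by
  obtain ⟨q, hq, hcell⟩ := τ.cell_mem
  have hq' : q ∈ PolyT (m + 1) := hq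
  -- Take `υ = 0` and `q` with Hessian `τ.cell`. Its degree allows it in the definition of `DD`, so
  -- the boundary terms cancel and only the cell term remains.
  have h := τ.tensForm_potential hR hT (PolyT_mono (by omega) hq')
    (CHess.submodule T.center (m + 1)).zero_mem
  rw [add_zero, map_zero, add_zero, τ.domainForm_DD hR hT hq', τ.boundaryTerm_edgePotential hq',
    sub_add_cancel, ← hcell] at h
  exact h

end

end LocalSigma

end PlatesComplex

namespace PlatesComplex

open MvPolynomial

namespace LocalSigma

variable {T : Element} {m : ℕ} (τ : LocalSigma (m + 2) T) {R : ℝ} {N : ℕ}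

/-! ### The norms in terms of the `L²` forms -/

theorem integral_sq_eq (E : MeshEdge) (f : Polynomial ℝ) :
    E.integral (fun s => f.eval s ^ 2) = intervalForm E.length f f := by
  simp only [sq]
  rfl

theorem compNormSq_eq (hT : T.IsShapeRegular R N) :
    τ.compNormSq = tensForm T.carrier hT.isBounded τ.cell τ.cell
      + tensForm T.carrier hT.isBounded τ.cellC τ.cellC
      + ∑ E : {E // E ∈ T.edges}, (T.diam * intervalForm E.1.length (τ.edge E) (τ.edge E)
        + T.diam ^ 3 * intervalForm E.1.length (τ.edgeD E) (τ.edgeD E))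
      + ∑ V : {V // V ∈ T.vertices}, T.diam ^ 2 * ddot (τ.vert V) (τ.vert V) := by
  simp only [compNormSq, integral_sq_eq, tensForm_eq_integral]
  rfl

/-- The normal-normal defect, as a polynomial in the arclength. -/
noncomputable def normalDefectPoly (E : {E // E ∈ T.edges}) : Polynomial ℝ :=
  E.1.trace (tcomp τ.potential E.1.normal E.1.normal) - τ.edgePotential E

/-- The shear defect, as a polynomial in the arclength. -/
noncomputable def shearDefectPoly (E : {E // E ∈ T.edges}) : Polynomial ℝ :=
  E.1.trace (dirDeriv E.1.tangent (tcomp τ.potential E.1.normal E.1.tangent)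
    + vdiv τ.potential ⬝ᵥ constVec E.1.normal) - τ.edgeD E

theorem prod_self_eq (hT : T.IsShapeRegular R N) :
    prod τ τ = tensForm T.carrier hT.isBounded τ.potential τ.potential
      + (∑ E : {E // E ∈ T.edges},
          T.diam * intervalForm E.1.length (τ.normalDefectPoly E) (τ.normalDefectPoly E)
        + ∑ E : {E // E ∈ T.edges},
          T.diam ^ 3 * intervalForm E.1.length (τ.shearDefectPoly E) (τ.shearDefectPoly E)
        + ∑ V : {V // V ∈ T.vertices}, T.diam ^ 2 * ddot (τ.vertexDefect V) (τ.vertexDefect V)) := by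
  simp only [prod, stab, tensForm_eq_integral, intervalForm_apply, normalDefectPoly,
    shearDefectPoly, Polynomial.eval_sub, MeshEdge.eval_trace]
  rfl

theorem edge_terms_nonneg (hT : T.IsShapeRegular R N) (f : {E // E ∈ T.edges} → Polynomial ℝ)
    (n : ℕ) (E : {E // E ∈ T.edges}) :
    0 ≤ T.diam ^ n * intervalForm E.1.length (f E) (f E) :=
  mul_nonneg (pow_nonneg hT.diam_pos.le n) (intervalForm_self_nonneg E.1.length_pos.le _)

theorem vertex_terms_nonneg (f : {V // V ∈ T.vertices} → Tens ℝ) (V : {V // V ∈ T.vertices}) :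
    0 ≤ T.diam ^ 2 * ddot (f V) (f V) := mul_nonneg (sq_nonneg _) (ddot_self_nonneg _)

/-- Each component is bounded by the component norm. -/
theorem components_le (hT : T.IsShapeRegular R N) :
    0 ≤ τ.compNormSq ∧
    tensForm T.carrier hT.isBounded τ.cell τ.cell ≤ τ.compNormSq ∧
    tensForm T.carrier hT.isBounded τ.cellC τ.cellC ≤ τ.compNormSq ∧
    (∀ E, T.diam * intervalForm E.1.length (τ.edge E) (τ.edge E) ≤ τ.compNormSq) ∧
    (∀ E, T.diam ^ 3 * intervalForm E.1.length (τ.edgeD E) (τ.edgeD E) ≤ τ.compNormSq) ∧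
    ∀ V, T.diam ^ 2 * ddot (τ.vert V) (τ.vert V) ≤ τ.compNormSq := by
  rw [τ.compNormSq_eq hT]
  have h1 := tensForm_self_nonneg hT.isBounded τ.cell
  have h2 := tensForm_self_nonneg hT.isBounded τ.cellC
  have h3 : ∀ E, 0 ≤ T.diam * intervalForm E.1.length (τ.edge E) (τ.edge E) := fun E => by
    simpa using edge_terms_nonneg hT τ.edge 1 E
  have h4 := edge_terms_nonneg hT τ.edgeD 3
  have h5 := vertex_terms_nonneg τ.vert
  have h6 := Finset.sum_nonneg fun E (_ : E ∈ Finset.univ) => add_nonneg (h3 E) (h4 E)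
  have h7 := Finset.sum_nonneg fun V (_ : V ∈ Finset.univ) => h5 V
  have h8 := fun E => Finset.single_le_sum (fun E _ => add_nonneg (h3 E) (h4 E))
    (Finset.mem_univ E)
  have h9 := fun V => Finset.single_le_sum (fun V _ => h5 V) (Finset.mem_univ V)
  refine ⟨by positivity, by linarith, by linarith, fun E => ?_, fun E => ?_, fun V => ?_⟩
  · linarith [h8 E, h4 E]
  · linarith [h8 E, h3 E]
  · linarith [h9 V]

/-- Each contribution is bounded by the operator norm. -/
theorem contributions_le (hT : T.IsShapeRegular R N) :
    0 ≤ prod τ τ ∧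
    tensForm T.carrier hT.isBounded τ.potential τ.potential ≤ prod τ τ ∧
    (∀ E, T.diam * intervalForm E.1.length (τ.normalDefectPoly E) (τ.normalDefectPoly E) ≤
      prod τ τ) ∧
    (∀ E, T.diam ^ 3 * intervalForm E.1.length (τ.shearDefectPoly E) (τ.shearDefectPoly E) ≤
      prod τ τ) ∧
    ∀ V, T.diam ^ 2 * ddot (τ.vertexDefect V) (τ.vertexDefect V) ≤ prod τ τ := by
  rw [τ.prod_self_eq hT]
  have h1 := tensForm_self_nonneg hT.isBounded τ.potential
  have h3 : ∀ E, 0 ≤ T.diam * intervalForm E.1.length (τ.normalDefectPoly E)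
    (τ.normalDefectPoly E) := fun E => by simpa using edge_terms_nonneg hT τ.normalDefectPoly 1 E
  have h4 := edge_terms_nonneg hT τ.shearDefectPoly 3
  have h5 := vertex_terms_nonneg τ.vertexDefect
  have h6 := Finset.sum_nonneg fun E (_ : E ∈ Finset.univ) => h3 E
  have h6' := Finset.sum_nonneg fun E (_ : E ∈ Finset.univ) => h4 E
  have h7 := Finset.sum_nonneg fun V (_ : V ∈ Finset.univ) => h5 V
  have h8 := fun E => Finset.single_le_sum (fun E _ => h3 E) (Finset.mem_univ E)
  have h8' := fun E => Finset.single_le_sum (fun E _ => h4 E) (Finset.mem_univ E)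
  have h9 := fun V => Finset.single_le_sum (fun V _ => h5 V) (Finset.mem_univ V)
  refine ⟨by positivity, by linarith, fun E => ?_, fun E => ?_, fun V => ?_⟩
  · linarith [h8 E]
  · linarith [h8' E]
  · linarith [h9 V]

theorem sum_edges_le (hT : T.IsShapeRegular R N) {f : {E // E ∈ T.edges} → ℝ} {c : ℝ}
    (hc : 0 ≤ c) (h : ∀ E, f E ≤ c) : ∑ E, f E ≤ N * c := by
  refine (Finset.sum_le_card_nsmul _ _ c fun E _ => h E).trans ?_
  rw [nsmul_eq_mul, Finset.card_univ, Fintype.card_coe]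
  have : (T.edges.card : ℝ) ≤ N := by exact_mod_cast hT.card_le
  gcongr

theorem sum_vertices_le (hT : T.IsShapeRegular R N) {f : {V // V ∈ T.vertices} → ℝ} {c : ℝ}
    (hc : 0 ≤ c) (h : ∀ V, f V ≤ c) : ∑ V, f V ≤ 2 * N * c := by
  classical
  refine (Finset.sum_le_card_nsmul _ _ c fun E _ => h E).trans ?_
  rw [nsmul_eq_mul, Finset.card_univ, Fintype.card_coe]
  have h1 : T.vertices.card ≤ 2 * N := by
    rw [Element.vertices]
    refine (Finset.card_union_le _ _).trans ?_
    have h2 := hT.card_le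
    have h3 := Finset.card_image_le (s := T.edges) (f := MeshEdge.a)
    have h4 := Finset.card_image_le (s := T.edges) (f := MeshEdge.b)
    convert (add_le_add (h3.trans h2) (h4.trans h2)).trans_eq (two_mul N).symm
  have : (T.vertices.card : ℝ) ≤ 2 * N := by exact_mod_cast h1
  gcongr

theorem vertex_mem_closedBall (hT : T.IsShapeRegular R N) (V : {V // V ∈ T.vertices}) :
    V.1 ∈ Metric.closedBall T.center T.diam := by
  classical
  obtain ⟨V, hV⟩ := V
  rw [Element.vertices, Finset.mem_union, Finset.mem_image, Finset.mem_image] at hV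
  rcases hV with ⟨E, hE, rfl⟩ | ⟨E, hE, rfl⟩
  · exact hT.a_mem E hE
  · exact hT.b_mem E hE

/-! ### Control of the operator norm -/

theorem abs_orient_le (T : Element) (E : MeshEdge) : |T.orient E| ≤ 1 := by
  rw [Element.orient]; split_ifs <;> simp

theorem abs_vertexSign_le (E : MeshEdge) (V : Plane) : |E.vertexSign V| ≤ 1 := by
  rw [MeshEdge.vertexSign]; split_ifs <;> simp

theorem abs_vcomp_le {A : Tens ℝ} {h k : ℝ} (hk : 0 ≤ k) (hA : h ^ 2 * ddot A A ≤ k ^ 2)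
    {u v : Plane} (hu : ∀ i, |u i| ≤ 1) (hv : ∀ i, |v i| ≤ 1) : |h * vcomp A u v| ≤ 2 * k := by
  refine abs_le_of_sq_le_sq ?_ (by positivity)
  have := mul_le_mul_of_nonneg_left (vcomp_sq_le A hu hv) (sq_nonneg h)
  nlinarith

/-- Per edge, multiplied by the diameter: two vertex values at `2 k` each and one shear moment at
`k` make the 5, and the normal derivative costs `2 d`. -/
theorem abs_boundaryTerm_le (hT : T.IsShapeRegular R N) {g : {E // E ∈ T.edges} → Polynomial ℝ}
    {k : ℝ} (hk : 0 ≤ k) (hv : ∀ V, T.diam ^ 2 * ddot (τ.vert V) (τ.vert V) ≤ k ^ 2)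
    (hg : ∀ E, T.diam * intervalForm E.1.length (g E) (g E) ≤ k ^ 2)
    (hD : ∀ E, T.diam ^ 3 * intervalForm E.1.length (τ.edgeD E) (τ.edgeD E) ≤ k ^ 2)
    {d : ℕ} {q : Poly2} (hq : q ∈ PolyT d) :
    T.diam * |τ.boundaryTerm g q| ≤ N * (5 + 2 * d) * (k * discNorm T.center T.diam q) := by
  have hh := hT.diam_pos
  set n := discNorm T.center T.diam q with hn
  have hn0 : 0 ≤ n := discNorm_nonneg q
  have hmul : ∀ {a b c : ℝ}, |a| ≤ 1 → |b| ≤ c → |a * b| ≤ c := fun {a b c} ha hb => by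
    rw [abs_mul]
    exact (mul_le_of_le_one_left (abs_nonneg b) ha).trans hb
  have hfour : ∀ a b c d : ℝ, |a + b + (c - d)| ≤ |a| + |b| + (|c| + |d|) := fun a b c d =>
    (abs_add_le _ _).trans (add_le_add (abs_add_le _ _) (abs_sub _ _))
  have hvert : ∀ (A : Tens ℝ) (E : MeshEdge) (V : Plane), T.diam ^ 2 * ddot A A ≤ k ^ 2 →
      V ∈ Metric.closedBall T.center T.diam →
      T.diam * |E.vertexSign V * (vcomp A E.normal E.tangent * pval q V)| ≤ 2 * k * n := by
    intro A E V hA hV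
    have h1 := abs_vcomp_le hk hA E.abs_normal_le E.abs_tangent_le
    have h2 := abs_pval_le_discNorm hh q hV
    have h3 := hmul (abs_vertexSign_le E V) (le_refl |vcomp A E.normal E.tangent * pval q V|)
    calc _ ≤ T.diam * |vcomp A E.normal E.tangent * pval q V| := by gcongr
      _ = |T.diam * vcomp A E.normal E.tangent| * |pval q V| := by
          rw [abs_mul, abs_mul, abs_of_pos hh, mul_assoc]
      _ ≤ _ := mul_le_mul h1 h2 (abs_nonneg _) (by positivity)
  have hnormal : ∀ E : {E // E ∈ T.edges}, T.diam * |intervalForm E.1.length (g E)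
      (E.1.trace (dirDeriv E.1.normal q))| ≤ 2 * d * (k * n) := by
    intro E
    have h1 := E.1.abs_intervalForm_trace_le hh (hT.a_mem _ E.2) (hT.b_mem _ E.2)
      (hT.length_le _ E.2) hk (hg E) (dirDeriv E.1.normal q)
    have h2 := discNorm_dirDeriv_le (x := T.center) hh E.1.abs_normal_le hq
    calc _ ≤ T.diam * (k * discNorm T.center T.diam (dirDeriv E.1.normal q)) := by gcongr
      _ = k * (T.diam * discNorm T.center T.diam (dirDeriv E.1.normal q)) := by ring
      _ ≤ k * (2 * d * n) := by gcongr
      _ = _ := by ring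
  have hshear : ∀ E : {E // E ∈ T.edges},
      T.diam * |intervalForm E.1.length (τ.edgeD E) (E.1.trace q)| ≤ k * n := by
    intro E
    -- `D_{τ,E}` is weighted by the cube of the diameter instead of its first power, hence the bound
    -- `k / T.diam`.
    have h1 := E.1.abs_intervalForm_trace_le hh (hT.a_mem _ E.2) (hT.b_mem _ E.2)
      (hT.length_le _ E.2) (f := τ.edgeD E) (k := k / T.diam) (by positivity) (by
        rw [div_pow, le_div_iff₀ (by positivity)]
        linarith [hD E]) q
    calc _ ≤ T.diam * (k / T.diam * n) := by gcongr
      _ = _ := by field_simp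
  have hbt : τ.boundaryTerm g q = ∑ E : {E // E ∈ T.edges}, T.orient E.1 *
      (E.1.vertexSign E.1.a * (vcomp (τ.vertA E) E.1.normal E.1.tangent * pval q E.1.a)
      + E.1.vertexSign E.1.b * (vcomp (τ.vertB E) E.1.normal E.1.tangent * pval q E.1.b)
      + (intervalForm E.1.length (g E) (E.1.trace (dirDeriv E.1.normal q))
      - intervalForm E.1.length (τ.edgeD E) (E.1.trace q))) := by
    simp only [mul_add (T.orient _), Finset.sum_add_distrib]
    simp only [boundaryTerm, vertexTerm, mul_add (T.orient _), Finset.sum_add_distrib]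
    rfl
  rw [hbt]
  calc _ ≤ T.diam * ∑ E : {E // E ∈ T.edges}, |T.orient E.1 *
      (E.1.vertexSign E.1.a * (vcomp (τ.vertA E) E.1.normal E.1.tangent * pval q E.1.a)
      + E.1.vertexSign E.1.b * (vcomp (τ.vertB E) E.1.normal E.1.tangent * pval q E.1.b)
      + (intervalForm E.1.length (g E) (E.1.trace (dirDeriv E.1.normal q))
      - intervalForm E.1.length (τ.edgeD E) (E.1.trace q)))| := by
        gcongr
        exact Finset.abs_sum_le_sum_abs _ _
    _ ≤ N * ((5 + 2 * d) * (k * n)) := by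
        rw [Finset.mul_sum]
        refine sum_edges_le hT (by positivity) fun E => ?_
        have h1 := hvert (τ.vertA E) E.1 E.1.a (hv _) (hT.a_mem _ E.2)
        have h2 := hvert (τ.vertB E) E.1 E.1.b (hv _) (hT.b_mem _ E.2)
        have h3 := hnormal E
        have h4 := hshear E
        refine (mul_le_mul_of_nonneg_left (hmul (abs_orient_le T E.1) (hfour _ _ _ _))
          hh.le).trans ?_
        linarith
    _ = _ := by ring

/-- By uniqueness the edge potential is the stable interpolant. The 9 is `1 + 4 + 4`, from the edge
component and the two endpoints; `1 ≤ K` later allows one bound `K * k` for all the boundary data.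
-/
theorem exists_edgePotential_le (m : ℕ) : ∃ K : ℝ, 1 ≤ K ∧ ∀ (T : Element) (R : ℝ) (N : ℕ),
    T.IsShapeRegular R N → ∀ (τ : LocalSigma (m + 2) T) (k : ℝ), 0 ≤ k →
    (∀ V, T.diam ^ 2 * ddot (τ.vert V) (τ.vert V) ≤ k ^ 2) →
    (∀ E, T.diam * intervalForm E.1.length (τ.edge E) (τ.edge E) ≤ k ^ 2) →
    ∀ E, T.diam * intervalForm E.1.length (τ.edgePotential E) (τ.edgePotential E) ≤
      (K * k) ^ 2 := by
  obtain ⟨K, hK, h⟩ := exists_edge_interpolant m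
  refine ⟨1 + 9 * K, by linarith, fun T R N hT τ k hk hv he E => ?_⟩
  have hh := hT.diam_pos
  set a := vcomp (τ.vertA E) E.1.normal E.1.normal with ha
  set b := vcomp (τ.vertB E) E.1.normal E.1.normal with hb
  obtain ⟨p, hp, h0, hL, horth, hbound⟩ := h E.1.length E.1.length_pos a b (τ.edge E) (τ.edge_mem E)
  have hpe : τ.edgePotential E = p := (τ.existsUnique_edgePotential E).unique
    (τ.edgePotential_spec E) ⟨hp, h0, hL, τ.edge_mem E, horth⟩
  have h1 : T.diam ^ 2 * a ^ 2 ≤ 4 * k ^ 2 := by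
    have := mul_le_mul_of_nonneg_left (vcomp_sq_le (τ.vertA E) E.1.abs_normal_le E.1.abs_normal_le)
      (sq_nonneg T.diam)
    have h2 : T.diam ^ 2 * ddot (τ.vertA E) (τ.vertA E) ≤ k ^ 2 := hv _
    linarith
  have h2 : T.diam ^ 2 * b ^ 2 ≤ 4 * k ^ 2 := by
    have := mul_le_mul_of_nonneg_left (vcomp_sq_le (τ.vertB E) E.1.abs_normal_le E.1.abs_normal_le)
      (sq_nonneg T.diam)
    have h2 : T.diam ^ 2 * ddot (τ.vertB E) (τ.vertB E) ≤ k ^ 2 := hv _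
    linarith
  have h3 := hT.length_le _ E.2
  rw [hpe]
  calc T.diam * intervalForm E.1.length p p
      ≤ T.diam * (K * (intervalForm E.1.length (τ.edge E) (τ.edge E)
        + E.1.length * (a ^ 2 + b ^ 2))) := by gcongr
    _ ≤ T.diam * (K * (intervalForm E.1.length (τ.edge E) (τ.edge E)
        + T.diam * (a ^ 2 + b ^ 2))) := by gcongr
    _ = K * (T.diam * intervalForm E.1.length (τ.edge E) (τ.edge E)
        + T.diam ^ 2 * a ^ 2 + T.diam ^ 2 * b ^ 2) := by ring
    _ ≤ K * (k ^ 2 + 4 * k ^ 2 + 4 * k ^ 2) := by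
        gcongr
        exact he E
    _ ≤ _ := by
        rw [mul_pow]
        nlinarith [sq_nonneg k, mul_nonneg (sq_nonneg K) (sq_nonneg k), mul_nonneg hK.le (sq_nonneg k)]

/-- Divides out the unknown after it has been tested with itself. -/
theorem le_of_sq_le_mul {x c : ℝ} (hc : 0 ≤ c) (h : x ^ 2 ≤ c * x) : x ≤ c := by
  rcases le_or_gt x 0 with hx | hx
  · exact hx.trans hc
  · rw [sq] at h; exact le_of_mul_le_mul_right h hx

/-- Test `DD` with itself: the right-hand side is at most `c * k * n / T.diam`, while the inverse
estimate bounds the left-hand side below by a multiple of `(T.diam * n) ^ 2`. Cancelling one `n`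
leaves the third power of the diameter: two for the Hessian, one for the L² scaling. -/
theorem exists_DD_le (m N : ℕ) {R : ℝ} (hR : 1 ≤ R) : ∃ K : ℝ, 0 < K ∧ ∀ (T : Element),
    T.IsShapeRegular R N → ∀ (τ : LocalSigma (m + 2) T) (k : ℝ), 0 ≤ k → τ.compNormSq ≤ k ^ 2 →
    T.diam ^ 3 * discNorm T.center T.diam τ.DD ≤ K * k := by
  obtain ⟨K₁, hK₁, h₁⟩ := Element.IsShapeRegular.exists_discNorm_le (m + 1) hR
  obtain ⟨K₂, hK₂, h₂⟩ := Element.IsShapeRegular.exists_tensNorm_le (m + 1) hR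
  set c : ℝ := 16 * K₂ * ((m + 1 : ℕ) : ℝ) ^ 2 + N * (5 + 2 * ((m + 1 : ℕ) : ℝ)) with hc
  have hc0 : 0 ≤ c := by positivity
  refine ⟨K₁ ^ 2 * c + 1, by positivity, fun T hT τ k hk hτ => ?_⟩
  have hh := hT.diam_pos
  obtain ⟨-, hcell, -, hedge, hedgeD, hvert⟩ := τ.components_le hT
  set n := discNorm T.center T.diam τ.DD with hn
  have hn0 : 0 ≤ n := discNorm_nonneg _
  have hDD := τ.DD_mem hR hT
  obtain ⟨q, hq, hqc⟩ := τ.cell_mem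
  have hcellm : ∀ i j, τ.cell i j ∈ PolyT (m + 1) := fun i j => by
    rw [hqc]
    exact PolyT_mono (by omega) (pderiv_mem_PolyT (pderiv_mem_PolyT hq j) i)
  have hcn := h₂ T N hT τ.cell hcellm k hk (hcell.trans hτ)
  have hhess := tensNorm_hess_le (x := T.center) hh hDD
  have hb := τ.abs_boundaryTerm_le hT hk (fun V => (hvert V).trans hτ)
    (fun E => (hedge E).trans hτ) (fun E => (hedgeD E).trans hτ) hDD
  set I := domainForm T.carrier hT.isBounded τ.DD τ.DD with hI
  have hI0 : 0 ≤ I := domainForm_self_nonneg _ _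
  have hIeq := τ.domainForm_DD hR hT hDD
  have hI1 : T.diam * I ≤ c * k * n := by
    have ht := hT.abs_tensForm_le τ.cell (hess τ.DD)
    have ht' : T.diam * |tensForm T.carrier hT.isBounded τ.cell (hess τ.DD)| ≤
        16 * K₂ * ((m + 1 : ℕ) : ℝ) ^ 2 * k * n := by
      calc _ ≤ T.diam * (4 * T.diam ^ 2 * (tensNorm T.center T.diam τ.cell *
            tensNorm T.center T.diam (hess τ.DD))) := by gcongr
        _ = 4 * ((T.diam * tensNorm T.center T.diam τ.cell) *
            (T.diam ^ 2 * tensNorm T.center T.diam (hess τ.DD))) := by ring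
        _ ≤ 4 * ((K₂ * k) * (4 * ((m + 1 : ℕ) : ℝ) ^ 2 * n)) := by
            gcongr
            exact mul_nonneg (sq_nonneg _) (tensNorm_nonneg _)
        _ = _ := by ring
    have h3 : I ≤ |tensForm T.carrier hT.isBounded τ.cell (hess τ.DD)| +
        |τ.boundaryTerm τ.edge τ.DD| := by
      rw [hI, hIeq]
      exact (le_abs_self _).trans (abs_sub _ _)
    have h4 := mul_le_mul_of_nonneg_left h3 hh.le
    have h5 : c * k * n = 16 * K₂ * ((m + 1 : ℕ) : ℝ) ^ 2 * k * n +
      N * (5 + 2 * ((m + 1 : ℕ) : ℝ)) * (k * n) := by rw [hc]; ring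
    linarith
  have h6 := h₁ T N hT τ.DD hDD (Real.sqrt I) (Real.sqrt_nonneg _) (by rw [Real.sq_sqrt hI0])
  have h7 : (T.diam * n) ^ 2 ≤ K₁ ^ 2 * I := by
    calc _ ≤ (K₁ * Real.sqrt I) ^ 2 := pow_le_pow_left₀ (by positivity) h6 2
      _ = _ := by rw [mul_pow, Real.sq_sqrt hI0]
  have h8 : (T.diam ^ 3 * n) ^ 2 ≤ (K₁ ^ 2 * c * k) * (T.diam ^ 3 * n) := by
    calc _ = T.diam ^ 4 * (T.diam * n) ^ 2 := by ring
      _ ≤ T.diam ^ 4 * (K₁ ^ 2 * I) := by gcongr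
      _ = T.diam ^ 3 * K₁ ^ 2 * (T.diam * I) := by ring
      _ ≤ T.diam ^ 3 * K₁ ^ 2 * (c * k * n) := by gcongr
      _ = _ := by ring
  have h9 := le_of_sq_le_mul (by positivity) h8
  nlinarith

-- Test the potential with itself, split as `hess q + υ` stably. The norm of `q` is at most `T.diam
-- ^ 2 * n`, which absorbs the powers of the diameter in the bounds of `DD` and of the boundary
-- terms; one factor `n` then cancels.
set_option maxHeartbeats 1000000 in
theorem exists_potential_le (m N : ℕ) {R : ℝ} (hR : 1 ≤ R) : ∃ K : ℝ, 0 < K ∧ ∀ (T : Element),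
    T.IsShapeRegular R N → ∀ (τ : LocalSigma (m + 2) T) (k : ℝ), 0 ≤ k → τ.compNormSq ≤ k ^ 2 →
    T.diam * tensNorm T.center T.diam τ.potential ≤ K * k := by
  obtain ⟨K₁, hK₁, h₁⟩ := Element.IsShapeRegular.exists_tensNorm_le (m + 2) hR
  obtain ⟨K₂, hK₂, h₂⟩ := exists_DD_le m N hR
  obtain ⟨K₃, hK₃, h₃⟩ := exists_edgePotential_le m
  set c₀ : ℝ := 1 + 4 * ((m + 1 : ℕ) + 3) ^ 2 with hc₀
  set c : ℝ := 4 * K₂ + N * (5 + 2 * ((m + 4 : ℕ) : ℝ)) * K₃ + 4 * K₁ * c₀ with hc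
  have hK₃0 : 0 ≤ K₃ := zero_le_one.trans hK₃
  have hc₀0 : 0 ≤ c₀ := by positivity
  have hc0 : 0 ≤ c := by positivity
  refine ⟨K₁ ^ 2 * c + 1, by positivity, fun T hT τ k hk hτ => ?_⟩
  have hh := hT.diam_pos
  obtain ⟨-, -, hcellC, hedge, hedgeD, hvert⟩ := τ.components_le hT
  have hP := τ.potential_mem hR hT
  set P := τ.potential with hPdef
  set n := tensNorm T.center T.diam P with hn
  have hn0 : 0 ≤ n := tensNorm_nonneg _
  obtain ⟨q, hq, υ, hυ, hPe, hqn, hυn⟩ :=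
    exists_stable_decomposition (x := T.center) hh (m := m + 1) hP
  have hDD := h₂ T hT τ k hk hτ
  have hkK : k ^ 2 ≤ (K₃ * k) ^ 2 := pow_le_pow_left₀ hk (le_mul_of_one_le_left hk hK₃) 2
  have hb := τ.abs_boundaryTerm_le hT (g := τ.edgePotential) (k := K₃ * k) (by positivity)
    (fun V => ((hvert V).trans hτ).trans hkK)
    (h₃ T R N hT τ k hk (fun V => (hvert V).trans hτ) (fun E => (hedge E).trans hτ))
    (fun E => ((hedgeD E).trans hτ).trans hkK) (d := m + 4) hq
  have hcn := h₁ T N hT τ.cellC (CHess_subset_SymPolyT _ _ τ.cellC_mem).2 k hk (hcellC.trans hτ)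
  set I := tensForm T.carrier hT.isBounded P P with hI
  have hI0 : 0 ≤ I := tensForm_self_nonneg _ _
  have hIeq : I = domainForm T.carrier hT.isBounded τ.DD q + τ.boundaryTerm τ.edgePotential q
      + tensForm T.carrier hT.isBounded τ.cellC υ := by
    rw [← τ.tensForm_potential hR hT hq hυ, ← hPe]
  have hI1 : T.diam * I ≤ c * k * (T.diam ^ 2 * n) := by
    have a1 : T.diam * |domainForm T.carrier hT.isBounded τ.DD q| ≤
        4 * K₂ * k * (T.diam ^ 2 * n) := by
      have := hT.abs_domainForm_le τ.DD q
      calc _ ≤ T.diam * (4 * T.diam ^ 2 * (discNorm T.center T.diam τ.DD *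
            discNorm T.center T.diam q)) := by gcongr
        _ = 4 * ((T.diam ^ 3 * discNorm T.center T.diam τ.DD) *
            discNorm T.center T.diam q) := by ring
        _ ≤ 4 * ((K₂ * k) * (T.diam ^ 2 * n)) := by
            gcongr
            exact discNorm_nonneg _
        _ = _ := by ring
    have a2 : T.diam * |τ.boundaryTerm τ.edgePotential q| ≤
        N * (5 + 2 * ((m + 4 : ℕ) : ℝ)) * K₃ * k * (T.diam ^ 2 * n) := by
      calc _ ≤ N * (5 + 2 * ((m + 4 : ℕ) : ℝ)) * (K₃ * k * discNorm T.center T.diam q) := hb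
        _ ≤ N * (5 + 2 * ((m + 4 : ℕ) : ℝ)) * (K₃ * k * (T.diam ^ 2 * n)) := by gcongr
        _ = _ := by ring
    have a3 : T.diam * |tensForm T.carrier hT.isBounded τ.cellC υ| ≤
        4 * K₁ * c₀ * k * (T.diam ^ 2 * n) := by
      have := hT.abs_tensForm_le τ.cellC υ
      calc _ ≤ T.diam * (4 * T.diam ^ 2 * (tensNorm T.center T.diam τ.cellC *
            tensNorm T.center T.diam υ)) := by gcongr
        _ = 4 * T.diam ^ 2 * ((T.diam * tensNorm T.center T.diam τ.cellC) *
            tensNorm T.center T.diam υ) := by ring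
        _ ≤ 4 * T.diam ^ 2 * ((K₁ * k) * (c₀ * n)) := by
            gcongr
            exact tensNorm_nonneg _
        _ = _ := by ring
    have a4 : I ≤ |domainForm T.carrier hT.isBounded τ.DD q| +
        |τ.boundaryTerm τ.edgePotential q| + |tensForm T.carrier hT.isBounded τ.cellC υ| := by
      rw [hIeq]
      exact (le_abs_self _).trans (abs_add_three _ _ _)
    have a5 := mul_le_mul_of_nonneg_left a4 hh.le
    have a6 : c * k * (T.diam ^ 2 * n) = 4 * K₂ * k * (T.diam ^ 2 * n) +
      N * (5 + 2 * ((m + 4 : ℕ) : ℝ)) * K₃ * k * (T.diam ^ 2 * n) +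
      4 * K₁ * c₀ * k * (T.diam ^ 2 * n) := by rw [hc]; ring
    linarith
  have h6 := h₁ T N hT P hP.2 (Real.sqrt I) (Real.sqrt_nonneg _) (by rw [Real.sq_sqrt hI0])
  have h7 : (T.diam * n) ^ 2 ≤ K₁ ^ 2 * I := by
    calc _ ≤ (K₁ * Real.sqrt I) ^ 2 := pow_le_pow_left₀ (by positivity) h6 2
      _ = _ := by rw [mul_pow, Real.sq_sqrt hI0]
  have h8 : T.diam * (T.diam * n) ^ 2 ≤ T.diam * ((K₁ ^ 2 * c * k) * (T.diam * n)) := by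
    calc _ ≤ T.diam * (K₁ ^ 2 * I) := by gcongr
      _ = K₁ ^ 2 * (T.diam * I) := by ring
      _ ≤ K₁ ^ 2 * (c * k * (T.diam ^ 2 * n)) := by gcongr
      _ = _ := by ring
  have h9 := le_of_sq_le_mul (by positivity) (le_of_mul_le_mul_left h8 hh)
  nlinarith

end LocalSigma

end PlatesComplex

namespace PlatesComplex

open MvPolynomial

namespace LocalSigma

/-! ### The equivalence of the local norms -/

/-- Both the weight and the length of the edge are at most the diameter, so the squared trace costs
`T.diam ^ 2`. -/
theorem trace_normal_le {T : Element} {R : ℝ} {N : ℕ} (hT : T.IsShapeRegular R N)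
    (A : Tens Poly2) {E : MeshEdge} (hE : E ∈ T.edges) :
    T.diam * intervalForm E.length (E.trace (tcomp A E.normal E.normal))
      (E.trace (tcomp A E.normal E.normal)) ≤ (T.diam * tensNorm T.center T.diam A) ^ 2 := by
  have hh := hT.diam_pos
  have h1 := E.intervalForm_trace_le hh (hT.a_mem _ hE) (hT.b_mem _ hE) (hT.length_le _ hE)
    (tcomp A E.normal E.normal)
  have h2 := discNorm_tcomp_le (x := T.center) (h := T.diam) A E.abs_normal_le E.abs_normal_le
  have h3 := discNorm_nonneg (x := T.center) (h := T.diam) (tcomp A E.normal E.normal)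
  calc _ ≤ T.diam * (T.diam * discNorm T.center T.diam (tcomp A E.normal E.normal) ^ 2) := by
        gcongr
    _ ≤ T.diam * (T.diam * tensNorm T.center T.diam A ^ 2) := by gcongr
    _ = _ := by ring

theorem trace_shear_le {T : Element} {R : ℝ} {N : ℕ} (hT : T.IsShapeRegular R N)
    {A : Tens Poly2} {m : ℕ} (hA : ∀ i j, A i j ∈ PolyT m) {E : MeshEdge} (hE : E ∈ T.edges) :
    T.diam ^ 3 * intervalForm E.length
      (E.trace (dirDeriv E.tangent (tcomp A E.normal E.tangent) + vdiv A ⬝ᵥ constVec E.normal))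
      (E.trace (dirDeriv E.tangent (tcomp A E.normal E.tangent) + vdiv A ⬝ᵥ constVec E.normal)) ≤
      (3 * m * (T.diam * tensNorm T.center T.diam A)) ^ 2 := by
  have hh := hT.diam_pos
  set p := dirDeriv E.tangent (tcomp A E.normal E.tangent) + vdiv A ⬝ᵥ constVec E.normal
  have h1 := E.intervalForm_trace_le hh (hT.a_mem _ hE) (hT.b_mem _ hE) (hT.length_le _ hE) p
  have h2 : T.diam * discNorm T.center T.diam p ≤ 3 * m * tensNorm T.center T.diam A :=
    discNorm_shear_le hh hA E.abs_tangent_le E.abs_normal_le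
  have h3 := discNorm_nonneg (x := T.center) (h := T.diam) p
  calc _ ≤ T.diam ^ 3 * (T.diam * discNorm T.center T.diam p ^ 2) := by gcongr
    _ = (T.diam * (T.diam * discNorm T.center T.diam p)) ^ 2 := by ring
    _ ≤ (T.diam * (3 * m * tensNorm T.center T.diam A)) ^ 2 := by gcongr
    _ = _ := by ring

/-- Each defect is a trace of the potential minus a component or the edge potential. Traces are
controlled through the bound on the potential, and the subtracted quantities through the component
norm. -/
theorem exists_prod_le (m N : ℕ) {R : ℝ} (hR : 1 ≤ R) : ∃ C : ℝ, 0 < C ∧ ∀ (T : Element),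
    T.IsShapeRegular R N → ∀ τ : LocalSigma (m + 2) T, prod τ τ ≤ C * τ.compNormSq := by
  obtain ⟨K₁, hK₁, h₁⟩ := exists_potential_le m N hR
  obtain ⟨K₂, hK₂, h₂⟩ := exists_edgePotential_le m
  have hK₂0 : 0 ≤ K₂ := zero_le_one.trans hK₂
  set d : ℝ := 3 * ((m + 2 : ℕ) : ℝ) with hd
  refine ⟨4 * K₁ ^ 2 + (N * (2 * K₁ ^ 2 + 2 * K₂ ^ 2) + N * (2 * d ^ 2 * K₁ ^ 2 + 2)
    + 2 * N * (8 * K₁ ^ 2 + 2)), by positivity, fun T hT τ => ?_⟩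
  have hh := hT.diam_pos
  obtain ⟨hS, -, -, hedge, hedgeD, hvert⟩ := τ.components_le hT
  set S := τ.compNormSq with hSdef
  have hSq : S = Real.sqrt S ^ 2 := (Real.sq_sqrt hS).symm
  have hP := h₁ T hT τ (Real.sqrt S) (Real.sqrt_nonneg _) hSq.le
  have hE := h₂ T R N hT τ (Real.sqrt S) (Real.sqrt_nonneg _) (fun V => (hvert V).trans hSq.le)
    (fun E => (hedge E).trans hSq.le)
  have hPm := τ.potential_mem hR hT
  have hn0 := tensNorm_nonneg (x := T.center) (h := T.diam) τ.potential
  set n := tensNorm T.center T.diam τ.potential with hn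
  have hP2 : (T.diam * n) ^ 2 ≤ K₁ ^ 2 * S := by
    calc _ ≤ (K₁ * Real.sqrt S) ^ 2 := pow_le_pow_left₀ (by positivity) hP 2
      _ = _ := by rw [mul_pow, Real.sq_sqrt hS]
  rw [τ.prod_self_eq hT]
  have a1 : tensForm T.carrier hT.isBounded τ.potential τ.potential ≤ 4 * K₁ ^ 2 * S := by
    have := (le_abs_self _).trans (hT.abs_tensForm_le τ.potential τ.potential)
    have h3 : 4 * T.diam ^ 2 * (n * n) = 4 * (T.diam * n) ^ 2 := by ring
    linarith
  have a2 := sum_edges_le hT (c := (2 * K₁ ^ 2 + 2 * K₂ ^ 2) * S) (by positivity)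
    (f := fun E => T.diam * intervalForm E.1.length (τ.normalDefectPoly E) (τ.normalDefectPoly E))
    fun E => by
      have b1 := mul_le_mul_of_nonneg_left (form_sub_self_le (intervalForm E.1.length)
        (intervalForm_self_nonneg E.1.length_pos.le)
        (E.1.trace (tcomp τ.potential E.1.normal E.1.normal)) (τ.edgePotential E)) hh.le
      have b2 := trace_normal_le hT τ.potential E.2
      have b3 := hE E
      rw [mul_pow, Real.sq_sqrt hS] at b3
      rw [normalDefectPoly]
      linarith
  have a3 := sum_edges_le hT (c := (2 * d ^ 2 * K₁ ^ 2 + 2) * S) (by positivity)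
    (f := fun E => T.diam ^ 3 *
      intervalForm E.1.length (τ.shearDefectPoly E) (τ.shearDefectPoly E))
    fun E => by
      have b1 := mul_le_mul_of_nonneg_left (form_sub_self_le (intervalForm E.1.length)
        (intervalForm_self_nonneg E.1.length_pos.le)
        (E.1.trace (dirDeriv E.1.tangent (tcomp τ.potential E.1.normal E.1.tangent)
          + vdiv τ.potential ⬝ᵥ constVec E.1.normal)) (τ.edgeD E)) (pow_nonneg hh.le 3)
      have b2 := trace_shear_le hT hPm.2 E.2
      have b3 := hedgeD E
      have b4 : (d * (T.diam * n)) ^ 2 ≤ d ^ 2 * (K₁ ^ 2 * S) := by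
        rw [mul_pow]
        exact mul_le_mul_of_nonneg_left hP2 (sq_nonneg d)
      rw [shearDefectPoly]
      linarith
  have a4 := sum_vertices_le hT (c := (8 * K₁ ^ 2 + 2) * S) (by positivity)
    (f := fun V => T.diam ^ 2 * ddot (τ.vertexDefect V) (τ.vertexDefect V))
    fun V => by
      have b1 := mul_le_mul_of_nonneg_left (ddot_sub_self_le (tval τ.potential V.1) (τ.vert V))
        (sq_nonneg T.diam)
      have b2 := mul_le_mul_of_nonneg_left (ddot_tval_le hh τ.potential
        (vertex_mem_closedBall hT V)) (sq_nonneg T.diam)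
      have b3 := hvert V
      have b4 : T.diam ^ 2 * (4 * n ^ 2) = 4 * (T.diam * n) ^ 2 := by ring
      rw [vertexDefect]
      linarith
  calc _ ≤ 4 * K₁ ^ 2 * S + (N * ((2 * K₁ ^ 2 + 2 * K₂ ^ 2) * S)
        + N * ((2 * d ^ 2 * K₁ ^ 2 + 2) * S) + 2 * N * ((8 * K₁ ^ 2 + 2) * S)) :=
        add_le_add a1 (add_le_add (add_le_add a2 a3) a4)
    _ = _ := by ring

/-- The edge component is the projection of the edge potential. -/
theorem intervalForm_edge_le {T : Element} {m : ℕ} (τ : LocalSigma (m + 2) T)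
    (E : {E // E ∈ T.edges}) :
    intervalForm E.1.length (τ.edge E) (τ.edge E) ≤
      intervalForm E.1.length (τ.edgePotential E) (τ.edgePotential E) := by
  have h := τ.intervalForm_edgePotential E (τ.edge_mem E)
  have h1 := intervalForm_sq_le E.1.length_pos.le (τ.edgePotential E) (τ.edge E)
  rw [h, sq] at h1
  rcases (intervalForm_self_nonneg E.1.length_pos.le (τ.edge E)).eq_or_lt with h2 | h2
  · rw [← h2]; exact intervalForm_self_nonneg E.1.length_pos.le _
  · exact le_of_mul_le_mul_right h1 h2

/-- Here the potential is bounded by hypothesis, through its L² norm. The cell components are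
projections of it, vertex values and `D_{τ,E}` are its traces minus defects, and `τ_E` is bounded
through the edge potential, again a trace minus a defect. -/
theorem exists_compNormSq_le (m N : ℕ) {R : ℝ} (hR : 1 ≤ R) : ∃ C : ℝ, 0 < C ∧ ∀ (T : Element),
    T.IsShapeRegular R N → ∀ τ : LocalSigma (m + 2) T, τ.compNormSq ≤ C * prod τ τ := by
  obtain ⟨K₁, hK₁, h₁⟩ := Element.IsShapeRegular.exists_tensNorm_le (m + 2) hR
  set d : ℝ := 3 * ((m + 2 : ℕ) : ℝ) with hd
  refine ⟨1 + 1 + N * ((2 * K₁ ^ 2 + 2) + (2 * d ^ 2 * K₁ ^ 2 + 2))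
    + 2 * N * (8 * K₁ ^ 2 + 2), by positivity, fun T hT τ => ?_⟩
  have hh := hT.diam_pos
  obtain ⟨hS, hpot, hnd, hsd, hvd⟩ := τ.contributions_le hT
  set S := prod τ τ with hSdef
  have hSq : S = Real.sqrt S ^ 2 := (Real.sq_sqrt hS).symm
  have hPm := τ.potential_mem hR hT
  have hP := h₁ T N hT τ.potential hPm.2 (Real.sqrt S) (Real.sqrt_nonneg _) (hpot.trans hSq.le)
  have hn0 := tensNorm_nonneg (x := T.center) (h := T.diam) τ.potential
  set n := tensNorm T.center T.diam τ.potential with hn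
  have hP2 : (T.diam * n) ^ 2 ≤ K₁ ^ 2 * S := by
    calc _ ≤ (K₁ * Real.sqrt S) ^ 2 := pow_le_pow_left₀ (by positivity) hP 2
      _ = _ := by rw [mul_pow, Real.sq_sqrt hS]
  rw [τ.compNormSq_eq hT]
  have a0 := (tensForm_self_le_of_eq hT.isBounded (τ.tensForm_potential_cell hR hT)).trans hpot
  have a1 := (tensForm_self_le_of_eq hT.isBounded (τ.tensForm_potential_cellC hR hT)).trans hpot
  have a2 := sum_edges_le hT (c := ((2 * K₁ ^ 2 + 2) + (2 * d ^ 2 * K₁ ^ 2 + 2)) * S)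
    (by positivity)
    (f := fun E => T.diam * intervalForm E.1.length (τ.edge E) (τ.edge E)
        + T.diam ^ 3 * intervalForm E.1.length (τ.edgeD E) (τ.edgeD E))
    fun E => by
      have b0 := mul_le_mul_of_nonneg_left (τ.intervalForm_edge_le E) hh.le
      have b1 := mul_le_mul_of_nonneg_left (form_sub_self_le (intervalForm E.1.length)
        (intervalForm_self_nonneg E.1.length_pos.le)
        (E.1.trace (tcomp τ.potential E.1.normal E.1.normal)) (τ.normalDefectPoly E)) hh.le
      have b2 := trace_normal_le hT τ.potential E.2
      have b3 := hnd E
      have c1 := mul_le_mul_of_nonneg_left (form_sub_self_le (intervalForm E.1.length)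
        (intervalForm_self_nonneg E.1.length_pos.le)
        (E.1.trace (dirDeriv E.1.tangent (tcomp τ.potential E.1.normal E.1.tangent)
          + vdiv τ.potential ⬝ᵥ constVec E.1.normal)) (τ.shearDefectPoly E)) (pow_nonneg hh.le 3)
      have c2 := trace_shear_le hT hPm.2 E.2
      have c3 := hsd E
      have c4 : (d * (T.diam * n)) ^ 2 ≤ d ^ 2 * (K₁ ^ 2 * S) := by
        rw [mul_pow]
        exact mul_le_mul_of_nonneg_left hP2 (sq_nonneg d)
      have e1 : E.1.trace (tcomp τ.potential E.1.normal E.1.normal) - τ.normalDefectPoly E =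
          τ.edgePotential E := by rw [normalDefectPoly, sub_sub_cancel]
      have e2 : E.1.trace (dirDeriv E.1.tangent (tcomp τ.potential E.1.normal E.1.tangent)
          + vdiv τ.potential ⬝ᵥ constVec E.1.normal) - τ.shearDefectPoly E = τ.edgeD E := by
        rw [shearDefectPoly, sub_sub_cancel]
      rw [e1] at b1
      rw [e2] at c1
      linarith
  have a4 := sum_vertices_le hT (c := (8 * K₁ ^ 2 + 2) * S) (by positivity)
    (f := fun V => T.diam ^ 2 * ddot (τ.vert V) (τ.vert V))
    fun V => by
      have b1 := mul_le_mul_of_nonneg_left (ddot_sub_self_le (tval τ.potential V.1)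
        (τ.vertexDefect V)) (sq_nonneg T.diam)
      have b2 := mul_le_mul_of_nonneg_left (ddot_tval_le hh τ.potential
        (vertex_mem_closedBall hT V)) (sq_nonneg T.diam)
      have b3 := hvd V
      have b4 : T.diam ^ 2 * (4 * n ^ 2) = 4 * (T.diam * n) ^ 2 := by ring
      rw [vertexDefect, sub_sub_cancel] at b1
      rw [vertexDefect] at b3
      linarith
  calc _ ≤ S + S + N * (((2 * K₁ ^ 2 + 2) + (2 * d ^ 2 * K₁ ^ 2 + 2)) * S)
        + 2 * N * ((8 * K₁ ^ 2 + 2) * S) := add_le_add (add_le_add (add_le_add a0 a1) a2) a4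
    _ = _ := by ring

/-- The uniform equivalence of the component and operator norms on shape-regular elements. -/
theorem exists_norm_equivalence (m N : ℕ) {R : ℝ} (hR : 1 ≤ R) : ∃ C : ℝ, 0 < C ∧
    ∀ (T : Element), T.IsShapeRegular R N → ∀ τ : LocalSigma (m + 2) T,
      0 ≤ τ.compNormSq ∧ 0 ≤ prod τ τ ∧
      τ.compNormSq ≤ C ^ 2 * prod τ τ ∧ prod τ τ ≤ C ^ 2 * τ.compNormSq := by
  obtain ⟨C₁, hC₁, h₁⟩ := exists_prod_le m N hR
  obtain ⟨C₂, hC₂, h₂⟩ := exists_compNormSq_le m N hR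
  -- The square of this constant dominates both `C₁` and `C₂`.
  refine ⟨1 + C₁ + C₂, by positivity, fun T hT τ => ?_⟩
  have hS := (τ.components_le hT).1
  have hP := (τ.contributions_le hT).1
  refine ⟨hS, hP, (h₂ T hT τ).trans ?_, (h₁ T hT τ).trans ?_⟩
  · exact mul_le_mul_of_nonneg_right (by nlinarith) hP
  · exact mul_le_mul_of_nonneg_right (by nlinarith) hS

end LocalSigma

end PlatesComplex

namespace PlatesComplex

open MeasureTheory

/-! ### Triangles of a simplicial complex in the plane -/

section triangles

variable {t : Finset Plane}

/-- The vertices of a nondegenerate triangle as an affine basis of the plane. -/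
noncomputable def triangleBasis (hi : AffineIndependent ℝ ((↑) : t → Plane)) (hc : t.card = 3) :
    AffineBasis t ℝ Plane where
  toFun := (↑)
  ind' := hi
  tot' := by
    rw [hi.affineSpan_eq_top_iff_card_eq_finrank_add_one, Fintype.card_coe, hc,
      finrank_euclideanSpace_fin]

theorem range_triangleBasis (hi : AffineIndependent ℝ ((↑) : t → Plane)) (hc : t.card = 3) :
    Set.range (triangleBasis hi hc) = (t : Set Plane) := Subtype.range_coe

theorem mem_interior_triangle (hi : AffineIndependent ℝ ((↑) : t → Plane)) (hc : t.card = 3)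
    {x : Plane} : x ∈ interior (convexHull ℝ (t : Set Plane)) ↔
      ∀ i, 0 < (triangleBasis hi hc).coord i x := by
  rw [← range_triangleBasis hi hc, AffineBasis.interior_convexHull]
  rfl

theorem coord_nonneg_of_mem_triangle (hi : AffineIndependent ℝ ((↑) : t → Plane))
    (hc : t.card = 3) {x : Plane} (hx : x ∈ convexHull ℝ (t : Set Plane)) (i : t) :
    0 ≤ (triangleBasis hi hc).coord i x := by
  rw [← range_triangleBasis hi hc, AffineBasis.convexHull_eq_nonneg_coord] at hx
  exact hx i

/-- A boundary point of a triangle which is not a vertex lies on an open side. -/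
theorem exists_mem_openSegment_of_mem_triangle (hi : AffineIndependent ℝ ((↑) : t → Plane))
    (hc : t.card = 3) {x : Plane} (hx : x ∈ convexHull ℝ (t : Set Plane))
    (hint : x ∉ interior (convexHull ℝ (t : Set Plane))) (hvert : x ∉ t) :
    ∃ y ∈ t, ∃ z ∈ t, y ≠ z ∧ x ∈ openSegment ℝ y z := by
  classical
  set b := triangleBasis hi hc with hb
  rw [mem_interior_triangle hi hc] at hint
  push Not at hint
  -- One barycentric coordinate vanishes at a non-interior point; neither of the other two does,
  -- since otherwise the point would be a vertex.
  obtain ⟨i, hi0⟩ := hint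
  have hi1 : b.coord i x = 0 := le_antisymm hi0 (coord_nonneg_of_mem_triangle hi hc hx i)
  have hcard : (Finset.univ.erase i).card = 2 := by
    rw [Finset.card_erase_of_mem (Finset.mem_univ _), Finset.card_univ, Fintype.card_coe, hc]
  obtain ⟨y, z, hyz, hyzeq⟩ := Finset.card_eq_two.1 hcard
  have hsum := b.sum_coord_apply_eq_one x
  have hcomb := b.linear_combination_coord_eq_self x
  rw [← Finset.add_sum_erase _ _ (Finset.mem_univ i), hyzeq, Finset.sum_pair hyz, hi1, zero_add]
    at hsum
  rw [← Finset.add_sum_erase _ _ (Finset.mem_univ i), hyzeq, Finset.sum_pair hyz, hi1, zero_smul,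
    zero_add] at hcomb
  change b.coord y x • (y : Plane) + b.coord z x • (z : Plane) = x at hcomb
  have hy0 := coord_nonneg_of_mem_triangle hi hc hx y
  have hz0 := coord_nonneg_of_mem_triangle hi hc hx z
  refine ⟨y, y.2, z, z.2, fun h => hyz (Subtype.ext h), b.coord y x, b.coord z x,
    hy0.lt_of_ne fun h => hvert ?_, hz0.lt_of_ne fun h => hvert ?_, hsum, hcomb⟩
  · rw [← hb] at h
    rw [← h, zero_add] at hsum
    rw [← h, hsum, zero_smul, one_smul, zero_add] at hcomb
    rw [← hcomb]; exact z.2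
  · rw [← hb] at h
    rw [← h, add_zero] at hsum
    rw [← h, hsum, zero_smul, one_smul, add_zero] at hcomb
    rw [← hcomb]; exact y.2

/-- A common point lies in the hull of the common vertices. Some vertex of `s` is not in `t`: its
barycentric coordinate vanishes on that hull but is positive inside `s`. -/
theorem disjoint_interior_triangles {K : Geometry.SimplicialComplex ℝ Plane} {s t : Finset Plane}
    (hs : s ∈ K.faces) (ht : t ∈ K.faces) (hsc : s.card = 3) (htc : t.card = 3) (hst : s ≠ t) :
    Disjoint (interior (convexHull ℝ (s : Set Plane))) (interior (convexHull ℝ (t : Set Plane))) := by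
  rw [Set.disjoint_left]
  intro x hxs hxt
  have h1 : ¬ s ⊆ t := fun h => hst (Finset.eq_of_subset_of_card_le h (by rw [hsc, htc]))
  obtain ⟨i, his, hit⟩ := Finset.not_subset.1 h1
  set b := triangleBasis (K.indep hs) hsc
  have h2 := K.inter_subset_convexHull hs ht ⟨interior_subset hxs, interior_subset hxt⟩
  have h3 : convexHull ℝ (s ∩ t : Set Plane) ⊆ b.coord ⟨i, his⟩ ⁻¹' {0} := by
    refine convexHull_min (fun y hy => ?_) ((convex_singleton 0).affine_preimage _)
    refine b.coord_apply_ne (i := ⟨i, his⟩) (j := ⟨y, hy.1⟩) fun h => hit ?_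
    have hiy : i = y := congrArg Subtype.val h
    exact hiy ▸ hy.2
  exact ((mem_interior_triangle (K.indep hs) hsc).1 hxs ⟨i, his⟩).ne' (h3 h2)

theorem diam_triangle_pos (hc : t.card = 3) :
    0 < Metric.diam (convexHull ℝ (t : Set Plane)) := by
  obtain ⟨y, hy, z, hz, hyz⟩ := Finset.one_lt_card.1 (by omega : 1 < t.card)
  have hb : Bornology.IsBounded (convexHull ℝ (t : Set Plane)) :=
    isBounded_convexHull.2 t.finite_toSet.isBounded
  exact (dist_pos.2 hyz).trans_le (Metric.dist_le_diam_of_mem hb (subset_convexHull ℝ _ hy)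
    (subset_convexHull ℝ _ hz))

theorem exists_closedBall_subset_of_lt_inradius {S : Set Plane} {a : ℝ} (h : a < inradius S) :
    ∃ r, a < r ∧ ∃ c, Metric.closedBall c r ⊆ S := by
  have hne : {r : ℝ | ∃ c, Metric.closedBall c r ⊆ S}.Nonempty := by
    -- A closed ball of negative radius is empty, so the set of admissible radii is never empty.
    refine ⟨-1, 0, ?_⟩
    rw [Metric.closedBall_eq_empty.2 (by norm_num)]
    exact Set.empty_subset _
  obtain ⟨r, hr, har⟩ := exists_lt_of_lt_csSup hne h
  exact ⟨r, har, hr⟩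

end triangles

/-! ### Elements of regular meshes are shape-regular -/

namespace PolygonalMesh

variable {Ω : Set Plane} {M : PolygonalMesh Ω} {K : Geometry.SimplicialComplex ℝ Plane}

open Classical in
/-- The triangles of the submesh contained in `T`. -/
noncomputable def trianglesIn (hK : M.IsMatchingSubmesh K) (T : Set Plane) :
    Finset (Finset Plane) :=
  hK.finite.toFinset.filter fun t =>
    t.card = 3 ∧ interior (convexHull ℝ (t : Set Plane)) ⊆ T

theorem mem_trianglesIn {hK : M.IsMatchingSubmesh K} {T : Set Plane} {t : Finset Plane} :
    t ∈ trianglesIn hK T ↔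
      t ∈ K.faces ∧ t.card = 3 ∧ interior (convexHull ℝ (t : Set Plane)) ⊆ T := by
  classical
  rw [trianglesIn, Finset.mem_filter, Set.Finite.mem_toFinset]

/-- A triangle through a point of `T` has interior points nearby, hence in the open set `T`; as its
interior lies in one element and elements are disjoint, this element is `T`. The finite union of
triangles is closed, which gives the closure. -/
theorem mem_triangles_of_mem (hK : M.IsMatchingSubmesh K) {T : Set Plane} (hT : T ∈ M.elems)
    {x : Plane} (hx : x ∈ closure T) :
    ∃ t ∈ trianglesIn hK T, x ∈ convexHull ℝ (t : Set Plane) := by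
  have hsub : T ⊆ ⋃ t ∈ trianglesIn hK T, convexHull ℝ (t : Set Plane) := by
    intro x hx
    have h1 : x ∈ K.space := by
      rw [hK.space_eq, M.closure_eq]
      exact Set.mem_biUnion hT (subset_closure hx)
    obtain ⟨s, hs, hxs⟩ := Geometry.SimplicialComplex.mem_space_iff.1 h1
    obtain ⟨t, ht, htc, hst⟩ := hK.pure s hs
    have hxt : x ∈ convexHull ℝ (t : Set Plane) :=
      convexHull_mono (Finset.coe_subset.2 hst) hxs
    obtain ⟨T', hT', htT'⟩ := hK.triangle_sub t ht htc
    refine Set.mem_biUnion (mem_trianglesIn.2 ⟨ht, htc, ?_⟩) hxt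
    have hne : (interior (convexHull ℝ (t : Set Plane))).Nonempty := by
      rw [interior_convexHull_nonempty_iff_affineSpan_eq_top,
        ← range_triangleBasis (K.indep ht) htc]
      exact (triangleBasis (K.indep ht) htc).tot
    have hcl : x ∈ closure (interior (convexHull ℝ (t : Set Plane))) := by
      rw [(convex_convexHull ℝ _).closure_interior_eq_closure_of_nonempty_interior hne]
      exact subset_closure hxt
    obtain ⟨y, hyT, hyt⟩ := mem_closure_iff.1 hcl T (M.elem_polygonal T hT).1 hx
    have : T = T' := by
      by_contra h
      exact Set.disjoint_left.1 (M.elem_disjoint T hT T' hT' h) hyT (htT' hyt)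
    rwa [this]
  have hcl : IsClosed (⋃ t ∈ trianglesIn hK T, convexHull ℝ (t : Set Plane)) :=
    isClosed_biUnion_finset fun t _ => (t.finite_toSet.isCompact_convexHull (𝕜 := ℝ)).isClosed
  have := closure_minimal hsub hcl hx
  simpa using this

/-- Every edge of an element contains an open side of one of the triangles in the element. -/
theorem exists_side_subset (hK : M.IsMatchingSubmesh K) {T : Set Plane} (hT : T ∈ M.elems)
    {E : MeshEdge} (hE : E ∈ M.edges) (hET : E.carrier ⊆ frontier T) :
    ∃ t ∈ trianglesIn hK T, ∃ y ∈ t, ∃ z ∈ t, y ≠ z ∧ openSegment ℝ y z ⊆ E.carrier := by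
  classical
  have hinf : E.carrier.Infinite := by
    rw [MeshEdge.carrier, openSegment_eq_image_lineMap]
    exact (Set.Ioo_infinite zero_lt_one).image (AffineMap.lineMap_injective ℝ E.ne).injOn
  -- A point of the edge away from all triangle vertices. Being on the boundary of `T`, it is not
  -- interior to its triangle, so it lies on an open side.
  obtain ⟨x, hxE, hxv⟩ := hinf.exists_notMem_finset ((trianglesIn hK T).biUnion id)
  have hxT := hET hxE
  obtain ⟨t, ht, hxt⟩ := mem_triangles_of_mem hK hT (frontier_subset_closure hxT)
  obtain ⟨htK, htc, htT⟩ := mem_trianglesIn.1 ht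
  have hxint : x ∉ interior (convexHull ℝ (t : Set Plane)) := fun h => by
    rw [(M.elem_polygonal T hT).1.frontier_eq] at hxT
    exact hxT.2 (htT h)
  obtain ⟨y, hy, z, hz, hyz, hx⟩ := exists_mem_openSegment_of_mem_triangle (K.indep htK) htc hxt
    hxint fun h => hxv (Finset.mem_biUnion.2 ⟨t, ht, h⟩)
  refine ⟨t, ht, y, hy, z, hz, hyz, ?_⟩
  -- The side meets the edge at `x`, so the matching property leaves only inclusion.
  refine (hK.side_sub y z hyz ⟨{y, z}, K.down_closed htK ?_ ?_, by simp⟩ E hE).resolve_left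
    fun h => Set.disjoint_left.1 h hx hxE
  · intro p hp
    rw [Finset.mem_insert, Finset.mem_singleton] at hp
    rcases hp with rfl | rfl <;> assumption
  · exact Finset.insert_nonempty _ _

-- Each edge selects an ordered pair of vertices of a triangle whose open side it contains. Disjoint
-- edges cannot select the same pair, and a triangle has `3 * 3` pairs.
open Classical in
theorem card_edges_le (hK : M.IsMatchingSubmesh K) {T : Set Plane} (hT : T ∈ M.elems) :
    (M.edges.filter fun E => E.carrier ⊆ frontier T).card ≤ 9 * (trianglesIn hK T).card := by
  have h : ∀ E : MeshEdge, ∃ p : Plane × Plane, E ∈ M.edges.filter (fun E => E.carrier ⊆ frontier T) →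
      p ∈ (trianglesIn hK T).biUnion (fun t => t ×ˢ t) ∧ p.1 ≠ p.2 ∧
        openSegment ℝ p.1 p.2 ⊆ E.carrier := by
    intro E
    by_cases hE : E ∈ M.edges.filter (fun E => E.carrier ⊆ frontier T)
    · obtain ⟨hE1, hE2⟩ := Finset.mem_filter.1 hE
      obtain ⟨t, ht, y, hy, z, hz, hyz, hs⟩ := exists_side_subset hK hT hE1 hE2
      exact ⟨(y, z), fun _ => ⟨Finset.mem_biUnion.2 ⟨t, ht, Finset.mk_mem_product hy hz⟩, hyz, hs⟩⟩
    · exact ⟨0, fun h => absurd h hE⟩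
  choose f hf using h
  have hinj : Set.InjOn f (M.edges.filter fun E => E.carrier ⊆ frontier T) := by
    intro E hE E' hE' hEE'
    have h1 := hf E hE
    have h2 := hf E' hE'
    rw [← hEE'] at h2
    by_contra hne
    have hmid : midpoint ℝ (f E).1 (f E).2 ∈ openSegment ℝ (f E).1 (f E).2 :=
      midpoint_mem_openSegment _ _
    exact Set.disjoint_left.1 (M.edge_disjoint E (Finset.mem_filter.1 hE).1 E'
      (Finset.mem_filter.1 hE').1 hne) (h1.2.2 hmid) (h2.2.2 hmid)
  refine (Finset.card_le_card_of_injOn f (fun E hE => (hf E hE).1) hinj).trans ?_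
  refine (Finset.card_biUnion_le).trans ?_
  refine (Finset.sum_le_card_nsmul _ _ 9 fun t ht => ?_).trans_eq (by rw [smul_eq_mul, mul_comm])
  rw [Finset.card_product, (mem_trianglesIn.1 ht).2.1]

/-- The number of disjoint triangles containing discs of a given radius is bounded. -/
theorem card_trianglesIn_mul_le (hK : M.IsMatchingSubmesh K) {T : Set Plane} {x : Plane} {h r : ℝ}
    (hh : 0 ≤ h) (hr : 0 ≤ r) (hTh : T ⊆ Metric.closedBall x h)
    (hball : ∀ t ∈ trianglesIn hK T, ∃ c,
      Metric.ball c r ⊆ interior (convexHull ℝ (t : Set Plane))) :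
    (trianglesIn hK T).card * r ^ 2 ≤ h ^ 2 := by
  have h1 : volume (⋃ t ∈ trianglesIn hK T, interior (convexHull ℝ (t : Set Plane))) =
      ∑ t ∈ trianglesIn hK T, volume (interior (convexHull ℝ (t : Set Plane))) := by
    refine measure_biUnion_finset (fun s hs t ht hst => ?_) fun t _ => isOpen_interior.measurableSet
    obtain ⟨hs1, hs2, -⟩ := mem_trianglesIn.1 hs
    obtain ⟨ht1, ht2, -⟩ := mem_trianglesIn.1 ht
    exact disjoint_interior_triangles hs1 ht1 hs2 ht2 hst
  have h2 : (⋃ t ∈ trianglesIn hK T, interior (convexHull ℝ (t : Set Plane))) ⊆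
      Metric.closedBall x h :=
    Set.iUnion₂_subset fun t ht => (mem_trianglesIn.1 ht).2.2.trans hTh
  -- Comparison of areas: disjoint discs of radius `r` inside a disc of radius `h`.
  have h3 : (trianglesIn hK T).card • (ENNReal.ofReal r ^ 2 * ENNReal.ofReal Real.pi) ≤
      ENNReal.ofReal h ^ 2 * ENNReal.ofReal Real.pi := by
    rw [← EuclideanSpace.volume_closedBall_fin_two x h]
    refine le_trans ?_ (measure_mono h2)
    rw [h1]
    refine Finset.card_nsmul_le_sum _ _ _ fun t ht => ?_
    obtain ⟨c, hc⟩ := hball t ht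
    rw [← EuclideanSpace.volume_ball_fin_two c r]
    exact measure_mono hc
  have h4 := ENNReal.toReal_mono (by finiteness) h3
  rw [nsmul_eq_mul, ENNReal.toReal_mul, ENNReal.toReal_mul, ENNReal.toReal_mul,
    ENNReal.toReal_pow, ENNReal.toReal_pow, ENNReal.toReal_ofReal hh, ENNReal.toReal_ofReal hr,
    ENNReal.toReal_ofReal Real.pi_pos.le, ENNReal.toReal_natCast, ← mul_assoc] at h4
  exact le_of_mul_le_mul_right h4 Real.pi_pos

theorem diam_pos {T : Set Plane} (hT : IsPolygonalDomain T) : 0 < Metric.diam T := by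
  obtain ⟨hopen, hconn, hbdd, -, -⟩ := hT
  obtain ⟨x, hx⟩ := hconn.nonempty
  obtain ⟨ε, hε, hball⟩ := Metric.isOpen_iff.1 hopen x hx
  have hv : ‖EuclideanSpace.single (0 : Fin 2) (ε / 2)‖ = ε / 2 := by
    rw [PiLp.norm_single, Real.norm_of_nonneg (by positivity)]
  have hd : dist (x + EuclideanSpace.single 0 (ε / 2)) x = ε / 2 := by
    rw [dist_eq_norm, add_sub_cancel_left, hv]
  have hy : x + EuclideanSpace.single 0 (ε / 2) ∈ T := hball (by
    rw [Metric.mem_ball, hd]; linarith)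
  have := Metric.dist_le_diam_of_mem hbdd hy hx
  rw [hd] at this
  linarith

/-- The inradius of a triangle is at least `ρ h_t ≥ ρ² h_T`, which leaves room for a disc of radius
`ρ² h_T / 2`. Its centre is within `h_T` of `x_T`, and `2 h_T` is `4 / ρ²` times this radius. By
areas there are at most `4 / ρ⁴` triangles, hence at most `36 / ρ⁴` edges. -/
theorem isShapeRegular_element {ρ : ℝ} (hρ : 0 < ρ) (hM : M.IsRegular ρ)
    (x : {T // T ∈ M.elems} → Plane) (hx : ∀ T, x T ∈ T.1) (T : {T // T ∈ M.elems}) :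
    (M.element x T).IsShapeRegular (4 / ρ ^ 2) ⌈36 / ρ ^ 4⌉₊ := by
  classical
  obtain ⟨K, hK, hin, hdiam⟩ := hM
  obtain ⟨T, hT⟩ := T
  have hpoly := M.elem_polygonal T hT
  have hbdd : Bornology.IsBounded T := hpoly.2.2.1
  have hh : 0 < Metric.diam T := diam_pos hpoly
  have hxT : x ⟨T, hT⟩ ∈ T := hx ⟨T, hT⟩
  set h := Metric.diam T with hdef
  set x₀ := x ⟨T, hT⟩ with hx₀
  have hsub : T ⊆ Metric.closedBall x₀ h := fun y hy => Metric.dist_le_diam_of_mem hbdd hy hxT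
  have hcl : closure T ⊆ Metric.closedBall x₀ h := closure_minimal hsub Metric.isClosed_closedBall
  have hseg : ∀ E ∈ (M.element x ⟨T, hT⟩).edges, segment ℝ E.a E.b ⊆ closure T := fun E hE => by
    rw [← closure_openSegment]
    exact closure_minimal ((Finset.mem_filter.1 hE).2.trans frontier_subset_closure) isClosed_closure
  have hball : ∀ t ∈ trianglesIn hK T, ∃ c,
      Metric.ball c (ρ ^ 2 * h / 2) ⊆ interior (convexHull ℝ (t : Set Plane)) := by
    intro t ht
    obtain ⟨ht1, ht2, ht3⟩ := mem_trianglesIn.1 ht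
    have hd := diam_triangle_pos ht2
    have h1 := hin t ht1 ht2
    have h2 := hdiam T hT t ht1 ht2 ht3
    -- The inradius is a supremum that need not be attained, so half of the lower bound is used to
    -- have a strict inequality.
    obtain ⟨r, hr, c, hc⟩ := exists_closedBall_subset_of_lt_inradius
      (a := ρ * Metric.diam (convexHull ℝ (t : Set Plane)) / 2)
      (lt_of_lt_of_le (by have := mul_pos hρ hd; linarith) h1)
    have h3 : ρ ^ 2 * h / 2 ≤ r := by
      have := mul_le_mul_of_nonneg_left h2 hρ.le
      nlinarith
    exact ⟨c, interior_maximal ((Metric.ball_subset_ball h3).trans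
      (Metric.ball_subset_closedBall.trans hc)) Metric.isOpen_ball⟩
  refine ⟨hh, hsub, ?_, fun E hE => hcl (hseg E hE (left_mem_segment ℝ _ _)),
    fun E hE => hcl (hseg E hE (right_mem_segment ℝ _ _)), fun E hE => ?_, ?_⟩
  · obtain ⟨t, ht, -⟩ := mem_triangles_of_mem hK hT (subset_closure hxT)
    obtain ⟨c, hc⟩ := hball t ht
    have hcT := hc.trans (mem_trianglesIn.1 ht).2.2
    refine ⟨c, ρ ^ 2 * h / 2, by positivity, ?_, hcT⟩
    have h1 : dist x₀ c ≤ h :=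
      Metric.dist_le_diam_of_mem hbdd hxT (hcT (Metric.mem_ball_self (by positivity)))
    have h2 : 4 / ρ ^ 2 * (ρ ^ 2 * h / 2) = 2 * h := by field_simp; ring
    rw [h2]
    change dist x₀ c + h ≤ 2 * h
    linarith
  · change dist E.a E.b ≤ h
    rw [hdef, ← Metric.diam_closure]
    exact Metric.dist_le_diam_of_mem hbdd.closure (hseg E hE (left_mem_segment ℝ _ _))
      (hseg E hE (right_mem_segment ℝ _ _))
  · have h1 := card_trianglesIn_mul_le hK hh.le (by positivity) hsub hball
    have h2 : ((trianglesIn hK T).card : ℝ) ≤ 4 / ρ ^ 4 := by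
      rw [le_div_iff₀ (by positivity)]
      have h3 : ((trianglesIn hK T).card * ρ ^ 4) * h ^ 2 ≤ 4 * h ^ 2 := by nlinarith
      exact le_of_mul_le_mul_right h3 (by positivity)
    have h4 : (M.element x ⟨T, hT⟩).edges.card ≤ 9 * (trianglesIn hK T).card := by
      convert card_edges_le hK hT
      rfl
    have h5 : ((9 * (trianglesIn hK T).card : ℕ) : ℝ) ≤ 36 / ρ ^ 4 := by
      push_cast
      calc (9 : ℝ) * (trianglesIn hK T).card ≤ 9 * (4 / ρ ^ 4) := by gcongr
        _ = _ := by ring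
    exact h4.trans (Nat.cast_le.1 (h5.trans (Nat.le_ceil _)))

end PolygonalMesh

end PlatesComplex

/-! ### Square roots, summation over the elements, and the theorem. -/

namespace PlatesComplex

theorem LocalSigma.compNorm_le_opNorm {ℓ : ℕ} {T : Element} {τ : LocalSigma ℓ T} {C : ℝ}
    (hC : 0 ≤ C) (h : τ.compNormSq ≤ C ^ 2 * prod τ τ) : τ.compNorm ≤ C * τ.opNorm := by
  rw [compNorm, opNorm, ← Real.sqrt_sq hC, ← Real.sqrt_mul (sq_nonneg _)]
  exact Real.sqrt_le_sqrt h

theorem LocalSigma.opNorm_le_compNorm {ℓ : ℕ} {T : Element} {τ : LocalSigma ℓ T} {C : ℝ}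
    (hC : 0 ≤ C) (h : prod τ τ ≤ C ^ 2 * τ.compNormSq) : τ.opNorm ≤ C * τ.compNorm := by
  rw [compNorm, opNorm, ← Real.sqrt_sq hC, ← Real.sqrt_mul (sq_nonneg _)]
  exact Real.sqrt_le_sqrt h

namespace GlobalSigma

variable {ℓ : ℕ} {Ω : Set Plane} {M : PolygonalMesh Ω} {x : {T // T ∈ M.elems} → Plane}

theorem compNorm_le_opNorm {τ : GlobalSigma ℓ M x} {C : ℝ} (hC : 0 ≤ C)
    (h0 : ∀ T, 0 ≤ (τ.restrict T).compNormSq)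
    (h : ∀ T, (τ.restrict T).compNormSq ≤
      C ^ 2 * LocalSigma.prod (τ.restrict T) (τ.restrict T)) :
    τ.compNorm ≤ C * τ.opNorm := by
  rw [compNorm, opNorm, ← Real.sqrt_sq hC, ← Real.sqrt_mul (sq_nonneg _),
    prod, Finset.mul_sum]
  refine Real.sqrt_le_sqrt (Finset.sum_le_sum fun T _ => ?_)
  rw [LocalSigma.compNorm, Real.sq_sqrt (h0 T)]
  exact h T

theorem opNorm_le_compNorm {τ : GlobalSigma ℓ M x} {C : ℝ} (hC : 0 ≤ C)
    (h0 : ∀ T, 0 ≤ (τ.restrict T).compNormSq)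
    (h : ∀ T, LocalSigma.prod (τ.restrict T) (τ.restrict T) ≤
      C ^ 2 * (τ.restrict T).compNormSq) :
    τ.opNorm ≤ C * τ.compNorm := by
  rw [compNorm, opNorm, ← Real.sqrt_sq hC, ← Real.sqrt_mul (sq_nonneg _),
    prod, Finset.mul_sum]
  refine Real.sqrt_le_sqrt (Finset.sum_le_sum fun T _ => ?_)
  rw [LocalSigma.compNorm, Real.sq_sqrt (h0 T)]
  exact h T

end GlobalSigma

end PlatesComplex

theorem mainTheorem6 (ℓ : ℕ) (hℓ : 2 ≤ ℓ) (ρ : ℝ) (hρ : 0 < ρ) (hρ1 : ρ < 1) :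
    ∃ C : ℝ, 0 < C ∧
      ∀ (Ω : Set PlatesComplex.Plane), PlatesComplex.IsPolygonalDomain Ω →
      ∀ (M : PlatesComplex.PolygonalMesh Ω), M.IsRegular ρ →
      ∀ (x : {T // T ∈ M.elems} → PlatesComplex.Plane), (∀ T, x T ∈ T.1) →
        (∀ (T : {T // T ∈ M.elems}) (τ : PlatesComplex.LocalSigma ℓ (M.element x T)),
          τ.compNorm ≤ C * τ.opNorm ∧ τ.opNorm ≤ C * τ.compNorm) ∧
        (∀ τ : PlatesComplex.GlobalSigma ℓ M x,
          τ.compNorm ≤ C * τ.opNorm ∧ τ.opNorm ≤ C * τ.compNorm) := by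
  -- Writing `ℓ = m + 2` makes the truncated differences `ℓ - 1` and `ℓ - 2` genuine degrees.
  obtain ⟨m, rfl⟩ := Nat.exists_eq_add_of_le' hℓ
  have hR : 1 ≤ 4 / ρ ^ 2 := by
    rw [one_le_div (by positivity)]
    nlinarith
  obtain ⟨C, hC, h⟩ :=
    PlatesComplex.LocalSigma.exists_norm_equivalence m ⌈36 / ρ ^ 4⌉₊ hR
  refine ⟨C, hC, fun Ω _ M hM x hx => ?_⟩
  have hloc := fun T => h (M.element x T) (M.isShapeRegular_element hρ hM x hx T)
  exact ⟨fun T τ => ⟨PlatesComplex.LocalSigma.compNorm_le_opNorm hC.le (hloc T τ).2.2.1,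
      PlatesComplex.LocalSigma.opNorm_le_compNorm hC.le (hloc T τ).2.2.2⟩,
    fun τ => ⟨PlatesComplex.GlobalSigma.compNorm_le_opNorm hC.le
        (fun T => (hloc T _).1) fun T => (hloc T _).2.2.1,
      PlatesComplex.GlobalSigma.opNorm_le_compNorm hC.le
        (fun T => (hloc T _).1) fun T => (hloc T _).2.2.2⟩⟩
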